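/- Let $\mathbb F_q$ be a finite field of characteristic $\ne 2$, let $\delta\in\mathbb F_q^*$ be a fixed non-square, let $n\ge 0$, and consider one of the series $B_n$, $C_n$, $D_n$. **Matrices.** Put $M=2n+1$ for $B_n$ and $M=2n$ for $C_n,D_n$. Rows and columns of $M\times M$ matrices over $\mathbb F_q$ are numbered, in decreasing order, by $n>\dots>1>0>-1>\dots>-n$ for $B_n$ and by the same list without $0$ for $C_n,D_n$. Let $X^\dagger=JX^{t}J^{-1}$, where $J$ is the matrix with $1$ on the antidiagonal and $0$ elsewhere for $B_n,D_n$, and $J=\begin{pmatrix}0&\mathbb I_n\\-\mathbb I_n&0\end{pmatrix}$ for $C_n$, $\mathbb I_n$ being the $n\times n$ matrix with $1$ on the antidiagonal and $0$ elsewhere. The set of indices is partitioned into consecutive segments $I_\ell,\dots,I_0,\dots,I_{-\ell}$, numbered in the order of the indices, with $-I_k=I_{-k}$ ($I_0$ may be empty for $C_n$, $D_n$). **Contraction.** Let $\mathbf p$ be the algebra of block upper triangular matrices of $\mathfrak{gl}(M)$ with respect to the segments, and $\mathcal U_+$, $\mathcal U_-$ the spaces of strictly block upper and strictly block lower triangular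 matrices; $\mathcal U_-$ is identified with $\mathcal U_+^*$ by the trace form. The associative algebra $\mathfrak{gl}^a(M)=\mathbf p\oplus\mathcal U_-$ has the matrix product on $\mathbf p$, zero product on $\mathcal U_-$, and $(p\lambda)(x)=\lambda(xp)$, $(\lambda p)(x)=\lambda(px)$ for $p\in\mathbf p$, $\lambda\in\mathcal U_-$, $x\in\mathcal U_+$. Let $\mathbf G^a=\mathbf P\ltimes\mathbf U_-^a$ be the group of its invertible elements (the parabolic contraction of $\mathrm{GL}(M,\mathbb F_q)$), and let $\mathfrak u^a=\{X\in\mathcal U_+\oplus\mathcal U_-:\ X^\dagger=-X\}$. The group $\mathbf G^a$ acts on $\mathfrak u^a$ by $g\cdot X=gXg^\dagger$, with the products of $\mathfrak{gl}^a(M)$. **Basic pairs.** Roots are identified with pairs of indices: for $i>j>0$ the positive roots $\epsilon_i-\epsilon_j$, $\epsilon_i+\epsilon_j$ with $(i,j)$, $(i,-j)$, and for $i>0$ the roots $\epsilon_i$ (case $B_n$) and $2\epsilon_i$ (case $C_n$) with $(i,0)$ and $(i,-i)$; the pair of $-\alpha$ is the transpose of the pair of $\alpha$. For $\gamma=(i,j)$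 put $\gamma'=(-j,-i)$, and let $E_\gamma$ be the matrix unit at $\gamma$. The root vector of $\gamma$ is $\mathcal E_\gamma=E_\gamma$ if $\gamma=\gamma'$, and $\mathcal E_\gamma=E_\gamma-E_\gamma^\dagger$ (a combination $E_\gamma\pm E_{\gamma'}$) otherwise. Let $\Delta(\mathfrak u^a)$ be the set of roots whose root vector lies in $\mathfrak u^a$. A subset $D\subset\Delta(\mathfrak u^a)$ is a rook placement if $D\cup D'$, $D'=\{\gamma':\gamma\in D\}$, has at most one pair in every row and in every column. For a rook placement $D$ and a map $\varphi:D\to\mathbb F_q^*$ put $X_{D,\varphi}=\sum_{\gamma\in D}\varphi(\gamma)\mathcal E_\gamma$. For $B_n$ and $D_n$, $(D,\varphi)$ is a basic pair if $\varphi\equiv1$. For $C_n$, $(D,\varphi)$ is a basic pair if (1) $\varphi(\gamma)\in\{1,\delta\}$ for all $\gamma \in D$; (2) $\varphi(\gamma)=\delta$ implies that $\gamma=(i,-i)$ for some $i$; (3) for every $k$, all elements of $D\cap(I_k\times I_{-k})$ have the form $(i,-i)$, and $\varphi=\delta$ for at most one of them. **Weyl group.** Let $W_{\mathbf L}$ be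 the group of permutations of the indices preserving every segment $I_k$ (the Weyl group of $\mathbf L=\prod_k \mathrm{GL}(I_k)$), embedded in $\mathbf G^a$ by permutation matrices. For $w\in W_{\mathbf L}$ and $\gamma\in\Delta(\mathfrak u^a)$ one has $w\mathcal E_\gamma w^\dagger=\pm\mathcal E_{w\cdot\gamma}$ for a root $w\cdot\gamma\in\Delta(\mathfrak u^a)$. When $(D,\varphi)$ is a basic pair, $w\cdot(D,\varphi)$ is the basic pair $(w\cdot D,\psi)$ with $\psi(w\cdot\gamma)=\varphi(\gamma)$. **Theorem.** 1) Every $\mathbf G^a$-orbit in $\mathfrak u^a$ contains an element $X_{D,\varphi}$ for some basic pair $(D,\varphi)$. 2) For basic pairs $(D,\varphi)$ and $(D',\varphi')$, the elements $X_{D,\varphi}$ and $X_{D',\varphi'}$ lie in a common $\mathbf G^a$-orbit if and only if $(D,\varphi)$ and $(D',\varphi')$ lie in a common $W_{\mathbf L}$-orbit. -/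

import Mathlib

namespace ParabolicContraction

open Matrix

noncomputable section

/-- The series `B_n`, `C_n`, `D_n`. -/
inductive Series where
  | B
  | C
  | D
deriving DecidableEq

/-- The numbers of rows and columns: `[-n, n]` for `B_n`, and `[-n, n]` without `0` for
`C_n` and `D_n`. Rows and columns are listed in decreasing order `n > … > -n`. -/
def indices (t : Series) (n : ℕ) : Finset ℤ :=
  (Finset.Icc (-(n : ℤ)) n).filter fun i => t = Series.B ∨ i ≠ 0

/-- The index type of the `M × M` matrices, `M = 2n + 1` or `M = 2n`. -/
abbrev Idx (t : Series) (n : ℕ) : Type := {i : ℤ // i ∈ indices t n}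

/-- The symmetry `i ↦ -i` of the set of indices. -/
def Idx.neg {t : Series} {n : ℕ} (i : Idx t n) : Idx t n :=
  ⟨-i.1, by
    have h := i.2
    simp only [indices, Finset.mem_filter, Finset.mem_Icc] at h ⊢
    obtain ⟨⟨h1, h2⟩, h3⟩ := h
    exact ⟨⟨by linarith, by linarith⟩, h3.imp id fun h4 => neg_ne_zero.mpr h4⟩⟩

instance {t : Series} {n : ℕ} : Neg (Idx t n) := ⟨Idx.neg⟩

/-- A partition of the set of indices into consecutive segments `I_ℓ, …, I_0, …, I_{-ℓ}`,
symmetric relative to zero: `block i` is the number of the segment that contains `i`, the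
segments are numbered comparably with the indices, and `-I_k = I_{-k}`. The segment `I_0` may be
empty if there is no index `0`. -/
structure SymmetricPartition (t : Series) (n : ℕ) where
  block : Idx t n → ℤ
  monotone : ∀ i j : Idx t n, i.1 ≤ j.1 → block i ≤ block j
  symmetric : ∀ i : Idx t n, block (-i) = -block i

variable {K : Type*} [Field K] {t : Series} {n : ℕ}

/-- Square matrices with rows and columns numbered by the indices. -/
abbrev Mat (K : Type*) (t : Series) (n : ℕ) : Type _ := Matrix (Idx t n) (Idx t n) K

/-! ### The antiautomorphism -/

/-- The matrix with units on the antidiagonal in the orthogonal cases, and the block matrix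
`(0, I; -I, 0)`, where `I` has units on the antidiagonal, in the symplectic case. -/
def formMatrix (K : Type*) [Field K] (t : Series) (n : ℕ) : Mat K t n :=
  Matrix.of fun i j =>
    if j = -i then (if t = Series.C ∧ i.1 < 0 then -1 else 1) else 0

theorem Idx.neg_neg' (i : Idx t n) : -(-i) = i :=
  Subtype.ext (_root_.neg_neg i.1)

/-- The transpose of the form matrix is its inverse. -/
theorem formMatrix_mul_transpose : formMatrix K t n * (formMatrix K t n)ᵀ = 1 := by
  ext i j
  rw [Matrix.mul_apply, Finset.sum_eq_single (-i)]
  · have hij : (-i = -j) ↔ i = j :=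
      ⟨fun h => by rw [← Idx.neg_neg' i, h, Idx.neg_neg'], fun h => by rw [h]⟩
    by_cases h : i = j
    · subst h
      simp only [formMatrix, Matrix.of_apply, Matrix.transpose_apply, if_true, Matrix.one_apply_eq]
      split_ifs <;> simp
    · simp [formMatrix, Matrix.one_apply_ne h, hij, h]
  · intro k _ hk
    simp [formMatrix, hk]
  · simp

/-- The involutive antiautomorphism `X† = J Xᵀ J⁻¹` (`J⁻¹ = Jᵀ`), `J` the form matrix. -/
def dagger (X : Mat K t n) : Mat K t n :=
  formMatrix K t n * Xᵀ * (formMatrix K t n)ᵀ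

/-! ### The parabolic contraction of the matrix algebra and of `GL(M)` -/

/-- The component in the block upper triangular subalgebra `𝐩` of the decomposition
`gl(M) = 𝐩 ⊕ 𝒰₋` (recall that larger indices come first). -/
def parabolicPart (I : SymmetricPartition t n) (X : Mat K t n) : Mat K t n :=
  Matrix.of fun i j => if I.block j ≤ I.block i then X i j else 0

/-- The component in the space `𝒰₋` of strictly block lower triangular matrices. -/
def lowerPart (I : SymmetricPartition t n) (X : Mat K t n) : Mat K t n :=
  Matrix.of fun i j => if I.block i < I.block j then X i j else 0

/-- The multiplication of the associative algebra `gl^a(M) = 𝐩 ⊕ 𝒰₋^a`: on `𝐩` it is matrix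
multiplication, on `𝒰₋^a` it is zero, and `𝐩` acts on `𝒰₋^a`, identified by the trace form with
the dual space of `𝒰₊`, by `(pl)(x) = l(xp)` and `(lp)(x) = l(px)`; under this identification
`pl` and `lp` are the matrix products projected to `𝒰₋` along `𝐩`. -/
def contractedMul (I : SymmetricPartition t n) (X Y : Mat K t n) : Mat K t n :=
  parabolicPart I X * parabolicPart I Y +
    lowerPart I (parabolicPart I X * lowerPart I Y + lowerPart I X * parabolicPart I Y)

/-- The parabolic contraction `𝐆^a = 𝐏 ⋉ 𝐔₋^a` of `GL(M)`, that is, the set of invertible elements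
of the associative algebra `gl^a(M)`. -/
def contractedGL (I : SymmetricPartition t n) : Set (Mat K t n) :=
  {g | ∃ h : Mat K t n, contractedMul I g h = 1 ∧ contractedMul I h g = 1}

/-- `g • X = g X g†`, with the products taken in `gl^a(M)`. -/
def daggerAction (I : SymmetricPartition t n) (g X : Mat K t n) : Mat K t n :=
  contractedMul I (contractedMul I g X) (dagger g)

/-- The space `𝔲^a = 𝔲₊ ⊕ 𝔲₋^a`: matrices with zero diagonal blocks such that `X† = -X`. -/
def nilradical (I : SymmetricPartition t n) : Set (Mat K t n) :=
  {X | (∀ i j, I.block i = I.block j → X i j = 0) ∧ dagger X = -X}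

/-- Two matrices lie in a common `𝐆^a`-orbit. -/
def SameOrbit (I : SymmetricPartition t n) (X Y : Mat K t n) : Prop :=
  ∃ g ∈ contractedGL I, daggerAction I g X = Y

/-! ### Roots -/

/-- The pairs of the positive roots: `(i, j)` and `(i, -j)` with `i > j > 0` for `ε_i - ε_j` and
`ε_i + ε_j`, and `(i, 0)` for `ε_i` in `B_n`, and `(i, -i)` for `2ε_i` in `C_n`. -/
def IsPositiveRoot (p : Idx t n × Idx t n) : Prop :=
  0 < p.1.1 ∧ p.2.1 < p.1.1 ∧ (-p.1.1 < p.2.1 ∨ (t = Series.C ∧ p.2.1 = -p.1.1))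

/-- The pairs of the roots; the pair of a negative root is transposed to that of its opposite. -/
def IsRoot (p : Idx t n × Idx t n) : Prop :=
  IsPositiveRoot p ∨ IsPositiveRoot p.swap

/-- `(i, j)' = (-j, -i)`. -/
def prime (p : Idx t n × Idx t n) : Idx t n × Idx t n := (-p.2, -p.1)

/-- The root vector: the matrix unit `E` at `p`, if `p = p'`, and otherwise
`E - E†`, which is the sum of the matrix units at `p` and at `p'`, the latter with the sign that
makes the sum satisfy `X† = -X`. -/
def rootVector (K : Type*) [Field K] (p : Idx t n × Idx t n) : Mat K t n :=
  if prime p = p then Matrix.single p.1 p.2 1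
  else Matrix.single p.1 p.2 1 - dagger (Matrix.single p.1 p.2 1)

/-- The roots whose root vectors lie in `𝔲^a`: those outside the diagonal blocks. -/
def IsRadicalRoot (I : SymmetricPartition t n) (p : Idx t n × Idx t n) : Prop :=
  IsRoot p ∧ I.block p.1 ≠ I.block p.2

/-- `D ∪ D'` has at most one pair in any row and in any column. -/
def IsRookPlacement (D : Finset (Idx t n × Idx t n)) : Prop :=
  ∀ p ∈ D ∪ D.image prime, ∀ q ∈ D ∪ D.image prime, (p.1 = q.1 ∨ p.2 = q.2) → p = q

/-- `X_{D,φ}`, the sum of `φ(γ)` times the root vector of `γ` over `γ ∈ D`. -/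
def rookMatrix (D : Finset (Idx t n × Idx t n)) (φ : D → Kˣ) : Mat K t n :=
  ∑ γ : D, (φ γ : K) • rootVector K γ.1

/-! ### Basic pairs -/

/-- `(D, φ)` is a basic pair, with respect to the fixed non-square `δ`. -/
structure IsBasicPair (I : SymmetricPartition t n) (δ : Kˣ)
    (D : Finset (Idx t n × Idx t n)) (φ : D → Kˣ) : Prop where
  roots : ∀ γ ∈ D, IsRadicalRoot I γ
  rook : IsRookPlacement D
  orthogonal : t ≠ Series.C → ∀ γ, φ γ = 1
  symplectic_values : t = Series.C → ∀ γ, φ γ = 1 ∨ φ γ = δ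
  symplectic_antidiagonal : t = Series.C → ∀ γ, φ γ = δ → γ.1.2 = -γ.1.1
  /-- `D ∩ (I_k × I_{-k})` is contained in the antidiagonal, for all `k`. -/
  symplectic_block : t = Series.C → ∀ γ ∈ D, I.block γ.2 = -I.block γ.1 → γ.2 = -γ.1
  /-- There is at most one `γ` in `D ∩ (I_k × I_{-k})` with `φ(γ) = δ`, for all `k`. -/
  symplectic_unique : t = Series.C → ∀ γ₁ γ₂ : D,
    I.block γ₁.1.2 = -I.block γ₁.1.1 → I.block γ₂.1.2 = -I.block γ₂.1.1 →
    I.block γ₁.1.1 = I.block γ₂.1.1 → φ γ₁ = δ → φ γ₂ = δ → γ₁ = γ₂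

/-- The Weyl group of the Levi subgroup `𝐋 = ∏ GL(I_k)` of `GL(M)`: permutations of the indices
that preserve every segment. -/
def weylGroup (I : SymmetricPartition t n) : Subgroup (Equiv.Perm (Idx t n)) where
  carrier := {w | ∀ i, I.block (w i) = I.block i}
  mul_mem' := fun {a b} ha hb i => by
    rw [Equiv.Perm.mul_apply, ha, hb]
  one_mem' := fun _ => rfl
  inv_mem' := fun {a} ha i => by
    have h := ha (a⁻¹ i)
    simpa using h.symm

/-- The permutation matrix with units at `(w i, i)`. -/
def weylMatrix (K : Type*) [Field K] (w : Equiv.Perm (Idx t n)) : Mat K t n :=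
  Matrix.of fun i j => if i = w j then 1 else 0

/-- `β = w • γ` for the action on roots that is obtained by restriction of the action
`X ↦ g X g†`: the permutation matrix of `w` takes the root vector of `γ` to the root vector of `β`,
up to sign. -/
def WeylMapsTo (K : Type*) [Field K] (I : SymmetricPartition t n) (w : Equiv.Perm (Idx t n))
    (γ β : Idx t n × Idx t n) : Prop :=
  daggerAction I (weylMatrix K w) (rootVector K γ) = rootVector K β ∨
    daggerAction I (weylMatrix K w) (rootVector K γ) = -rootVector K β

/-- `(D₁, φ₁)` and `(D₂, φ₂)` lie in a common orbit of the Weyl group of `𝐋`: for some `w`,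
`D₂ = w • D₁` and `φ₂(w • γ) = φ₁(γ)`. -/
def WeylConjugate (I : SymmetricPartition t n)
    (D₁ : Finset (Idx t n × Idx t n)) (φ₁ : D₁ → Kˣ)
    (D₂ : Finset (Idx t n × Idx t n)) (φ₂ : D₂ → Kˣ) : Prop :=
  ∃ w ∈ weylGroup I,
    (∀ γ : D₁, ∃ β : D₂, WeylMapsTo K I w γ.1 β.1 ∧ φ₂ β = φ₁ γ) ∧
    (∀ β : D₂, ∃ γ : D₁, WeylMapsTo K I w γ.1 β.1 ∧ φ₂ β = φ₁ γ)

end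

end ParabolicContraction

/-! Right multiplication by the form matrix `J` turns `X` with `X† = -X` into a bilinear form `Y =
XJ` with `Yᵀ = ηY`, where `η = 1` for `C_n` and `η = -1` for `B_n`, `D_n`, and turns `g X g†` into
`g Y gᵀ`. The block `(k, l)` of `X` becomes the block `(k, -l)` of `Y`, so the parabolic part of `X`
is the part `Y₊` of `Y` on blocks with sum `≥ 0`, and the lower part is `Y₋`, on blocks with
negative sum. For an element of the contraction with components `g` and `u`, the action reads `Y₊ ↦
g Y₊ gᵀ` and `Y₋ ↦ (g Y₋ gᵀ + g Y₊ uᵀ + u Y₊ gᵀ)₋` (`sameOrbit_iff`).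

Existence. Block triangular Gaussian elimination, with pivots taken in the lowest possible blocks,
brings `Y₊` to a monomial form `R`. The terms with `u` then remove everything in `Y₋` that meets the
support of `R`, and the remainder is reduced by congruences that do not touch this support
(`exists_formOrbit_normal`). For `η = 1` the entries inside a block are diagonalized. Over a finite
field a binary quadratic form represents everything, so all loops (diagonal entries) of a block
except at most one become standard, and the last is standard up to the factor `δ`.

Uniqueness. For monomial forms in a common orbit, comparison of entries shows that a submatrix of
`g` has a one-sided inverse. Hence the number of rows of the block `k` paired with the block `l` is
invariant, and for `η = 1` so is the product of the loops of a block modulo squares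
(`Transfer.card_le`, `Transfer.exists_prod_eq`). For `Y₋` the argument is restricted to the zero
rows of `Y₊`, where `u` has no effect. These invariants determine a normal form up to permutations
inside the blocks (`FormOrbit.combEquiv`). Conversely, such a permutation and a rescaling lie in the
group (`CombEquiv.formOrbit`). Finally, normal forms up to block permutations are the same as basic
pairs up to `W_L` (`combEquiv_iff`, `exists_isBasicPair`). -/

namespace ParabolicContraction

open Matrix

/-! ### The contracted action on bilinear forms. -/

section Forms

variable {ι K : Type*} [Fintype ι] [DecidableEq ι] [Field K]

/-- Block upper triangular matrices: the row `i` involves only columns of smaller blocks. -/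
def IsUpper (b : ι → ℤ) (g : Matrix ι ι K) : Prop := ∀ i j, b i < b j → g i j = 0

/-- The part of a form on the pairs of blocks with nonnegative sum. -/
def posPart (b : ι → ℤ) (Y : Matrix ι ι K) : Matrix ι ι K :=
  Matrix.of fun i j => if 0 ≤ b i + b j then Y i j else 0

/-- The part of a form on the pairs of blocks with negative sum. -/
def negPart (b : ι → ℤ) (Y : Matrix ι ι K) : Matrix ι ι K :=
  Matrix.of fun i j => if b i + b j < 0 then Y i j else 0

variable {b : ι → ℤ} {g h A B Y Y₁ Y₂ Y₃ : Matrix ι ι K}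

omit [Fintype ι] in
theorem IsUpper.one : IsUpper b (1 : Matrix ι ι K) := fun i j hij =>
  Matrix.one_apply_ne fun h => by simp [h] at hij

omit [DecidableEq ι] in
theorem IsUpper.mul (hA : IsUpper b A) (hB : IsUpper b B) : IsUpper b (A * B) := fun i j hij => by
  rw [Matrix.mul_apply]
  refine Finset.sum_eq_zero fun k _ => ?_
  rcases lt_or_ge (b i) (b k) with h | h
  · rw [hA i k h, zero_mul]
  · rw [hB k j (h.trans_lt hij), mul_zero]

omit [DecidableEq ι] in
theorem IsUpper.mul_posPart (hA : IsUpper b A) (hB : posPart b B = B) :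
    posPart b (A * B) = A * B := by
  ext i j
  simp only [posPart, Matrix.of_apply, ite_eq_left_iff, not_le]
  intro hij
  rw [Matrix.mul_apply]
  refine (Finset.sum_eq_zero fun k _ => ?_).symm
  rcases lt_or_ge (b i) (b k) with h | h
  · rw [hA i k h, zero_mul]
  · rw [← hB]
    simp only [posPart, Matrix.of_apply]
    rw [if_neg (by linarith), mul_zero]

omit [Fintype ι] [DecidableEq ι] in
theorem posPart_transpose : (posPart b A)ᵀ = posPart b Aᵀ := by
  ext i j; simp [posPart, add_comm]

omit [Fintype ι] [DecidableEq ι] in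
theorem posPart_posPart : posPart b (posPart b A) = posPart b A := by
  ext i j; simp only [posPart, Matrix.of_apply]; split_ifs <;> rfl

omit [Fintype ι] [DecidableEq ι] in
theorem posPart_add_negPart : posPart b A + negPart b A = A := by
  ext i j
  simp only [posPart, negPart, Matrix.of_apply, Matrix.add_apply]
  rcases lt_or_ge (b i + b j) 0 with h | h
  · simp [h]
  · simp [h, not_lt.2 h]

omit [Fintype ι] [DecidableEq ι] in
theorem negPart_add : negPart b (A + B) = negPart b A + negPart b B := by
  ext i j; simp only [negPart, Matrix.of_apply, Matrix.add_apply]; split_ifs <;> simp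

omit [Fintype ι] [DecidableEq ι] in
theorem negPart_eq_zero (h : posPart b A = A) : negPart b A = 0 := by
  have := posPart_add_negPart (b := b) (A := A)
  rwa [h, add_eq_left] at this

omit [DecidableEq ι] in
theorem IsUpper.posPart_mul_transpose (hA : IsUpper b A) (hB : posPart b B = B) :
    posPart b (B * Aᵀ) = B * Aᵀ := by
  have h := hA.mul_posPart (B := Bᵀ) (by rw [← posPart_transpose, hB])
  apply_fun Matrix.transpose at h
  rwa [posPart_transpose, Matrix.transpose_mul, Matrix.transpose_transpose] at h

omit [DecidableEq ι] in
-- Upper congruences preserve the forms supported on blocks with nonnegative sum, so negative parts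
-- form a quotient on which they act.
theorem IsUpper.negPart_congr (hg : IsUpper b g) :
    negPart b (g * negPart b A * gᵀ) = negPart b (g * A * gᵀ) := by
  conv_rhs => rw [← posPart_add_negPart (b := b) (A := A), mul_add, add_mul, negPart_add,
    negPart_eq_zero (hg.posPart_mul_transpose (hg.mul_posPart posPart_posPart)), zero_add]

/-- The orbits of the parabolic contraction in terms of the forms `X J`. -/
def FormOrbit (b : ι → ℤ) (Y Y' : Matrix ι ι K) : Prop :=
  ∃ g h u : Matrix ι ι K, IsUpper b g ∧ IsUpper b h ∧ g * h = 1 ∧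
    posPart b Y' = g * posPart b Y * gᵀ ∧
    negPart b Y' =
      negPart b (g * negPart b Y * gᵀ + g * posPart b Y * uᵀ + u * posPart b Y * gᵀ)

theorem FormOrbit.trans (h₁ : FormOrbit b Y₁ Y₂) (h₂ : FormOrbit b Y₂ Y₃) :
    FormOrbit b Y₁ Y₃ := by
  obtain ⟨g₁, k₁, u₁, hg₁, hk₁, e₁, p₁, n₁⟩ := h₁
  obtain ⟨g₂, k₂, u₂, hg₂, hk₂, e₂, p₂, n₂⟩ := h₂
  -- The product of `g₂ + u₂` and `g₁ + u₁`, without the term `u₂ u₁` that vanishes in the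
  -- contraction.
  refine ⟨g₂ * g₁, k₁ * k₂, g₂ * u₁ + u₂ * g₁, hg₂.mul hg₁, hk₁.mul hk₂, ?_, ?_, ?_⟩
  · rw [mul_assoc, ← mul_assoc g₁, e₁, one_mul, e₂]
  · rw [p₂, p₁, Matrix.transpose_mul]; simp only [mul_assoc]
  · rw [n₂, negPart_add, negPart_add, n₁, hg₂.negPart_congr, p₁, ← negPart_add, ← negPart_add]
    congr 1
    simp only [Matrix.transpose_mul, Matrix.transpose_add, mul_add, add_mul, mul_assoc]
    abel

theorem FormOrbit.symm (h₁ : FormOrbit b Y₁ Y₂) : FormOrbit b Y₂ Y₁ := by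
  obtain ⟨g, h, u, hg, hh, e, p, m⟩ := h₁
  have e' : h * g = 1 := mul_eq_one_comm.1 e
  have et : gᵀ * hᵀ = 1 := by rw [← Matrix.transpose_mul, e', Matrix.transpose_one]
  -- The inverse of `g + u` to first order in `u`.
  refine ⟨h, g, -(h * u * h), hh, hg, e', ?_, ?_⟩
  · rw [p]
    calc _ = (h * g) * posPart b Y₁ * (gᵀ * hᵀ) := by rw [e', et]; simp
      _ = _ := by simp only [mul_assoc]
  · rw [negPart_add, negPart_add, m, hh.negPart_congr, p, ← negPart_add, ← negPart_add]
    have key : ∀ N P : Matrix ι ι K, h * (g * N * gᵀ + g * P * uᵀ + u * P * gᵀ) * hᵀ +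
        h * (g * P * gᵀ) * (-(h * u * h))ᵀ + -(h * u * h) * (g * P * gᵀ) * hᵀ = N := by
      intro N P
      have h1 : ∀ Z : Matrix ι ι K, h * (g * Z) = Z := fun Z => by rw [← mul_assoc, e', one_mul]
      have h2 : ∀ Z : Matrix ι ι K, gᵀ * (hᵀ * Z) = Z := fun Z => by rw [← mul_assoc, et, one_mul]
      simp only [Matrix.transpose_mul, Matrix.transpose_neg, mul_add, add_mul, mul_assoc, h1, h2,
        et, mul_one, neg_mul, mul_neg]
      abel
    rw [key]
    ext i j; simp only [negPart, Matrix.of_apply]; split_ifs <;> rfl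

end Forms

/-! ### Monomial forms with equivalent supports lie in a common orbit. -/

section Forms

set_option linter.unusedSectionVars false

variable {ι K : Type*} [Fintype ι] [DecidableEq ι] [Field K]
variable {b : ι → ℤ} {η : K} {Y Y₁ Y₂ : Matrix ι ι K}

/-- Every row has at most one nonzero entry. -/
def IsMono (Y : Matrix ι ι K) : Prop := ∀ i j j', Y i j ≠ 0 → Y i j' ≠ 0 → j = j'

/-- The supports correspond under a permutation that preserves the blocks, and the diagonal
entries are equal. -/
def CombEquiv (b : ι → ℤ) (Y₁ Y₂ : Matrix ι ι K) : Prop :=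
  ∃ w : Equiv.Perm ι, (∀ i, b (w i) = b i) ∧ (∀ i j, Y₂ (w i) (w j) ≠ 0 ↔ Y₁ i j ≠ 0) ∧
    ∀ i, Y₂ (w i) (w i) = Y₁ i i

/-- The product of a permutation matrix and a diagonal matrix. -/
def permDiag (w : Equiv.Perm ι) (d : ι → K) : Matrix ι ι K :=
  Matrix.of fun i j => if i = w j then d j else 0

theorem permDiag_apply (w : Equiv.Perm ι) (d : ι → K) (i j : ι) :
    permDiag w d (w i) j = if i = j then d i else 0 := by
  simp only [permDiag, Matrix.of_apply, EmbeddingLike.apply_eq_iff_eq]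
  split_ifs with h
  · rw [h]
  · rfl

theorem permDiag_congr (w : Equiv.Perm ι) (d : ι → K) (A : Matrix ι ι K) (i j : ι) :
    (permDiag w d * A * (permDiag w d)ᵀ) (w i) (w j) = d i * A i j * d j := by
  simp [Matrix.mul_apply, permDiag_apply]

theorem permDiag_mul (w : Equiv.Perm ι) (d : ι → K) (hd : ∀ i, d i ≠ 0) :
    permDiag w d * permDiag w⁻¹ (fun i => (d (w⁻¹ i))⁻¹) = 1 := by
  ext i j
  obtain ⟨i, rfl⟩ := w.surjective i
  rw [Matrix.mul_apply, Finset.sum_eq_single i]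
  · rw [permDiag_apply]
    simp only [permDiag, Matrix.of_apply, if_true, Matrix.one_apply]
    by_cases h : w i = j
    · subst h; simp [hd]
    · rw [if_neg h, if_neg (fun h' => h (by simp [h'])), mul_zero]
  · intro k _ hk
    rw [permDiag_apply, if_neg (Ne.symm hk), zero_mul]
  · simp

theorem permDiag_isUpper {w : Equiv.Perm ι} (hw : ∀ i, b (w i) = b i) (d : ι → K) :
    IsUpper b (permDiag w d) := by
  intro i j hij
  simp only [permDiag, Matrix.of_apply]
  rw [if_neg]
  rintro rfl
  rw [hw] at hij
  exact lt_irrefl _ hij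

/-- In a monomial form every index meets at most one edge, so edges can be rescaled independently.
Loops scale only by squares, hence the requirement that they agree. -/
theorem exists_scaling [LinearOrder ι] (hη : η ≠ 0) (h₁ : ∀ i j, Y₁ j i = η * Y₁ i j)
    (h₂ : ∀ i j, Y₂ j i = η * Y₂ i j) (hm : IsMono Y₁) (hs : ∀ i j, Y₂ i j ≠ 0 ↔ Y₁ i j ≠ 0)
    (hd : ∀ i, Y₂ i i = Y₁ i i) :
    ∃ d : ι → K, (∀ i, d i ≠ 0) ∧ ∀ i j, Y₂ i j = d i * Y₁ i j * d j := by
  classical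
  -- An edge is rescaled at its smaller end only; larger ends, loops and zero rows get the factor 1.
  let d : ι → K := fun i => if h : ∃ j, i < j ∧ Y₁ i j ≠ 0 then
    Y₂ i h.choose / Y₁ i h.choose else 1
  have d1 : ∀ i j, i < j → Y₁ i j ≠ 0 → d i = Y₂ i j / Y₁ i j := by
    intro i j hij hY
    have h : ∃ j, i < j ∧ Y₁ i j ≠ 0 := ⟨j, hij, hY⟩
    have e : h.choose = j := hm i _ _ h.choose_spec.2 hY
    simp only [d, dif_pos h, e]
  have d2 : ∀ i j, j ≤ i → Y₁ i j ≠ 0 → d i = 1 := by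
    intro i j hij hY
    simp only [d]
    rw [dif_neg]
    rintro ⟨j', hj', hY'⟩
    rw [hm i j j' hY hY'] at hij
    exact absurd hj' (not_lt.2 hij)
  have sw : ∀ i j, Y₁ i j ≠ 0 → Y₁ j i ≠ 0 := fun i j h => by
    rw [h₁]; exact mul_ne_zero hη h
  refine ⟨d, fun i => ?_, fun i j => ?_⟩
  · by_cases h : ∃ j, i < j ∧ Y₁ i j ≠ 0
    · obtain ⟨j, hij, hY⟩ := h
      rw [d1 i j hij hY]
      exact div_ne_zero ((hs i j).2 hY) hY
    · simp [d, dif_neg h]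
  · by_cases hY : Y₁ i j = 0
    · rw [hY]; simp only [mul_zero, zero_mul]
      by_contra h; exact (hs i j).1 h hY
    rcases lt_trichotomy i j with h | h | h
    · rw [d1 i j h hY, d2 j i h.le (sw i j hY)]; field_simp
    · subst h; rw [d2 i i le_rfl hY, hd]; ring
    · have := sw i j hY
      rw [d2 i j h.le hY, d1 j i h this, h₁ j i, h₂ j i]; field_simp

theorem CombEquiv.formOrbit [LinearOrder ι] (hη : η ≠ 0) (h₁ : ∀ i j, Y₁ j i = η * Y₁ i j)
    (h₂ : ∀ i j, Y₂ j i = η * Y₂ i j) (hm : IsMono Y₁) (h : CombEquiv b Y₁ Y₂) :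
    FormOrbit b Y₁ Y₂ := by
  obtain ⟨w, hw, hs, hd⟩ := h
  obtain ⟨d, d0, hY⟩ := exists_scaling (Y₂ := Y₂.submatrix w w) hη h₁ (fun i j => h₂ _ _) hm hs hd
  have hw' : ∀ i, b (w⁻¹ i) = b i := fun i => by rw [← hw]; simp
  refine ⟨_, _, 0, permDiag_isUpper hw d, permDiag_isUpper hw' _, permDiag_mul w d d0, ?_, ?_⟩
  · ext i j
    obtain ⟨i, rfl⟩ := w.surjective i
    obtain ⟨j, rfl⟩ := w.surjective j
    rw [permDiag_congr]
    simp only [posPart, Matrix.of_apply, hw]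
    split_ifs
    · exact hY i j
    · simp
  · rw [Matrix.transpose_zero, mul_zero, zero_mul, zero_mul, add_zero, add_zero]
    ext i j
    obtain ⟨i, rfl⟩ := w.surjective i
    obtain ⟨j, rfl⟩ := w.surjective j
    simp only [negPart, Matrix.of_apply, hw]
    split_ifs
    · rw [permDiag_congr, Matrix.of_apply, if_pos ‹_›]
      exact hY i j
    · rfl

end Forms

/-! ### Block triangular elimination to a monomial form. -/

section Forms

set_option linter.unusedSectionVars false

variable {ι K : Type*} [Fintype ι] [DecidableEq ι] [Field K]
variable {b : ι → ℤ} {S : Set ι} {η : K} {g h Y Y' Y₁ Y₂ Y₃ : Matrix ι ι K}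

/-- Block upper triangular matrices that act trivially on the coordinates in `S`. -/
def IsInertUpper (b : ι → ℤ) (S : Set ι) (g : Matrix ι ι K) : Prop :=
  IsUpper b g ∧ ∀ i ∈ S, ∀ j, g i j = (1 : Matrix ι ι K) i j ∧ g j i = (1 : Matrix ι ι K) j i

/-- Congruence by block upper triangular matrices that act trivially on the coordinates in `S`. -/
def UpperCongr (b : ι → ℤ) (S : Set ι) (Y Y' : Matrix ι ι K) : Prop :=
  ∃ g h : Matrix ι ι K, IsInertUpper b S g ∧ IsInertUpper b S h ∧ g * h = 1 ∧ Y' = g * Y * gᵀ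

theorem IsInertUpper.one : IsInertUpper b S (1 : Matrix ι ι K) :=
  ⟨IsUpper.one, fun _ _ _ => ⟨rfl, rfl⟩⟩

theorem IsInertUpper.mul (hg : IsInertUpper b S g) (hh : IsInertUpper b S h) :
    IsInertUpper b S (g * h) := by
  refine ⟨hg.1.mul hh.1, fun i hi j => ⟨?_, ?_⟩⟩
  · simp only [Matrix.mul_apply, (hg.2 i hi _).1, ← (hh.2 i hi j).1]
    rw [← Matrix.mul_apply, one_mul]
  · simp only [Matrix.mul_apply, (hh.2 i hi _).2, ← (hg.2 i hi j).2]
    rw [← Matrix.mul_apply, mul_one]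

theorem UpperCongr.refl : UpperCongr b S Y Y :=
  ⟨1, 1, .one, .one, by simp, by simp⟩

theorem UpperCongr.trans (h₁ : UpperCongr b S Y₁ Y₂) (h₂ : UpperCongr b S Y₂ Y₃) :
    UpperCongr b S Y₁ Y₃ := by
  obtain ⟨g₁, k₁, hg₁, hk₁, e₁, rfl⟩ := h₁
  obtain ⟨g₂, k₂, hg₂, hk₂, e₂, rfl⟩ := h₂
  refine ⟨g₂ * g₁, k₁ * k₂, hg₂.mul hg₁, hk₁.mul hk₂, ?_, ?_⟩
  · rw [mul_assoc, ← mul_assoc g₁, e₁, one_mul, e₂]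
  · rw [Matrix.transpose_mul]; simp only [mul_assoc]

theorem congr_symm (hY : ∀ i j, Y j i = η * Y i j) (i j : ι) :
    (g * Y * gᵀ) j i = η * (g * Y * gᵀ) i j := by
  have h : Yᵀ = η • Y := by ext i j; exact hY i j
  have h2 : (g * Y * gᵀ)ᵀ = η • (g * Y * gᵀ) := by
    rw [Matrix.transpose_mul, Matrix.transpose_mul, Matrix.transpose_transpose, h]
    simp [mul_assoc]
  exact congrFun (congrFun h2 i) j

theorem UpperCongr.symmetry (hc : UpperCongr b S Y Y') (hY : ∀ i j, Y j i = η * Y i j) (i j : ι) :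
    Y' j i = η * Y' i j := by
  obtain ⟨g, h, -, -, -, rfl⟩ := hc
  exact congr_symm hY i j

theorem UpperCongr.zero_row (hc : UpperCongr b S Y Y') {i : ι} (hi : i ∈ S)
    (h0 : ∀ j, Y i j = 0) (j : ι) : Y' i j = 0 := by
  obtain ⟨g, h, hg, -, -, rfl⟩ := hc
  rw [mul_assoc, Matrix.mul_apply]
  simp only [(hg.2 i hi _).1]
  rw [← Matrix.mul_apply, one_mul, Matrix.mul_apply]
  simp [h0]

theorem IsInertUpper.one_add {N : Matrix ι ι K}
    (hN : ∀ i j, N i j ≠ 0 → b j ≤ b i ∧ i ∉ S ∧ j ∉ S) : IsInertUpper b S (1 + N) := by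
  refine ⟨fun i j hij => ?_, fun i hi j => ⟨?_, ?_⟩⟩
  · rw [Matrix.add_apply, IsUpper.one i j hij, zero_add]
    by_contra h
    exact absurd (hN i j h).1 (not_le.2 hij)
  · rw [Matrix.add_apply, add_eq_left]
    by_contra h
    exact (hN i j h).2.1 hi
  · rw [Matrix.add_apply, add_eq_left]
    by_contra h
    exact (hN j i h).2.2 hi

theorem UpperCongr.of_nilpotent {N : Matrix ι ι K} (hN2 : N * N = 0)
    (hN : ∀ i j, N i j ≠ 0 → b j ≤ b i ∧ i ∉ S ∧ j ∉ S) :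
    UpperCongr b S Y ((1 + N) * Y * (1 + N)ᵀ) := by
  refine ⟨1 + N, 1 + -N, .one_add hN, .one_add fun i j h => hN i j (by simpa using h), ?_, rfl⟩
  rw [add_mul, mul_add, mul_add, one_mul, mul_neg, mul_neg, hN2]
  simp

/-- Adding a multiple of the row and column `p` to the row and column `q`. -/
theorem exists_upperCongr_transvection (s : K) {p q : ι} (hpq : p ≠ q) (hb : b p ≤ b q)
    (hp : p ∉ S) (hq : q ∉ S) :
    ∃ Y', UpperCongr b S Y Y' ∧ ∀ i j, Y' i j = Y i j + (if i = q then s * Y p j else 0) +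
      (if j = q then s * (Y i p + if i = q then s * Y p p else 0) else 0) := by
  refine ⟨_, UpperCongr.of_nilpotent (N := Matrix.single q p s) ?_ ?_, ?_⟩
  · simp [hpq]
  · intro i j h
    by_cases h' : q = i ∧ p = j
    · obtain ⟨rfl, rfl⟩ := h'; exact ⟨hb, hq, hp⟩
    · exact absurd (Matrix.single_apply_of_ne _ _ _ _ _ h') h
  · have row : ∀ i j, ((1 + Matrix.single q p s) * Y) i j =
        Y i j + if i = q then s * Y p j else 0 := by
      intro i j
      rw [add_mul, one_mul, Matrix.add_apply]
      congr 1
      split_ifs with h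
      · subst h; simp
      · rw [Matrix.single_mul_apply_of_ne _ _ _ _ _ h]
    intro i j
    rw [Matrix.transpose_add, Matrix.transpose_one, Matrix.transpose_single, mul_add, mul_one,
      Matrix.add_apply, row]
    congr 1
    split_ifs with h h'
    · subst h; simp [row, h', mul_comm]
    · subst h; simp [row, h', mul_comm]
    · rw [Matrix.mul_single_apply_of_ne _ _ _ _ _ h]

/-- Splitting off a nondegenerate set `T` of coordinates. -/
theorem exists_upperCongr_clear {T : Set ι}
    {N : Matrix ι ι K} (hT : ∀ i j, N i j ≠ 0 → i ∉ T ∧ j ∈ T)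
    (hN : ∀ i j, N i j ≠ 0 → b j ≤ b i ∧ i ∉ S ∧ j ∉ S)
    (hc : ∀ i ∉ T, ∀ j ∈ T, Y i j + (N * Y) i j = 0) :
    ∃ Y', UpperCongr b S Y Y' ∧ (∀ i ∈ T, ∀ j ∈ T, Y' i j = Y i j) ∧
      (∀ i ∉ T, ∀ j ∈ T, Y' i j = 0) ∧ (∀ i ∉ T, ∀ j ∉ T, Y' i j = Y i j + (N * Y) i j) := by
  have hN2 : N * N = 0 := by
    ext i j
    rw [Matrix.mul_apply]
    refine Finset.sum_eq_zero fun k _ => ?_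
    by_contra h
    exact (hT k j (right_ne_zero_of_mul h)).1 (hT i k (left_ne_zero_of_mul h)).2
  have hcg : UpperCongr b S Y _ := UpperCongr.of_nilpotent (Y := Y) hN2 hN
  have hN0 : ∀ i ∈ T, ∀ j, N i j = 0 := fun i hi j => by
    by_contra h; exact (hT i j h).1 hi
  have e : ∀ i j, ((1 + N) * Y * (1 + N)ᵀ : Matrix ι ι K) i j =
      Y i j + (N * Y) i j + ∑ k, (Y i k + (N * Y) i k) * N j k := by
    intro i j
    rw [Matrix.transpose_add, Matrix.transpose_one, mul_add, mul_one, add_mul, one_mul]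
    simp [Matrix.mul_apply]
  have e1 : ∀ i ∉ T, ∀ j, ((1 + N) * Y * (1 + N)ᵀ : Matrix ι ι K) i j = Y i j + (N * Y) i j := by
    intro i hi j
    rw [e, add_eq_left]
    refine Finset.sum_eq_zero fun k _ => ?_
    by_cases h : N j k = 0
    · rw [h, mul_zero]
    · rw [hc i hi k (hT j k h).2, zero_mul]
  refine ⟨_, hcg, ?_, ?_, fun i hi j _ => e1 i hi j⟩
  · intro i hi j hj
    rw [e]
    simp [hN0 j hj, Matrix.mul_apply, hN0 i hi]
  · intro i hi j hj
    rw [e1 i hi, hc i hi j hj]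

/-- The row `i` has at most one nonzero entry, which is alone in its column, and which is
on the diagonal if it is in a diagonal block of a symmetric matrix. -/
def GoodRow (b : ι → ℤ) (η : K) (Y : Matrix ι ι K) (i : ι) : Prop :=
  ∀ j, Y i j ≠ 0 → (∀ j', Y i j' ≠ 0 → j' = j) ∧ (∀ i', Y i' j ≠ 0 → i' = i) ∧
    (η = 1 → b i = b j → i = j)

/-- Used mostly in the contrapositive: a good row vanishes in the columns of bad rows, so
elimination among bad rows never disturbs good ones. -/
theorem GoodRow.partner (hη : η ≠ 0) (hY : ∀ i j, Y j i = η * Y i j) {i j : ι}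
    (hi : GoodRow b η Y i) (hij : Y i j ≠ 0) : GoodRow b η Y j := by
  obtain ⟨h1, h2, h3⟩ := hi j hij
  have sw : ∀ i j, Y i j ≠ 0 → Y j i ≠ 0 := fun i j h => by
    rw [hY]; exact mul_ne_zero hη h
  have hji : ∀ k, Y j k ≠ 0 → k = i := fun k hk => h2 k (sw _ _ hk)
  intro k hk
  obtain rfl := hji k hk
  exact ⟨hji, fun i' hi' => h1 i' (sw _ _ hi'), fun h h' => (h3 h h'.symm).symm⟩

/-- The column condition at `j` is, by symmetry, a condition on the row `j`, which is good as the
partner of `i` and is therefore also unchanged. -/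
theorem GoodRow.mono (hη : η ≠ 0) (hY : ∀ i j, Y j i = η * Y i j)
    (hY' : ∀ i j, Y' j i = η * Y' i j)
    (h : ∀ i, GoodRow b η Y i → ∀ j, Y' i j = Y i j) {i : ι} (hi : GoodRow b η Y i) :
    GoodRow b η Y' i := by
  intro j hj
  rw [h i hi] at hj
  have hgj := hi.partner hη hY hj
  obtain ⟨h1, h2, h3⟩ := hi j hj
  refine ⟨fun j' hj' => h1 j' (by rwa [h i hi] at hj'), fun i' hi' => h2 i' ?_, h3⟩
  rwa [hY', h j hgj, ← hY] at hi'

/-- Some congruence enlarges the set of good rows. -/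
def Improvable (b : ι → ℤ) (S : Set ι) (η : K) (Y : Matrix ι ι K) : Prop :=
  ∃ Y', UpperCongr b S Y Y' ∧ (∀ i, GoodRow b η Y i → GoodRow b η Y' i) ∧
    ∃ p, ¬ GoodRow b η Y p ∧ GoodRow b η Y' p

theorem notMem_of_not_goodRow (hS : ∀ i ∈ S, ∀ j, Y i j = 0) {i : ι} (h : ¬ GoodRow b η Y i) :
    i ∉ S := fun hi => h fun j hj => absurd (hS i hi j) hj

/-- A diagonal pivot in the lowest bad block: only bad rows need clearing, and these lie in blocks
at least `b p`, so the elimination is block upper triangular. -/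
theorem improvable_of_diag (hη : η = 1) (hY : ∀ i j, Y j i = η * Y i j)
    (hS : ∀ i ∈ S, ∀ j, Y i j = 0) {p : ι} (hp : ¬ GoodRow b η Y p) (hpp : Y p p ≠ 0)
    (hmin : ∀ a, ¬ GoodRow b η Y a → b p ≤ b a) : Improvable b S η Y := by
  have hη0 : η ≠ 0 := hη ▸ one_ne_zero
  have hg : ∀ i, GoodRow b η Y i → Y i p = 0 := fun i hi => by
    by_contra h; exact hp (hi.partner hη0 hY h)
  let N : Matrix ι ι K := Matrix.of fun i j => if i ≠ p ∧ j = p then -(Y i p / Y p p) else 0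
  have hN : ∀ i j, N i j ≠ 0 → i ≠ p ∧ j = p ∧ Y i p ≠ 0 := by
    intro i j h
    simp only [N, Matrix.of_apply, ne_eq, ite_eq_right_iff, Classical.not_imp] at h
    refine ⟨h.1.1, h.1.2, fun h0 => h.2 (by rw [h0]; simp)⟩
  have hNY : ∀ i ≠ p, ∀ j, (N * Y) i j = -(Y i p / Y p p) * Y p j := by
    intro i hi j
    rw [Matrix.mul_apply, Finset.sum_eq_single p]
    · simp [N, hi]
    · intro k _ hk; simp [N, hk]
    · simp
  obtain ⟨Y', hc, h1, h2, h3⟩ := exists_upperCongr_clear (b := b) (S := S) (Y := Y) (T := {p}) (N := N)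
    (fun i j h => ⟨(hN i j h).1, (hN i j h).2.1⟩)
    (fun i j h => by
      obtain ⟨h1, rfl, h3⟩ := hN i j h
      have : ¬ GoodRow b η Y i := fun hgi => h3 (hg i hgi)
      exact ⟨hmin i this, notMem_of_not_goodRow hS this, notMem_of_not_goodRow hS hp⟩)
    (fun i hi j hj => by
      obtain rfl : j = p := hj
      rw [hNY i hi]; field_simp; ring)
  have hY' := hc.symmetry hY
  refine ⟨Y', hc, fun i hi => hi.mono hη0 hY hY' fun i hi j => ?_, p, hp, ?_⟩
  · have hip : i ≠ p := fun h => hp (h ▸ hi)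
    by_cases hj : j = p
    · subst hj; rw [h2 i hip j rfl, hg i hi]
    · rw [h3 i hip j hj, hNY i hip, hg i hi]; simp
  · have hr : ∀ i, Y' i p ≠ 0 → i = p := fun i h => by
      by_contra hip; exact h (h2 i hip p rfl)
    have hr' : ∀ i, Y' p i ≠ 0 → i = p := fun i h => hr i (by rw [hY']; exact mul_ne_zero hη0 h)
    intro j hj
    obtain rfl := hr' j hj
    exact ⟨hr', hr, fun _ _ => rfl⟩

/-- Splitting off the plane of `p` and `q`. Row `p` may be added to any bad row by minimality of `b
p`. Row `q` is needed only for rows `i` with `Y p i ≠ 0`, and those satisfy `b q ≤ b i`. This choice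
of the pivot keeps the elimination upper triangular. -/
theorem improvable_of_hyperbolic (h2 : (2 : K) ≠ 0) (hη : η = 1 ∨ η = -1)
    (hY : ∀ i j, Y j i = η * Y i j) (hS : ∀ i ∈ S, ∀ j, Y i j = 0) {p q : ι} (hpq : p ≠ q)
    (hp : ¬ GoodRow b η Y p) (hne : Y p q ≠ 0) (hpp : Y p p = 0) (hb : b p ≤ b q)
    (hb' : η = 1 → b p ≠ b q)
    (hmin : ∀ a, ¬ GoodRow b η Y a → b p ≤ b a) (hmin' : ∀ a, Y p a ≠ 0 → b q ≤ b a) :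
    Improvable b S η Y := by
  have hη0 : η ≠ 0 := by rcases hη with rfl | rfl <;> simp
  have hne' : Y q p ≠ 0 := by rw [hY]; exact mul_ne_zero hη0 hne
  have hq : ¬ GoodRow b η Y q := fun h => hp (h.partner hη0 hY hne')
  have hg : ∀ i, GoodRow b η Y i → Y i p = 0 ∧ Y i q = 0 := fun i hi =>
    ⟨by by_contra h; exact hp (hi.partner hη0 hY h),
      by by_contra h; exact hq (hi.partner hη0 hY h)⟩
  -- As `Y p p = 0`, the column `p` is cleared by row `q` alone and determines `β`; then `α` clears
  -- the column `q`.
  let β : ι → K := fun i => -(Y i p / Y q p)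
  let α : ι → K := fun i => -((Y i q + β i * Y q q) / Y p q)
  let N : Matrix ι ι K := Matrix.of fun i j =>
    if i = p ∨ i = q then 0 else if j = p then α i else if j = q then β i else 0
  have hNY : ∀ i, i ≠ p → i ≠ q → ∀ j, (N * Y) i j = α i * Y p j + β i * Y q j := by
    intro i hi hi' j
    rw [Matrix.mul_apply, Finset.sum_eq_add p q hpq]
    · simp [N, hi, hi', hpq.symm]
    · rintro k _ ⟨hk, hk'⟩; simp [N, hk, hk']
    · simp
    · simp
  have hNg : ∀ i, GoodRow b η Y i → ∀ j, N i j = 0 := by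
    intro i hi j
    simp [N, α, β, hg i hi]
  obtain ⟨Y', hc, e1, e2, e3⟩ := exists_upperCongr_clear (b := b) (S := S) (Y := Y) (T := {p, q}) (N := N)
    (fun i j h => by
      simp only [N, Matrix.of_apply] at h
      split_ifs at h with h1 h2 h3
      · exact absurd rfl h
      · exact ⟨h1, Or.inl h2⟩
      · exact ⟨h1, Or.inr h3⟩
      · exact absurd rfl h)
    (fun i j h => by
      have hi : ¬ GoodRow b η Y i := fun hgi => h (hNg i hgi j)
      refine ⟨?_, notMem_of_not_goodRow hS hi, ?_⟩
      · simp only [N, Matrix.of_apply] at h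
        split_ifs at h with h1 h2 h3
        · exact absurd rfl h
        · exact h2 ▸ hmin i hi
        · refine h3 ▸ hmin' i fun h0 => h ?_
          simp only [β]; rw [hY, h0]; simp
        · exact absurd rfl h
      · simp only [N, Matrix.of_apply] at h
        split_ifs at h with h1 h2 h3
        · exact absurd rfl h
        · exact h2 ▸ notMem_of_not_goodRow hS hp
        · exact h3 ▸ notMem_of_not_goodRow hS hq
        · exact absurd rfl h)
    (fun i hi j hj => by
      have hi1 : i ≠ p := fun h => hi (Or.inl h)
      have hi2 : i ≠ q := fun h => hi (Or.inr h)
      rw [hNY i hi1 hi2]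
      rcases hj with rfl | hj
      · rw [hpp]; simp only [β]; field_simp; ring
      · obtain rfl : j = q := hj
        simp only [α]; field_simp; ring)
  have hY' := hc.symmetry hY
  obtain ⟨Y'', hc', e⟩ := exists_upperCongr_transvection (b := b) (S := S) (Y := Y')
    -- For `η = 1` this multiple of the isotropic vector `p` makes `q` isotropic; for `η = -1` the
    -- constant is zero.
    (-(Y q q / (2 * Y p q))) hpq hb (notMem_of_not_goodRow hS hp) (notMem_of_not_goodRow hS hq)
  have hcc := hc.trans hc'
  have hY'' := hcc.symmetry hY
  have f1 : ∀ i, i ≠ p → i ≠ q → ∀ j, Y'' i j = Y' i j := by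
    intro i hi hi' j
    rw [e, if_neg hi', if_neg hi', e2 i (by simp [hi, hi']) p (by simp)]
    simp
  have hpT : p ∈ ({p, q} : Set ι) := by simp
  have hqT : q ∈ ({p, q} : Set ι) := by simp
  have fpp : Y'' p p = 0 := by
    rw [e, if_neg hpq, if_neg hpq, e1 p hpT p hpT, hpp]; simp
  have fqq : Y'' q q = 0 := by
    rw [e]
    simp only [if_true]
    rw [e1 p hpT p hpT, e1 p hpT q hqT, e1 q hqT p hpT, e1 q hqT q hqT, hpp, hY p q]
    rcases hη with rfl | rfl
    · field_simp; ring
    · have : Y q q = 0 := by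
        have := hY q q
        have h3 : 2 * Y q q = 0 := by linear_combination this
        simpa [h2] using h3
      rw [this]; simp
  have f0 : ∀ i, i ≠ p → i ≠ q → Y'' i p = 0 ∧ Y'' i q = 0 := fun i hi hi' =>
    ⟨by rw [f1 i hi hi', e2 i (by simp [hi, hi']) p hpT],
     by rw [f1 i hi hi', e2 i (by simp [hi, hi']) q hqT]⟩
  have sw : ∀ i j, Y'' i j ≠ 0 → Y'' j i ≠ 0 := fun i j h => by
    rw [hY'']; exact mul_ne_zero hη0 h
  refine ⟨Y'', hcc, fun i hi => hi.mono hη0 hY hY'' fun i hi j => ?_, p, hp, ?_⟩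
  · have hip : i ≠ p := fun h => hp (h ▸ hi)
    have hiq : i ≠ q := fun h => hq (h ▸ hi)
    rw [f1 i hip hiq]
    by_cases hj : j ∈ ({p, q} : Set ι)
    · rw [e2 i (by simp [hip, hiq]) j hj]
      rcases hj with rfl | hj
      · exact (hg i hi).1.symm
      · obtain rfl : j = q := hj
        exact (hg i hi).2.symm
    · rw [e3 i (by simp [hip, hiq]) j hj, add_eq_left, Matrix.mul_apply]
      simp [hNg i hi]
  · have hcolp : ∀ i, Y'' i p ≠ 0 → i = q := fun i h => by
      by_contra hiq
      by_cases hip : i = p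
      · exact h (hip ▸ fpp)
      · exact h (f0 i hip hiq).1
    have hcolq : ∀ i, Y'' i q ≠ 0 → i = p := fun i h => by
      by_contra hip
      by_cases hiq : i = q
      · exact h (hiq ▸ fqq)
      · exact h (f0 i hip hiq).2
    intro j hj
    obtain rfl := hcolp j (sw _ _ hj)
    exact ⟨fun j' hj' => hcolp j' (sw _ _ hj'), hcolq, fun h h' => absurd h' (hb' h)⟩

/-- The pivot is a nonzero entry of a bad row with lexicographically minimal pair of blocks. It is
split off as a plane, except when `η = 1` and both blocks coincide; then a diagonal pivot is found
or created. -/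
theorem improvable_of_not_goodRow (h2 : (2 : K) ≠ 0) (hη : η = 1 ∨ η = -1)
    (hY : ∀ i j, Y j i = η * Y i j) (hS : ∀ i ∈ S, ∀ j, Y i j = 0) {a : ι}
    (ha : ¬ GoodRow b η Y a) : Improvable b S η Y := by
  classical
  have hη0 : η ≠ 0 := by rcases hη with rfl | rfl <;> simp
  have sw : ∀ i j, Y i j ≠ 0 → Y j i ≠ 0 := fun i j h => by
    rw [hY]; exact mul_ne_zero hη0 h
  have hex : ∀ a, ¬ GoodRow b η Y a → ∃ c, Y a c ≠ 0 := fun a ha => by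
    by_contra! h; exact ha fun j hj => absurd (h j) hj
  have hng : ∀ i j, ¬ GoodRow b η Y i → Y i j ≠ 0 → ¬ GoodRow b η Y j := fun i j hi hij hj =>
    hi (hj.partner hη0 hY (sw _ _ hij))
  let P : Finset (ι × ι) := Finset.univ.filter fun x => ¬ GoodRow b η Y x.1 ∧ Y x.1 x.2 ≠ 0
  have hP : P.Nonempty := by
    obtain ⟨c, hc⟩ := hex a ha
    exact ⟨(a, c), by simp [P, ha, hc]⟩
  obtain ⟨⟨p, q⟩, hpq, hmin⟩ := P.exists_min_image (fun x => toLex (b x.1, b x.2)) hP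
  simp only [P, Finset.mem_filter, Finset.mem_univ, true_and, Prod.forall, Prod.Lex.toLex_le_toLex,
    and_imp] at hpq hmin
  obtain ⟨hp, hne⟩ := hpq
  have hm1 : ∀ a, ¬ GoodRow b η Y a → b p ≤ b a := fun a ha => by
    obtain ⟨c, hc⟩ := hex a ha
    rcases hmin a c ha hc with h | h
    · exact h.le
    · exact h.1.le
  have hm2 : ∀ a, Y p a ≠ 0 → b q ≤ b a := fun a ha => by
    rcases hmin p a hp ha with h | h
    · exact absurd h (lt_irrefl _)
    · exact h.2
  have hq := hng p q hp hne
  rcases (hm1 q hq).lt_or_eq with hlt | heq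
  · refine improvable_of_hyperbolic h2 hη hY hS (fun h => ?_) hp hne ?_ hlt.le (fun _ => hlt.ne)
      hm1 hm2
    · rw [h] at hlt; exact lt_irrefl _ hlt
    · by_contra h; exact absurd (hm2 p h) (not_le.2 hlt)
  · rcases eq_or_ne η 1 with h1 | h1
    · by_cases hd : Y p p = 0
      · by_cases hd' : Y q q = 0
        · have hpq : q ≠ p := fun h => hne (h ▸ hd)
          -- Both diagonal entries vanish, so adding `q` to `p` makes the entry at `(p, p)` equal to
          -- `2 * Y p q ≠ 0`.
          obtain ⟨Y', hc, e⟩ := exists_upperCongr_transvection (b := b) (S := S) (Y := Y) 1 hpq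
            heq.ge (notMem_of_not_goodRow hS hq) (notMem_of_not_goodRow hS hp)
          have hY' := hc.symmetry hY
          have hgd : ∀ i, GoodRow b η Y i → GoodRow b η Y' i := fun i hi =>
            hi.mono hη0 hY hY' fun i hi j => by
              have hip : i ≠ p := fun h => hp (h ▸ hi)
              have : Y i q = 0 := by
                by_contra h; exact hq (hi.partner hη0 hY h)
              rw [e, if_neg hip, if_neg hip, this]; simp
          by_cases hp' : GoodRow b η Y' p
          · exact ⟨Y', hc, hgd, p, hp, hp'⟩
          · have hpp : Y' p p ≠ 0 := by
              rw [e, hd, hd', hY p q, h1]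
              have : (2 * Y p q) ≠ 0 := mul_ne_zero h2 hne
              simpa [← two_mul] using this
            obtain ⟨Y'', hc', hgd', r, hr, hr'⟩ := improvable_of_diag h1 hY'
              (fun i hi => hc.zero_row hi (hS i hi)) hp' hpp
              (fun a ha => hm1 a fun h => ha (hgd a h))
            exact ⟨Y'', hc.trans hc', fun i hi => hgd' i (hgd i hi), r,
              fun h => hr (hgd r h), hr'⟩
        · exact improvable_of_diag h1 hY hS hq hd' (heq ▸ hm1)
      · exact improvable_of_diag h1 hY hS hp hd hm1
    · have hη1 : η = -1 := hη.resolve_left h1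
      have hd : ∀ i, Y i i = 0 := fun i => by
        have := hY i i
        rw [hη1] at this
        have h3 : 2 * Y i i = 0 := by linear_combination this
        simpa [h2] using h3
      exact improvable_of_hyperbolic h2 hη hY hS (fun h : p = q => hne (h ▸ hd p)) hp hne (hd p) heq.le
        (fun h => absurd h h1) hm1 hm2

theorem exists_upperCongr_goodRow (h2 : (2 : K) ≠ 0) (hη : η = 1 ∨ η = -1)
    (hY : ∀ i j, Y j i = η * Y i j) (hS : ∀ i ∈ S, ∀ j, Y i j = 0) :
    ∃ Y', UpperCongr b S Y Y' ∧ ∀ i, GoodRow b η Y' i := by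
  classical
  induction hn : (Finset.univ.filter fun i => ¬ GoodRow b η Y i).card using Nat.strong_induction_on
    generalizing Y with
  | _ m ih =>
    by_cases hall : ∀ i, GoodRow b η Y i
    · exact ⟨Y, .refl, hall⟩
    · push Not at hall
      obtain ⟨a, ha⟩ := hall
      obtain ⟨Y', hc, hgd, p, hp, hp'⟩ := improvable_of_not_goodRow h2 hη hY hS ha
      obtain ⟨Y'', hc', h''⟩ := ih _ (by
        rw [← hn]
        refine Finset.card_lt_card ⟨fun i hi => ?_, fun h => ?_⟩
        · simp only [Finset.mem_filter, Finset.mem_univ, true_and] at hi ⊢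
          exact fun h => hi (hgd i h)
        · have := h (by simpa using hp : p ∈ _)
          simp only [Finset.mem_filter, Finset.mem_univ, true_and] at this
          exact this hp') (hc.symmetry hY) (fun i hi => hc.zero_row hi (hS i hi)) rfl
      exact ⟨Y'', hc.trans hc', h''⟩

end Forms

/-! ### Normalization of the loops over a finite field. -/

section Forms

set_option linter.unusedSectionVars false

variable {ι K : Type*} [Fintype ι] [DecidableEq ι] [Field K]
variable {b : ι → ℤ} {S : Set ι} {η : K} {g h Y Y' Y₁ Y₂ Y₃ : Matrix ι ι K}

theorem exists_mul_sq_add_mul_sq [Finite K] (h2 : (2 : K) ≠ 0) {c d : K} (hc : c ≠ 0) (hd : d ≠ 0)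
    (e : K) : ∃ x y : K, c * x ^ 2 + d * y ^ 2 = e := by
  classical
  have := Fintype.ofFinite K
  open Polynomial in
  obtain ⟨x, y, h⟩ := FiniteField.exists_root_sum_quadratic
    (f := C c * X ^ 2 + C 0 * X + C 0) (g := C d * X ^ 2 + C 0 * X + C (-e))
    (degree_quadratic hc) (degree_quadratic hd)
    (FiniteField.odd_card_of_char_ne_two (by
      intro h
      apply h2
      have := ringChar.Nat.cast_ringChar (R := K)
      rw [h] at this
      exact_mod_cast this))
  refine ⟨x, y, ?_⟩
  simp at h
  linear_combination h

/-- The linear transformation `(x, y; z, w)` of the coordinates `i`, `j`. -/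
def mixMatrix (i j : ι) (x y z w : K) : Matrix ι ι K :=
  Matrix.of fun a => if a = i then x • Pi.single i 1 + y • Pi.single j 1
    else if a = j then z • Pi.single i 1 + w • Pi.single j 1 else Pi.single a 1

theorem mixMatrix_mul_apply (i j : ι) (x y z w : K) (A : Matrix ι ι K) (a c : ι) :
    (mixMatrix i j x y z w * A) a c = if a = i then x * A i c + y * A j c
      else if a = j then z * A i c + w * A j c else A a c := by
  rw [Matrix.mul_apply]
  simp only [mixMatrix, Matrix.of_apply]
  split_ifs <;> simp [add_mul, Finset.sum_add_distrib, Pi.single_apply]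

theorem mixMatrix_congr_apply (i j : ι) (x y z w : K) (A : Matrix ι ι K) (a c : ι) :
    (mixMatrix i j x y z w * A * (mixMatrix i j x y z w)ᵀ) a c =
      if c = i then x * (mixMatrix i j x y z w * A) a i + y * (mixMatrix i j x y z w * A) a j
      else if c = j then z * (mixMatrix i j x y z w * A) a i + w * (mixMatrix i j x y z w * A) a j
      else (mixMatrix i j x y z w * A) a c := by
  have : (mixMatrix i j x y z w * A * (mixMatrix i j x y z w)ᵀ) a c =
      (mixMatrix i j x y z w * (mixMatrix i j x y z w * A)ᵀ) c a := by
    rw [← Matrix.transpose_apply (_ * _ * _), Matrix.transpose_mul, Matrix.transpose_transpose]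
  rw [this, mixMatrix_mul_apply]
  simp only [Matrix.transpose_apply]

theorem mixMatrix_isInertUpper {i j : ι} (hb : b i = b j) (hi : i ∉ S) (hj : j ∉ S) (x y z w : K) :
    IsInertUpper b S (mixMatrix i j x y z w) := by
  have key : ∀ a c, a ≠ c → mixMatrix i j x y z w a c ≠ 0 → (a = i ∨ a = j) ∧ (c = i ∨ c = j) := by
    intro a c hac h
    by_contra hcon
    apply h
    simp only [mixMatrix, Matrix.of_apply]
    split_ifs with h1 h2
    · have : c ≠ i ∧ c ≠ j := by tauto
      simp [this]
    · have : c ≠ i ∧ c ≠ j := by tauto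
      simp [this]
    · simp [Ne.symm hac]
  have hdiag : ∀ a, a ≠ i → a ≠ j → mixMatrix i j x y z w a a = 1 := fun a h h' => by
    simp [mixMatrix, h, h']
  refine ⟨fun a c hac => ?_, fun a ha c => ?_⟩
  · by_contra h
    have hne : a ≠ c := fun h => by rw [h] at hac; exact lt_irrefl _ hac
    obtain ⟨h1, h2⟩ := key a c hne h
    have e1 : b a = b j := by rcases h1 with rfl | rfl <;> simp [hb]
    have e2 : b c = b j := by rcases h2 with rfl | rfl <;> simp [hb]
    rw [e1, e2] at hac; exact lt_irrefl _ hac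
  · have hai : a ≠ i := fun h => hi (h ▸ ha)
    have haj : a ≠ j := fun h => hj (h ▸ ha)
    by_cases hac : a = c
    · subst hac; simp [hdiag a hai haj]
    · rw [Matrix.one_apply_ne hac, Matrix.one_apply_ne (Ne.symm hac)]
      constructor
      · by_contra h
        obtain ⟨h1, -⟩ := key a c hac h
        tauto
      · by_contra h
        obtain ⟨-, h1⟩ := key c a (Ne.symm hac) h
        tauto

theorem mixMatrix_mul {i j : ι} (hij : i ≠ j) {x y z w x' y' z' w' : K}
    (h1 : x * x' + y * z' = 1) (h2 : x * y' + y * w' = 0) (h3 : z * x' + w * z' = 0)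
    (h4 : z * y' + w * w' = 1) :
    mixMatrix i j x y z w * mixMatrix i j x' y' z' w' = 1 := by
  ext a c
  rw [mixMatrix_mul_apply]
  simp only [mixMatrix, Matrix.of_apply, if_true, if_neg hij.symm]
  split_ifs with hi hj
  · subst hi
    simp only [Pi.add_apply, Pi.smul_apply, Pi.single_apply, smul_eq_mul, Matrix.one_apply]
    by_cases ha : c = a
    · subst ha; simp [hij, h1]
    · by_cases hc : c = j
      · subst hc; simp [hij, ha, h2]
      · simp [ha, hc, Ne.symm ha]
  · subst hj
    simp only [Pi.add_apply, Pi.smul_apply, Pi.single_apply, smul_eq_mul, Matrix.one_apply]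
    by_cases ha : c = a
    · subst ha; simp [hi, h4]
    · by_cases hc : c = i
      · subst hc; simp [hij, hi, h3]
      · simp [ha, hc, Ne.symm ha]
  · simp [Matrix.one_apply, Pi.single_apply, eq_comm]

theorem GoodRow.of_support (hs : ∀ i j, Y' i j ≠ 0 ↔ Y i j ≠ 0) {i : ι} (hi : GoodRow b η Y i) :
    GoodRow b η Y' i := by
  simpa only [GoodRow, hs] using hi

/-- The binary form with diagonal `Y i i`, `Y j j` represents `e`; a vector with value `e` and an
orthogonal one form the new basis of the plane. -/
theorem exists_upperCongr_mix [Finite K] (h2 : (2 : K) ≠ 0) (hS : ∀ i ∈ S, ∀ j, Y i j = 0)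
    (hg : ∀ i, GoodRow b 1 Y i) {i j : ι} (hij : i ≠ j)
    (hb : b i = b j) (hi : Y i i ≠ 0) (hj : Y j j ≠ 0) {e : K} (he : e ≠ 0) :
    ∃ Y', UpperCongr b S Y Y' ∧ Y' i i = e ∧ Y' j j ≠ 0 ∧
      ∀ a c, (a = c → a ≠ i ∧ a ≠ j) → Y' a c = Y a c := by
  obtain ⟨x, y, hxy⟩ := exists_mul_sq_add_mul_sq h2 hi hj e
  have hiS : i ∉ S := fun h => hi (hS i h i)
  have hjS : j ∉ S := fun h => hj (hS j h j)
  have ri : ∀ c, c ≠ i → Y i c = 0 := fun c hc => by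
    by_contra h; exact hc ((hg i i hi).1 c h)
  have ci : ∀ c, c ≠ i → Y c i = 0 := fun c hc => by
    by_contra h; exact hc ((hg i i hi).2.1 c h)
  have rj : ∀ c, c ≠ j → Y j c = 0 := fun c hc => by
    by_contra h; exact hc ((hg j j hj).1 c h)
  have cj : ∀ c, c ≠ j → Y c j = 0 := fun c hc => by
    by_contra h; exact hc ((hg j j hj).2.1 c h)
  -- The second row is orthogonal to `(x, y)`. The determinant is `Y i i * x ^ 2 + Y j j * y ^ 2 =
  -- e`, hence the denominators of the inverse.
  refine ⟨_, ⟨mixMatrix i j x y (-(Y j j * y)) (Y i i * x),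
    mixMatrix i j (Y i i * x / e) (-y / e) (Y j j * y / e) (x / e),
    mixMatrix_isInertUpper hb hiS hjS _ _ _ _, mixMatrix_isInertUpper hb hiS hjS _ _ _ _,
    mixMatrix_mul hij ?_ ?_ ?_ ?_, rfl⟩, ?_, ?_, ?_⟩
  · field_simp; linear_combination hxy
  · field_simp; ring
  · field_simp; ring
  · field_simp; linear_combination hxy
  · simp only [mixMatrix_congr_apply, mixMatrix_mul_apply, if_true, ri j hij.symm, rj i hij]
    linear_combination hxy
  · simp only [mixMatrix_congr_apply, mixMatrix_mul_apply, if_true, ri j hij.symm, rj i hij,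
      if_neg hij.symm]
    have : Y i i * Y j j * e ≠ 0 := mul_ne_zero (mul_ne_zero hi hj) he
    rw [← hxy] at this
    contrapose this
    rw [← this]; ring
  · intro a c hac
    simp only [mixMatrix_congr_apply, mixMatrix_mul_apply, ri j hij.symm, rj i hij]
    by_cases h1 : c = i
    · subst h1
      have hac' : a ≠ c := fun h => (hac h).1 h
      by_cases h3 : a = j
      · subst h3; simp [hac', rj c hij]; ring
      · simp [hac', h3, ci a hac', cj a h3]
    · by_cases h3 : c = j
      · subst h3
        have hac' : a ≠ c := fun h => (hac h).2 h
        by_cases h4 : a = i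
        · subst h4; simp [h1, ri c h1]; ring
        · simp [hac', h4, h1, ci a h4, cj a hac']
      · by_cases h4 : a = i
        · subst h4; simp [h1, h3, ri c h1, rj c h3]
        · by_cases h5 : a = j
          · subst h5; simp [h1, h3, h4, ri c h1, rj c h3]
          · simp [h1, h3, h4, h5]

/-- Whenever two loops of a block are both nonstandard, mixing makes one of them standard and keeps
the support, so the number of nonstandard diagonal entries drops. -/
theorem exists_upperCongr_loops [Finite K] (h2 : (2 : K) ≠ 0) (hS : ∀ i ∈ S, ∀ j, Y i j = 0)
    (hg : ∀ i, GoodRow b 1 Y i) (s : ℤ → K) (hs : ∀ k, s k ≠ 0) :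
    ∃ Y', UpperCongr b S Y Y' ∧ (∀ i, GoodRow b 1 Y' i) ∧
      ∀ i j, i ≠ j → b i = b j → Y' i i ≠ 0 → Y' j j ≠ 0 → Y' i i = s (b i) ∨ Y' j j = s (b i) := by
  classical
  induction hn : (Finset.univ.filter fun i => Y i i ≠ s (b i)).card using Nat.strong_induction_on
    generalizing Y with
  | _ m ih =>
    by_cases hall : ∀ i j, i ≠ j → b i = b j → Y i i ≠ 0 → Y j j ≠ 0 →
        Y i i = s (b i) ∨ Y j j = s (b i)
    · exact ⟨Y, .refl, hg, hall⟩
    · push Not at hall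
      obtain ⟨i, j, hij, hb, hi, hj, hi', hj'⟩ := hall
      obtain ⟨Y', hc, h1, h3, h4⟩ := exists_upperCongr_mix h2 hS hg hij hb hi hj (hs (b i))
      have hsupp : ∀ a c, Y' a c ≠ 0 ↔ Y a c ≠ 0 := by
        intro a c
        by_cases hac : a = c
        · subst hac
          by_cases hai : a = i
          · subst hai; rw [h1]; simp [hs, hi]
          · by_cases haj : a = j
            · subst haj; simp [h3, hj]
            · rw [h4 a a fun _ => ⟨hai, haj⟩]
        · rw [h4 a c fun h => absurd h hac]
      obtain ⟨Y'', hc', h''⟩ := ih _ (by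
        rw [← hn]
        refine Finset.card_lt_card ⟨fun a ha => ?_, fun h => ?_⟩
        · simp only [Finset.mem_filter, Finset.mem_univ, true_and] at ha ⊢
          by_cases hai : a = i
          · subst hai; exact hi'
          · by_cases haj : a = j
            · subst haj; rw [← hb]; exact hj'
            · rwa [h4 a a fun _ => ⟨hai, haj⟩] at ha
        · have := h (by simpa using hi' : i ∈ _)
          simp only [Finset.mem_filter, Finset.mem_univ, true_and] at this
          exact this h1) (fun i hi => hc.zero_row hi (hS i hi))
          (fun i => (hg i).of_support hsupp) rfl
      exact ⟨Y'', hc.trans hc', h''⟩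

/-- Diagonal entries are `s` or `s δ`, and `s δ` occurs at most once in every block. -/
structure NormalLoops (b : ι → ℤ) (s : ℤ → K) (δ : K) (Y : Matrix ι ι K) : Prop where
  values : ∀ i, Y i i ≠ 0 → Y i i = s (b i) ∨ Y i i = s (b i) * δ
  unique : ∀ i j, b i = b j → Y i i = s (b i) * δ → Y j j = s (b j) * δ → i = j

theorem exists_upperCongr_normalLoops [Finite K] (h2 : (2 : K) ≠ 0)
    (hS : ∀ i ∈ S, ∀ j, Y i j = 0) (hg : ∀ i, GoodRow b 1 Y i) (s : ℤ → K) (hs : ∀ k, s k ≠ 0)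
    {δ : K} (hδ : ¬ IsSquare δ) :
    ∃ Y', UpperCongr b S Y Y' ∧ (∀ i, GoodRow b 1 Y' i) ∧ NormalLoops b s δ Y' := by
  classical
  obtain ⟨Y₁, hc, hg₁, hl⟩ := exists_upperCongr_loops h2 hS hg s hs
  have hS₁ : ∀ i ∈ S, ∀ j, Y₁ i j = 0 := fun i hi => hc.zero_row hi (hS i hi)
  have hδ0 : δ ≠ 0 := fun h => hδ (h ▸ IsSquare.zero)
  have hδ1 : δ ≠ 1 := fun h => hδ (h ▸ IsSquare.one)
  -- The factor 1 on standard loops guarantees that a loop ending as `s δ` was nonstandard in `Y₁`,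
  -- which has at most one such loop per block.
  have hd : ∀ i, ∃ d : K, d ≠ 0 ∧ ((Y₁ i i = 0 ∨ Y₁ i i = s (b i)) → d = 1) ∧
      (Y₁ i i ≠ 0 → d * Y₁ i i * d = s (b i) ∨ d * Y₁ i i * d = s (b i) * δ) := by
    intro i
    by_cases h0 : Y₁ i i = 0 ∨ Y₁ i i = s (b i)
    · exact ⟨1, one_ne_zero, fun _ => rfl, fun h => Or.inl (by simp [h0.resolve_left h])⟩
    · push Not at h0
      obtain ⟨h0, h1⟩ := h0
      have hns : ¬ (Y₁ i i = 0 ∨ Y₁ i i = s (b i)) := by tauto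
      by_cases hsq : IsSquare (Y₁ i i / s (b i))
      · obtain ⟨r, hr⟩ := hsq
        have hr0 : r ≠ 0 := fun h => by
          rw [h, mul_zero, div_eq_zero_iff] at hr; exact hr.elim h0 (hs _)
        have e : Y₁ i i = s (b i) * (r * r) := by rw [← hr]; field_simp [hs (b i)]
        exact ⟨r⁻¹, inv_ne_zero hr0, fun h => absurd h hns, fun _ => Or.inl (by
          rw [e]; field_simp)⟩
      -- Over a finite field of odd characteristic the quotient of two non-squares is a square.
      · have hprod : IsSquare (Y₁ i i / s (b i) / δ) := by
          have := Fintype.ofFinite K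
          have hchar : ringChar K ≠ 2 := fun h => h2 (by
            have := ringChar.Nat.cast_ringChar (R := K)
            rw [h] at this
            exact_mod_cast this)
          by_contra hcon
          have a0 : Y₁ i i / s (b i) ≠ 0 := div_ne_zero h0 (hs _)
          have n1 := quadraticChar_neg_one_iff_not_isSquare.2 hsq
          have n2 := quadraticChar_neg_one_iff_not_isSquare.2 hδ
          have n3 := quadraticChar_neg_one_iff_not_isSquare.2 hcon
          have n4 : quadraticChar K (Y₁ i i / s (b i)) =
              quadraticChar K (Y₁ i i / s (b i) / δ) * quadraticChar K δ := by
            rw [← map_mul]; congr 1; field_simp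
          rw [n1, n2, n3] at n4
          norm_num at n4
        obtain ⟨r, hr⟩ := hprod
        have hr0 : r ≠ 0 := fun h => by
          rw [h, mul_zero, div_eq_zero_iff, div_eq_zero_iff] at hr
          exact hr.elim (fun h => h.elim h0 (hs _)) hδ0
        have e : Y₁ i i = s (b i) * δ * (r * r) := by rw [← hr]; field_simp [hs (b i)]
        exact ⟨r⁻¹, inv_ne_zero hr0, fun h => absurd h hns, fun _ => Or.inr (by
          rw [e]; field_simp)⟩
  choose d d0 d1 d2 using hd
  have hin : ∀ d : ι → K, (∀ i ∈ S, d i = 1) → IsInertUpper b S (permDiag 1 d) := by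
    intro d hd
    refine ⟨permDiag_isUpper (fun _ => rfl) d, fun i hi j => ?_⟩
    simp only [permDiag, Matrix.of_apply, Equiv.Perm.coe_one, id, Matrix.one_apply]
    constructor
    · by_cases h : i = j
      · subst h; simp [hd i hi]
      · simp [h]
    · by_cases h : j = i
      · subst h; simp [hd j hi]
      · simp [h]
  have hdS : ∀ i ∈ S, d i = 1 := fun i hi => d1 i (Or.inl (hS₁ i hi i))
  have e : ∀ i j, (permDiag 1 d * Y₁ * (permDiag 1 d)ᵀ) i j = d i * Y₁ i j * d j :=
    fun i j => permDiag_congr 1 d Y₁ i j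
  refine ⟨_, hc.trans ⟨permDiag 1 d, _, hin d hdS, hin _ fun i hi => ?_, permDiag_mul 1 d d0, rfl⟩,
    fun i => (hg₁ i).of_support fun i j => ?_, fun i hi => ?_, fun i j hb hi hj => ?_⟩
  · simp [hdS i hi]
  · rw [e]; simp [d0]
  · rw [e] at hi ⊢
    exact d2 i (right_ne_zero_of_mul (left_ne_zero_of_mul hi))
  · rw [e] at hi hj
    have hne : ∀ i, d i * Y₁ i i * d i = s (b i) * δ → Y₁ i i ≠ 0 ∧ Y₁ i i ≠ s (b i) := by
      intro i hi
      refine ⟨fun h => ?_, fun h => ?_⟩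
      · rw [h, mul_zero, zero_mul] at hi
        exact mul_ne_zero (hs _) hδ0 hi.symm
      · rw [d1 i (Or.inr h), h, one_mul, mul_one] at hi
        exact hδ1 (mul_left_cancel₀ (hs (b i)) (by rw [← hi, mul_one]))
    by_contra hij
    rcases hl i j hij hb (hne i hi).1 (hne j hj).1 with h | h
    · exact (hne i hi).2 h
    · exact (hne j hj).2 (hb ▸ h)

end Forms

/-! ### Normal forms for the contracted action. -/

section Forms

set_option linter.unusedSectionVars false

variable {ι K : Type*} [Fintype ι] [DecidableEq ι] [Field K]
variable {b : ι → ℤ} {S : Set ι} {η : K} {g h Y Y' Y₁ Y₂ Y₃ : Matrix ι ι K}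

theorem exists_upperCongr_normal [Finite K] (h2 : (2 : K) ≠ 0) (hη : η = 1 ∨ η = -1)
    (hY : ∀ i j, Y j i = η * Y i j) (hS : ∀ i ∈ S, ∀ j, Y i j = 0) (s : ℤ → K) (hs : ∀ k, s k ≠ 0)
    {δ : K} (hδ : ¬ IsSquare δ) :
    ∃ Y', UpperCongr b S Y Y' ∧ (∀ i, GoodRow b η Y' i) ∧ (η = 1 → NormalLoops b s δ Y') := by
  obtain ⟨Y₁, hc, hg⟩ := exists_upperCongr_goodRow (b := b) h2 hη hY hS
  by_cases h1 : η = 1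
  · subst h1
    obtain ⟨Y₂, hc', hg', hl⟩ := exists_upperCongr_normalLoops h2
      (fun i hi => hc.zero_row hi (hS i hi)) hg s hs hδ
    exact ⟨Y₂, hc.trans hc', hg', fun _ => hl⟩
  · exact ⟨Y₁, hc, hg, fun h => absurd h h1⟩

/-- A matrix with columns in the support of a monomial matrix `R` is a left multiple of `R`. -/
theorem exists_mul_eq {R F : Matrix ι ι K} (hR : ∀ i j j', R i j ≠ 0 → R i j' ≠ 0 → j = j')
    (hF : ∀ j, (∀ a, R a j = 0) → ∀ i, F i j = 0) : ∃ u, u * R = F := by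
  classical
  have hex : ∀ j, ∃ a : ι, ∃ c : K, (∀ i, F i j = F i j * (c * R a j)) ∧
      ∀ k, k ≠ j → c * R a k = 0 := by
    intro j
    by_cases h : ∀ a, R a j = 0
    · exact ⟨j, 0, fun i => by rw [hF j h]; simp, by simp⟩
    · push Not at h
      obtain ⟨a, ha⟩ := h
      refine ⟨a, (R a j)⁻¹, fun i => by rw [inv_mul_cancel₀ ha, mul_one], fun k hk => ?_⟩
      have : R a k = 0 := by
        by_contra h; exact hk (hR a k j h ha)
      rw [this, mul_zero]
  choose a c h1 h2 using hex
  refine ⟨Matrix.of fun i x => ∑ j, if x = a j then F i j * c j else 0, ?_⟩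
  ext i k
  simp only [Matrix.mul_apply, Matrix.of_apply, Finset.sum_mul, ite_mul, zero_mul]
  rw [Finset.sum_comm]
  simp only [Finset.sum_ite_eq', Finset.mem_univ, if_true]
  rw [Finset.sum_eq_single k, mul_assoc, ← h1 k i]
  · intro j _ hj
    rw [mul_assoc, h2 j k (Ne.symm hj), mul_zero]
  · simp

/-- The infinitesimal action of `u` on a monomial form `R` reaches every form of the same symmetry
that vanishes on pairs of zero rows of `R`. -/
theorem exists_add_transpose_eq (h2 : (2 : K) ≠ 0) (hη : η = 1 ∨ η = -1) {R E : Matrix ι ι K}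
    (hRs : ∀ i j, R j i = η * R i j) (hEs : ∀ i j, E j i = η * E i j)
    (hR : ∀ i j j', R i j ≠ 0 → R i j' ≠ 0 → j = j')
    (hE : ∀ i j, (∀ a, R i a = 0) → (∀ a, R j a = 0) → E i j = 0) :
    ∃ u, u * R + R * uᵀ = E := by
  classical
  have hηη : η * η = 1 := by rcases hη with rfl | rfl <;> simp
  have hη0 : η ≠ 0 := by rcases hη with rfl | rfl <;> simp
  have hRt : Rᵀ = η • R := by ext i j; exact hRs i j
  let Z : ι → Prop := fun i => ∀ a, R i a = 0
  have hZ : ∀ j, (∀ a, R a j = 0) ↔ Z j := fun j => by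
    simp only [Z]
    refine forall_congr' fun a => ?_
    rw [hRs j a]; simp [hη0]
  -- Here `u * R` is chosen so that adding `η` times its transpose gives `E`: half of `E` where both
  -- indices are in the support, all of it where only the column is.
  obtain ⟨u, hu⟩ := exists_mul_eq (R := R)
    (F := Matrix.of fun i j => if Z j then 0 else if Z i then E i j else E i j / 2) hR
    (fun j hj i => by simp [(hZ j).1 hj])
  refine ⟨u, ?_⟩
  have : R * uᵀ = η • (u * R)ᵀ := by
    rw [Matrix.transpose_mul, hRt, Matrix.smul_mul, smul_smul, hηη, one_smul]
  rw [this, hu]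
  ext i j
  simp only [Matrix.add_apply, Matrix.smul_apply, Matrix.transpose_apply, Matrix.of_apply,
    smul_eq_mul]
  by_cases hi : Z i <;> by_cases hj : Z j
  · simp [hi, hj, hE i j hi hj]
  · simp [hi, hj]
  · simp only [hi, hj, if_true, if_false, zero_add]; exact (hEs j i).symm
  · simp only [hi, hj, if_false]
    rw [hEs i j]
    field_simp
    linear_combination E i j * hηη

/-- The positive part becomes a monomial `R` with support `S`. The negative part is reduced outside
`S` by congruences fixing `R`, and `u` removes what meets `S`. The two supports are disjoint, so the
sum remains monomial. -/
theorem exists_formOrbit_normal [Finite K] (h2 : (2 : K) ≠ 0) (hη : η = 1 ∨ η = -1)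
    (hY : ∀ i j, Y j i = η * Y i j) (hY0 : ∀ i j, b i + b j = 0 → Y i j = 0)
    (s : ℤ → K) (hs : ∀ k, s k ≠ 0) {δ : K} (hδ : ¬ IsSquare δ) :
    ∃ Y', FormOrbit b Y Y' ∧ (∀ i j, Y' j i = η * Y' i j) ∧ (∀ i j, b i + b j = 0 → Y' i j = 0) ∧
      (∀ i, GoodRow b η Y' i) ∧ (η = 1 → NormalLoops b s δ Y') := by
  classical
  have hη0 : η ≠ 0 := by rcases hη with rfl | rfl <;> simp
  have hδ0 : δ ≠ 0 := fun h => hδ (h ▸ IsSquare.zero)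
  have hpos : ∀ i j, posPart b Y j i = η * posPart b Y i j := fun i j => by
    simp only [posPart, Matrix.of_apply, add_comm (b j)]
    split_ifs
    · exact hY i j
    · simp
  have hneg : ∀ i j, negPart b Y j i = η * negPart b Y i j := fun i j => by
    simp only [negPart, Matrix.of_apply, add_comm (b j)]
    split_ifs
    · exact hY i j
    · simp
  obtain ⟨R, ⟨g₁, k₁, hg₁, hk₁, e₁, hR⟩, hRg, hRl⟩ := exists_upperCongr_normal (S := ∅) (b := b)
    h2 hη hpos (by simp) s hs hδ
  have hRs : ∀ i j, R j i = η * R i j := by rw [hR]; exact congr_symm hpos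
  have hR0 : ∀ i j, b i + b j ≤ 0 → R i j = 0 := by
    intro i j hij
    rw [hR, Matrix.mul_apply]
    refine Finset.sum_eq_zero fun c _ => ?_
    rw [Matrix.mul_apply, Finset.sum_mul]
    refine Finset.sum_eq_zero fun a _ => ?_
    rw [Matrix.transpose_apply]
    rcases lt_or_ge (b i) (b a) with ha | ha
    · rw [hg₁.1 i a ha]; simp
    rcases lt_or_ge (b j) (b c) with hc | hc
    · rw [hg₁.1 j c hc]; simp
    have : posPart b Y a c = 0 := by
      simp only [posPart, Matrix.of_apply]
      split_ifs with h
      · exact hY0 a c (by linarith)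
      · rfl
    rw [this]; simp
  let W₁ := g₁ * negPart b Y * g₁ᵀ
  have hW₁ : ∀ i j, W₁ j i = η * W₁ i j := congr_symm hneg
  let S : Set ι := {i | ∃ j, R i j ≠ 0}
  have hSr : ∀ i ∉ S, ∀ j, R i j = 0 := fun i hi j => by
    by_contra h; exact hi ⟨j, h⟩
  have hSc : ∀ j ∉ S, ∀ i, R i j = 0 := fun j hj i => by
    rw [hRs j i, hSr j hj, mul_zero]
  -- `Z` may have entries on blocks with nonnegative sum. They are harmless, as only the negative
  -- part of its normal form `N` is kept.
  let Z : Matrix ι ι K := Matrix.of fun i j => if i ∈ S ∨ j ∈ S then 0 else W₁ i j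
  have hZ : ∀ i j, Z j i = η * Z i j := fun i j => by
    simp only [Z, Matrix.of_apply, or_comm (a := j ∈ S)]
    split_ifs
    · simp
    · exact hW₁ i j
  obtain ⟨N, hN, hNg, hNl⟩ := exists_upperCongr_normal (S := S) (b := b) h2 hη hZ
    (fun i hi j => by simp [Z, hi]) s hs hδ
  have hNs := hN.symmetry hZ
  have hNS : ∀ i ∈ S, ∀ j, N i j = 0 := fun i hi => hN.zero_row hi fun j => by simp [Z, hi]
  have hNS' : ∀ j ∈ S, ∀ i, N i j = 0 := fun j hj i => by rw [hNs j i, hNS j hj, mul_zero]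
  obtain ⟨g₂, k₂, hg₂, hk₂, e₂, hNe⟩ := hN
  have hcS : ∀ i, i ∉ S → ∀ a, a ∈ S → g₂ i a = 0 := fun i hi a ha => by
    rw [(hg₂.2 a ha i).2, Matrix.one_apply_ne]
    rintro rfl; exact hi ha
  have hgR : g₂ * R = R := by
    ext i j
    rw [Matrix.mul_apply]
    by_cases hi : i ∈ S
    · simp only [(hg₂.2 i hi _).1]
      rw [← Matrix.mul_apply, one_mul]
    · rw [hSr i hi]
      refine Finset.sum_eq_zero fun a _ => ?_
      by_cases ha : a ∈ S
      · rw [hcS i hi a ha, zero_mul]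
      · rw [hSr a ha, mul_zero]
  have hRt : Rᵀ = η • R := by ext i j; exact hRs i j
  have hgR' : R * g₂ᵀ = R := by
    have := congrArg Matrix.transpose hgR
    rw [Matrix.transpose_mul, hRt, Matrix.smul_mul] at this
    exact smul_right_injective _ hη0 this
  let W := g₂ * W₁ * g₂ᵀ
  have hW : ∀ i j, W j i = η * W i j := congr_symm hW₁
  have hWN : ∀ i j, i ∉ S → j ∉ S → W i j = N i j := by
    intro i j hi hj
    rw [hNe]
    simp only [W, Matrix.mul_apply, Matrix.transpose_apply]
    refine Finset.sum_congr rfl fun c _ => ?_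
    by_cases hc : c ∈ S
    · rw [hcS j hj c hc]; simp
    · congr 1
      refine Finset.sum_congr rfl fun a _ => ?_
      by_cases ha : a ∈ S
      · rw [hcS i hi a ha]; simp
      · simp [Z, ha, hc]
  obtain ⟨u, hu⟩ := exists_add_transpose_eq (R := R) (E := N - W) h2 hη hRs
    (fun i j => by simp only [Matrix.sub_apply, hNs i j, hW i j]; ring)
    (fun i j j' h h' => ((hRg i j h).1 j' h').symm)
    (fun i j hi hj => by
      rw [Matrix.sub_apply, hWN i j (fun ⟨a, ha⟩ => ha (hi a)) (fun ⟨a, ha⟩ => ha (hj a)), sub_self])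
  have hpR : posPart b R = R := by
    ext i j
    simp only [posPart, Matrix.of_apply, ite_eq_left_iff, not_le]
    intro h; exact (hR0 i j h.le).symm
  have hnR : negPart b R = 0 := negPart_eq_zero hpR
  have hpN : posPart b (negPart b N) = 0 := by
    ext i j
    simp only [posPart, negPart, Matrix.of_apply, Matrix.zero_apply]
    split_ifs with h1 h3
    · linarith
    · rfl
    · rfl
  have hnN : negPart b (negPart b N) = negPart b N := by
    ext i j; simp only [negPart, Matrix.of_apply]; split_ifs <;> rfl
  have hY' : ∀ i j, (R + negPart b N) i j ≠ 0 →
      (i ∈ S ∧ ∀ k, (R + negPart b N) i k = R i k ∧ (R + negPart b N) k i = R k i) ∨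
      (i ∉ S ∧ ∀ k, (R + negPart b N) i k = negPart b N i k ∧
        (R + negPart b N) k i = negPart b N k i) := by
    intro i j h
    by_cases hi : i ∈ S
    · refine Or.inl ⟨hi, fun k => ?_⟩
      simp [negPart, hNS i hi, hNS' i hi]
    · refine Or.inr ⟨hi, fun k => ?_⟩
      simp [hSr i hi, hSc i hi]
  have hss : ∀ i j, (R + negPart b N) j i = η * (R + negPart b N) i j := by
    intro i j
    simp only [Matrix.add_apply, negPart, Matrix.of_apply, hRs i j, add_comm (b j)]
    split_ifs
    · rw [hNs i j]; ring
    · ring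
  -- Loops of `R` lie in positive blocks and those of the negative part of `N` in negative blocks,
  -- so uniqueness within a block never mixes the two.
  have hloop : ∀ i, (R + negPart b N) i i ≠ 0 →
      (0 < b i ∧ (R + negPart b N) i i = R i i) ∨ (b i < 0 ∧ (R + negPart b N) i i = N i i) := by
    intro i hi
    rcases lt_or_ge 0 (b i) with h | h
    · refine Or.inl ⟨h, ?_⟩
      simp only [Matrix.add_apply, negPart, Matrix.of_apply]
      rw [if_neg (by linarith), add_zero]
    · rw [Matrix.add_apply, hR0 i i (by linarith), zero_add] at hi
      simp only [negPart, Matrix.of_apply, ne_eq, ite_eq_right_iff, Classical.not_imp] at hi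
      refine Or.inr ⟨by linarith, ?_⟩
      simp only [Matrix.add_apply, negPart, Matrix.of_apply]
      rw [if_pos hi.1, hR0 i i (by linarith), zero_add]
  -- Multiplying `u` by `g₂ * g₁` makes it act on `R` instead of on the original positive part.
  refine ⟨R + negPart b N, ⟨g₂ * g₁, k₁ * k₂, u * (g₂ * g₁), hg₂.1.mul hg₁.1, hk₁.1.mul hk₂.1,
    ?_, ?_, ?_⟩, hss, ?_, ?_, ?_⟩
  · rw [mul_assoc, ← mul_assoc g₁, e₁, one_mul, e₂]
  · have : posPart b (R + negPart b N) = R := by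
      conv_rhs => rw [← hpR]
      ext i j
      have := congrFun (congrFun hpN i) j
      simp only [posPart, Matrix.of_apply, Matrix.add_apply, Matrix.zero_apply] at this ⊢
      split_ifs at this ⊢
      · rw [this, add_zero]
      · rfl
    rw [this]
    calc R = g₂ * R * g₂ᵀ := by rw [hgR, hgR']
      _ = _ := by rw [hR, Matrix.transpose_mul]; simp only [mul_assoc]
  · rw [negPart_add, hnR, hnN, zero_add]
    congr 1
    have hPR : g₂ * g₁ * posPart b Y * (g₂ * g₁)ᵀ = R := by
      calc _ = g₂ * (g₁ * posPart b Y * g₁ᵀ) * g₂ᵀ := by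
            rw [Matrix.transpose_mul]; simp only [mul_assoc]
        _ = R := by rw [← hR, hgR, hgR']
    have hPW : g₂ * g₁ * negPart b Y * (g₂ * g₁)ᵀ = W := by
      simp only [W, W₁]; rw [Matrix.transpose_mul]; simp only [mul_assoc]
    rw [hPW, Matrix.transpose_mul u, ← mul_assoc _ _ uᵀ, hPR, mul_assoc u, mul_assoc u, hPR, add_assoc,
      add_comm (R * uᵀ), hu]
    simp
  · intro i j hij
    simp [hR0 i j hij.le, negPart, hij]
  · intro i j hij
    rcases hY' i j hij with ⟨hi, hk⟩ | ⟨hi, hk⟩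
    · rw [(hk j).1] at hij
      have hj : j ∈ S := ⟨i, by rw [hRs i j]; exact mul_ne_zero hη0 hij⟩
      obtain ⟨q1, q2, q3⟩ := hRg i j hij
      refine ⟨fun j' h' => q1 j' (by rwa [(hk j').1] at h'), fun i' h' => q2 i' ?_, q3⟩
      simpa [negPart, hNS' j hj] using h'
    · rw [(hk j).1] at hij
      have hij' : N i j ≠ 0 := by
        simp only [negPart, Matrix.of_apply, ne_eq, ite_eq_right_iff, Classical.not_imp] at hij
        exact hij.2
      have hj : j ∉ S := fun hj => hij' (hNS' j hj i)
      obtain ⟨q1, q2, q3⟩ := hNg i j hij'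
      refine ⟨fun j' h' => q1 j' ?_, fun i' h' => q2 i' ?_, q3⟩
      · rw [(hk j').1] at h'
        simp only [negPart, Matrix.of_apply, ne_eq, ite_eq_right_iff, Classical.not_imp] at h'
        exact h'.2
      · simp only [Matrix.add_apply, hSc j hj, zero_add, negPart, Matrix.of_apply, ne_eq,
          ite_eq_right_iff, Classical.not_imp] at h'
        exact h'.2
  · intro h1
    refine ⟨fun i hi => ?_, fun i j hb hi hj => ?_⟩
    · rcases hloop i hi with ⟨-, h⟩ | ⟨-, h⟩
      · rw [h] at hi ⊢; exact (hRl h1).values i hi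
      · rw [h] at hi ⊢; exact (hNl h1).values i hi
    · have hi' : (R + negPart b N) i i ≠ 0 := by rw [hi]; exact mul_ne_zero (hs _) hδ0
      have hj' : (R + negPart b N) j j ≠ 0 := by rw [hj]; exact mul_ne_zero (hs _) hδ0
      rcases hloop i hi' with ⟨c1, h⟩ | ⟨c1, h⟩ <;> rcases hloop j hj' with ⟨c2, h'⟩ | ⟨c2, h'⟩
      · rw [h] at hi; rw [h'] at hj; exact (hRl h1).unique i j hb hi hj
      · linarith
      · linarith
      · rw [h] at hi; rw [h'] at hj; exact (hNl h1).unique i j hb hi hj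

end Forms

/-! ### Invariants of an orbit. -/

section Forms

set_option linter.unusedSectionVars false

variable {ι K : Type*} [Fintype ι] [DecidableEq ι] [Field K]
variable {b : ι → ℤ} {η : K} {g h Y Y' Y₁ Y₂ A₁ A₂ : Matrix ι ι K} {T₁ T₂ : Set ι} {Q : ℤ → Prop}

/-- A congruence of monomial forms on `T₁` and `T₂` that is only known for those pairs of
blocks whose sums satisfy `Q`. -/
structure Transfer (b : ι → ℤ) (η : K) (Q : ℤ → Prop) (T₁ T₂ : Set ι) (g h A₁ A₂ : Matrix ι ι K) :
    Prop where
  down : ∀ m n, m ≤ n → Q n → Q m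
  upper : IsUpper b g
  upper_inv : IsUpper b h
  mul_inv : g * h = 1
  symm₁ : ∀ i j, A₁ j i = η * A₁ i j
  good₁ : ∀ i, GoodRow b η A₁ i
  good₂ : ∀ i, GoodRow b η A₂ i
  supp₁ : ∀ i j, A₁ i j ≠ 0 → j ∈ T₁
  supp₂ : ∀ i j, A₂ i j ≠ 0 → i ∈ T₂ ∧ j ∈ T₂
  inv_apply : ∀ a ∈ T₁, ∀ i ∉ T₂, h a i = 0
  congr : ∀ i ∈ T₂, ∀ j ∈ T₂, Q (b i + b j) → (g * A₁ * gᵀ) i j = A₂ i j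

/-- The rows of the block `k` with a nonzero entry in a column of the block `l`. -/
noncomputable def pairedRows (b : ι → ℤ) (Y : Matrix ι ι K) (k l : ℤ) : Finset ι :=
  open Classical in Finset.univ.filter fun i => b i = k ∧ ∃ j, b j = l ∧ Y i j ≠ 0

theorem mem_pairedRows {k l : ℤ} {i : ι} :
    i ∈ pairedRows b Y k l ↔ b i = k ∧ ∃ j, b j = l ∧ Y i j ≠ 0 := by
  simp [pairedRows]

namespace Transfer

/-- Columns of `g * A₁` are combinations, by the upper triangular `h`, of columns of `g * A₁ * gᵀ`
in no higher blocks. In row `i` these vanish below the block of the partner `j`, and monomiality of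
`A₁` isolates `g i a`. -/
theorem apply_eq_zero (H : Transfer b η Q T₁ T₂ g h A₁ A₂) {i j a c : ι} (hij : A₂ i j ≠ 0)
    (hQ : Q (b i + b j)) (hac : A₁ a c ≠ 0) (hc : b c < b j) : g i a = 0 := by
  have e1 : (g * A₁) i c = g i a * A₁ a c := by
    rw [Matrix.mul_apply, Finset.sum_eq_single a]
    · intro a' _ ha'
      have : A₁ a' c = 0 := by
        by_contra h; exact ha' ((H.good₁ a c hac).2.1 a' h)
      rw [this, mul_zero]
    · simp
  have e2 : g * A₁ = g * A₁ * gᵀ * hᵀ := by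
    rw [mul_assoc _ gᵀ, ← Matrix.transpose_mul, mul_eq_one_comm.1 H.mul_inv, Matrix.transpose_one,
      mul_one]
  have e3 : (g * A₁) i c = 0 := by
    rw [e2, Matrix.mul_apply]
    refine Finset.sum_eq_zero fun d _ => ?_
    rw [Matrix.transpose_apply]
    by_cases hd : h c d = 0
    · rw [hd, mul_zero]
    have hdc : b d ≤ b c := by
      by_contra h; exact hd (H.upper_inv c d (not_le.1 h))
    have hdT : d ∈ T₂ := by
      by_contra h; exact hd (H.inv_apply c (H.supp₁ a c hac) d h)
    rw [H.congr i (H.supp₂ i j hij).1 d hdT (H.down _ _ (by linarith) hQ)]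
    have : A₂ i d = 0 := by
      by_contra h
      have := (H.good₂ i j hij).1 d h
      rw [this] at hdc; linarith
    rw [this, zero_mul]
  rw [e1] at e3
  exact (mul_eq_zero.1 e3).resolve_right hac

/-- Triangularity bounds the blocks of `a` and `c` from above and `apply_eq_zero` from below. Thus a
term of `g * A₁ * gᵀ` at `(i, j)` survives only if it comes from the same pair of blocks. -/
theorem mem_of_ne_zero (H : Transfer b η Q T₁ T₂ g h A₁ A₂) (hη : η ≠ 0) {i i' j j' a c : ι}
    (hij : A₂ i i' ≠ 0) (hij' : A₂ j j' ≠ 0)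
    (hQ : Q (b i + b j)) (hb : b i' = b j) (hb' : b j' = b i)
    (hac : A₁ a c ≠ 0) (ha : g i a ≠ 0) (hc : g j c ≠ 0) : b a = b i ∧ b c = b j := by
  have hca : A₁ c a ≠ 0 := by rw [H.symm₁]; exact mul_ne_zero hη hac
  have h1 : b a ≤ b i := by
    by_contra h; exact ha (H.upper i a (not_le.1 h))
  have h2 : b c ≤ b j := by
    by_contra h; exact hc (H.upper j c (not_le.1 h))
  have h3 : b j ≤ b c := by
    by_contra h
    exact ha (H.apply_eq_zero hij (hb ▸ hQ) hac (hb ▸ not_le.1 h))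
  have h4 : b i ≤ b a := by
    by_contra h
    exact hc (H.apply_eq_zero hij' (by rw [hb', add_comm]; exact hQ) hca (hb' ▸ not_le.1 h))
  exact ⟨le_antisymm h1 h4, le_antisymm h2 h3⟩

/-- The submatrix `T` of `g` between the paired rows has a right inverse, because the entries of
`A₂` are computed from the paired rows of `A₁` alone; the rank of `T` gives the inequality. -/
theorem card_le (H : Transfer b η Q T₁ T₂ g h A₁ A₂) (hη : η ≠ 0)
    (h₂ : ∀ i j, A₂ j i = η * A₂ i j) {k l : ℤ} (hQ : Q (k + l)) :
    (pairedRows b A₂ k l).card ≤ (pairedRows b A₁ k l).card := by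
  have hp : ∀ i : pairedRows b A₂ k l, ∃ j, b j = l ∧ A₂ i j ≠ 0 := fun i =>
    (mem_pairedRows.1 i.2).2
  have hbk : ∀ i : pairedRows b A₂ k l, b i = k := fun i => (mem_pairedRows.1 i.2).1
  choose p hpl hp0 using hp
  have hp0' : ∀ i, A₂ (p i) i ≠ 0 := fun i => by rw [h₂]; exact mul_ne_zero hη (hp0 i)
  let T : Matrix (pairedRows b A₂ k l) (pairedRows b A₁ k l) K := Matrix.of fun i a => g i a
  let R : Matrix (pairedRows b A₁ k l) (pairedRows b A₂ k l) K :=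
    Matrix.of fun a i => (A₁ * gᵀ) a (p i) / A₂ i (p i)
  have e : T * R = 1 := by
    ext i j
    rw [Matrix.mul_apply]
    have : ∀ a, a ∉ pairedRows b A₁ k l → g i a * (A₁ * gᵀ) a (p j) = 0 := by
      intro a ha
      rw [Matrix.mul_apply, Finset.mul_sum]
      refine Finset.sum_eq_zero fun c _ => ?_
      by_contra hne
      have n1 := left_ne_zero_of_mul hne
      have n2 := right_ne_zero_of_mul hne
      have n3 := left_ne_zero_of_mul n2
      have n4 := right_ne_zero_of_mul n2
      obtain ⟨q1, q2⟩ := H.mem_of_ne_zero hη (hp0 i) (hp0' j) (by rwa [hbk i, hpl j])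
        (by rw [hpl, hpl]) (by rw [hbk, hbk]) n3 n1 n4
      exact ha (mem_pairedRows.2 ⟨q1.trans (hbk i), c, q2.trans (hpl j), n3⟩)
    have e1 : ∑ a : pairedRows b A₁ k l, g i a * (A₁ * gᵀ) a (p j) = A₂ i (p j) := by
      rw [← H.congr i (H.supp₂ _ _ (hp0 i)).1 (p j) (H.supp₂ _ _ (hp0 j)).2
        (by rwa [hbk i, hpl j]), mul_assoc, Matrix.mul_apply,
        Finset.sum_coe_sort (pairedRows b A₁ k l) (fun a => g i a * (A₁ * gᵀ) a (p j))]
      exact Finset.sum_subset (Finset.subset_univ _) fun a _ ha => this a ha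
    simp only [T, R, Matrix.of_apply, mul_div_assoc']
    rw [← Finset.sum_div, e1]
    by_cases hij : i = j
    · subst hij; rw [Matrix.one_apply_eq, div_self (hp0 i)]
    · rw [Matrix.one_apply_ne hij, div_eq_zero_iff]
      left
      by_contra hne
      exact hij (Subtype.ext ((H.good₂ j (p j) (hp0 j)).2.1 i hne))
  have h1 := Matrix.rank_mul_le_left T R
  rw [e, Matrix.rank_one] at h1
  have h2 := h1.trans (Matrix.rank_le_card_width T)
  simpa using h2

/-- The loops of the block form diagonal matrices congruent by the submatrix `T` of `g`;
determinants give the square `d = det T`. -/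
theorem exists_prod_eq (H : Transfer b η Q T₁ T₂ g h A₁ A₂) (hη : η = 1) {k : ℤ} (hQ : Q (k + k))
    (hcard : (pairedRows b A₁ k k).card = (pairedRows b A₂ k k).card) :
    ∃ d : K, ∏ i ∈ pairedRows b A₂ k k, A₂ i i = d ^ 2 * ∏ i ∈ pairedRows b A₁ k k, A₁ i i := by
  have hη0 : η ≠ 0 := hη ▸ one_ne_zero
  have hbk : ∀ i : pairedRows b A₂ k k, b i = k := fun i => (mem_pairedRows.1 i.2).1
  have hd : ∀ i : pairedRows b A₂ k k, A₂ i i ≠ 0 := fun i => by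
    obtain ⟨j, hj, hij⟩ := (mem_pairedRows.1 i.2).2
    have := (H.good₂ i j hij).2.2 hη ((hbk i).trans hj.symm)
    rwa [← this] at hij
  let e : pairedRows b A₂ k k ≃ pairedRows b A₁ k k := Finset.equivOfCardEq hcard.symm
  let T : Matrix (pairedRows b A₂ k k) (pairedRows b A₂ k k) K := Matrix.of fun i a => g i (e a)
  have key : T * Matrix.diagonal (fun a => A₁ (e a) (e a)) * Tᵀ =
      Matrix.diagonal fun i : pairedRows b A₂ k k => A₂ i i := by
    ext i j
    have e0 : (T * Matrix.diagonal (fun a => A₁ (e a) (e a)) * Tᵀ) i j =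
        ∑ a : pairedRows b A₁ k k, g i a * A₁ a a * g j a := by
      rw [Matrix.mul_apply, ← e.sum_comp]
      simp only [Matrix.mul_diagonal, Matrix.transpose_apply, T, Matrix.of_apply]
    have e1 : (g * A₁ * gᵀ) i j = ∑ a, g i a * A₁ a a * g j a := by
      rw [mul_assoc, Matrix.mul_apply]
      refine Finset.sum_congr rfl fun a _ => ?_
      rw [Matrix.mul_apply, Finset.mul_sum, Finset.sum_eq_single a]
      · rw [Matrix.transpose_apply, mul_assoc]
      · intro c _ hc
        by_contra hne
        have n1 := left_ne_zero_of_mul hne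
        have n2 := right_ne_zero_of_mul hne
        have n3 := left_ne_zero_of_mul n2
        have n4 := right_ne_zero_of_mul n2
        obtain ⟨q1, q2⟩ := H.mem_of_ne_zero hη0 (hd i) (hd j) (by rwa [hbk i, hbk j])
          (by rw [hbk, hbk]) (by rw [hbk, hbk]) n3 n1 n4
        rw [hbk] at q1 q2
        exact hc ((H.good₁ a c n3).2.2 hη (q1.trans q2.symm)).symm
      · simp
    have e2 : (g * A₁ * gᵀ) i j = A₂ i j := H.congr i (H.supp₂ _ _ (hd i)).1 j
      (H.supp₂ _ _ (hd j)).1 (by rwa [hbk i, hbk j])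
    rw [e0, Finset.sum_coe_sort (pairedRows b A₁ k k) (fun a => g i a * A₁ a a * g j a)]
    have e3 : ∑ a ∈ pairedRows b A₁ k k, g i a * A₁ a a * g j a =
        ∑ a, g i a * A₁ a a * g j a := by
      refine Finset.sum_subset (Finset.subset_univ _) fun a _ ha => ?_
      by_contra hne
      have n1 := left_ne_zero_of_mul (left_ne_zero_of_mul hne)
      have n2 := right_ne_zero_of_mul (left_ne_zero_of_mul hne)
      have n3 := right_ne_zero_of_mul hne
      obtain ⟨q1, q2⟩ := H.mem_of_ne_zero hη0 (hd i) (hd j) (by rwa [hbk i, hbk j])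
        (by rw [hbk, hbk]) (by rw [hbk, hbk]) n2 n1 n3
      rw [hbk] at q1
      exact ha (mem_pairedRows.2 ⟨q1, a, q1, n2⟩)
    rw [e3, ← e1, e2]
    by_cases hij : i = j
    · subst hij; simp
    · rw [Matrix.diagonal_apply_ne _ hij]
      by_contra hne
      exact hij (Subtype.ext ((H.good₂ j j (hd j)).2.1 i hne))
  refine ⟨T.det, ?_⟩
  have := congrArg Matrix.det key
  rw [Matrix.det_mul, Matrix.det_mul, Matrix.det_transpose, Matrix.det_diagonal,
    Matrix.det_diagonal] at this
  rw [← Finset.prod_coe_sort _ (fun i => A₂ i i), ← Finset.prod_coe_sort _ (fun i => A₁ i i), ← this,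
    ← e.prod_comp]
  ring

end Transfer

theorem posPart_symm (hY : ∀ i j, Y j i = η * Y i j) (i j : ι) :
    posPart b Y j i = η * posPart b Y i j := by
  simp only [posPart, Matrix.of_apply, add_comm (b j)]
  split_ifs
  · exact hY i j
  · simp

theorem negPart_symm (hY : ∀ i j, Y j i = η * Y i j) (i j : ι) :
    negPart b Y j i = η * negPart b Y i j := by
  simp only [negPart, Matrix.of_apply, add_comm (b j)]
  split_ifs
  · exact hY i j
  · simp

theorem of_posPart_ne_zero {i j : ι} (h : posPart b Y i j ≠ 0) : 0 ≤ b i + b j ∧ Y i j ≠ 0 := by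
  simpa only [posPart, Matrix.of_apply, ne_eq, ite_eq_right_iff, Classical.not_imp] using h

theorem of_negPart_ne_zero {i j : ι} (h : negPart b Y i j ≠ 0) : b i + b j < 0 ∧ Y i j ≠ 0 := by
  simpa only [negPart, Matrix.of_apply, ne_eq, ite_eq_right_iff, Classical.not_imp] using h

theorem GoodRow.of_subset {i : ι} (hi : GoodRow b η Y i) (h : ∀ i j, Y' i j ≠ 0 → Y i j ≠ 0) :
    GoodRow b η Y' i := fun j hj => by
  obtain ⟨h1, h2, h3⟩ := hi j (h i j hj)
  exact ⟨fun j' hj' => h1 j' (h _ _ hj'), fun i' hi' => h2 i' (h _ _ hi'), h3⟩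

theorem eq_zero_of_mul_eq_zero (h₁ : ∀ i, GoodRow b η Y i) {i a c : ι} (hac : Y a c ≠ 0)
    (h0 : (g * Y) i c = 0) : g i a = 0 := by
  rw [Matrix.mul_apply, Finset.sum_eq_single a] at h0
  · exact (mul_eq_zero.1 h0).resolve_right hac
  · intro a' _ ha'
    have : Y a' c = 0 := by
      by_contra h; exact ha' ((h₁ a c hac).2.1 a' h)
    rw [this, mul_zero]
  · simp

theorem row_eq_zero (hgh : g * h = 1) (e : A₂ = g * A₁ * gᵀ) {i : ι} (hi : ∀ j, A₂ i j = 0)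
    (c : ι) : (g * A₁) i c = 0 := by
  have : g * A₁ = A₂ * hᵀ := by
    rw [e, mul_assoc _ gᵀ, ← Matrix.transpose_mul, mul_eq_one_comm.1 hgh, Matrix.transpose_one,
      mul_one]
  rw [this, Matrix.mul_apply]
  simp [hi]

/-- For the negative parts the comparison is confined to the zero rows of the positive parts:
monomiality puts the negative support there, and the terms with `u` vanish there. -/
theorem FormOrbit.exists_transfer (hη : η ≠ 0) (h₁ : ∀ i j, Y₁ j i = η * Y₁ i j)
    (h₂ : ∀ i j, Y₂ j i = η * Y₂ i j) (hg₁ : ∀ i, GoodRow b η Y₁ i) (hg₂ : ∀ i, GoodRow b η Y₂ i)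
    (hf : FormOrbit b Y₁ Y₂) :
    (∃ g h, Transfer b η (fun _ => True) Set.univ Set.univ g h (posPart b Y₁) (posPart b Y₂)) ∧
    ∃ T₁ T₂ g h, Transfer b η (· < 0) T₁ T₂ g h (negPart b Y₁) (negPart b Y₂) := by
  obtain ⟨g, h, u, hg, hh, e, hp, hn⟩ := hf
  have e' : h * g = 1 := mul_eq_one_comm.1 e
  have et : gᵀ * hᵀ = 1 := by rw [← Matrix.transpose_mul, e', Matrix.transpose_one]
  have gp : ∀ {Y : Matrix ι ι K}, (∀ i, GoodRow b η Y i) → ∀ i, GoodRow b η (posPart b Y) i :=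
    fun hY i => (hY i).of_subset fun i j hij => (of_posPart_ne_zero hij).2
  have gn : ∀ {Y : Matrix ι ι K}, (∀ i, GoodRow b η Y i) → ∀ i, GoodRow b η (negPart b Y) i :=
    fun hY i => (hY i).of_subset fun i j hij => (of_negPart_ne_zero hij).2
  refine ⟨⟨g, h, ⟨fun _ _ _ _ => trivial, hg, hh, e, posPart_symm h₁, gp hg₁, gp hg₂,
    by simp, by simp, by simp, fun i _ j _ _ => by rw [hp]⟩⟩, {i | ∀ j, posPart b Y₁ i j = 0},
    {i | ∀ j, posPart b Y₂ i j = 0}, g, h, ?_⟩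
  have hp' : posPart b Y₁ = h * posPart b Y₂ * hᵀ := by
    rw [hp]
    calc posPart b Y₁ = (h * g) * posPart b Y₁ * (gᵀ * hᵀ) := by rw [e', et]; simp
      _ = _ := by simp only [mul_assoc]
  have supp : ∀ {Y : Matrix ι ι K}, (∀ i, GoodRow b η Y i) → ∀ i j, negPart b Y i j ≠ 0 →
      ∀ k, posPart b Y i k = 0 := by
    intro Y hY i j hij k
    by_contra hk
    obtain ⟨a1, a2⟩ := of_negPart_ne_zero hij
    obtain ⟨b1, b2⟩ := of_posPart_ne_zero hk
    rw [(hY i j a2).1 k b2] at b1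
    linarith
  have sw : ∀ {Y : Matrix ι ι K}, (∀ i j, Y j i = η * Y i j) → ∀ i j, Y i j ≠ 0 → Y j i ≠ 0 :=
    fun hY i j h => by rw [hY]; exact mul_ne_zero hη h
  refine ⟨fun m n hmn h => hmn.trans_lt h, hg, hh, e, negPart_symm h₁, gn hg₁, gn hg₂,
    fun i j hij => supp hg₁ j i (sw (negPart_symm h₁) i j hij),
    fun i j hij => ⟨supp hg₂ i j hij, supp hg₂ j i (sw (negPart_symm h₂) i j hij)⟩,
    fun a ha i hi => ?_, fun i hi j hj hij => ?_⟩
  -- A zero row `a` of the positive part of `Y₁` gives a zero row of `h` times the monomial positive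
  -- part of `Y₂`, so `h a` vanishes on the support of the latter.
  · simp only [Set.mem_ofPred_eq, not_forall] at hi
    obtain ⟨j, hj⟩ := hi
    exact eq_zero_of_mul_eq_zero (gp hg₂) hj (row_eq_zero e' hp' ha j)
  · rw [hn]
    simp only [negPart, Matrix.of_apply, if_pos hij, Matrix.add_apply]
    have z1 : (g * posPart b Y₁ * uᵀ) i j = 0 := by
      rw [Matrix.mul_apply]
      simp [row_eq_zero e hp hi]
    have z2 : (u * posPart b Y₁ * gᵀ) i j = 0 := by
      have hs : posPart b Y₁ * gᵀ = η⁻¹ • (g * posPart b Y₁)ᵀ := by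
        rw [Matrix.transpose_mul]
        have : (posPart b Y₁)ᵀ = η • posPart b Y₁ := by ext i j; exact posPart_symm h₁ i j
        rw [this, Matrix.smul_mul, smul_smul, inv_mul_cancel₀ hη, one_smul]
      rw [mul_assoc, hs, Matrix.mul_apply]
      refine Finset.sum_eq_zero fun x _ => ?_
      rw [Matrix.smul_apply, Matrix.transpose_apply, row_eq_zero e hp hj, smul_zero, mul_zero]
    rw [z1, z2, add_zero, add_zero]

theorem pairedRows_posPart {k l : ℤ} (h : 0 ≤ k + l) :
    pairedRows b (posPart b Y) k l = pairedRows b Y k l := by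
  ext i
  simp only [mem_pairedRows, posPart, Matrix.of_apply]
  refine and_congr_right fun hi => exists_congr fun j => and_congr_right fun hj => ?_
  rw [if_pos (by rw [hi, hj]; exact h)]

theorem pairedRows_negPart {k l : ℤ} (h : k + l < 0) :
    pairedRows b (negPart b Y) k l = pairedRows b Y k l := by
  ext i
  simp only [mem_pairedRows, negPart, Matrix.of_apply]
  refine and_congr_right fun hi => exists_congr fun j => and_congr_right fun hj => ?_
  rw [if_pos (by rw [hi, hj]; exact h)]

theorem FormOrbit.card_pairedRows_le (hη : η ≠ 0) (h₁ : ∀ i j, Y₁ j i = η * Y₁ i j)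
    (h₂ : ∀ i j, Y₂ j i = η * Y₂ i j) (hg₁ : ∀ i, GoodRow b η Y₁ i) (hg₂ : ∀ i, GoodRow b η Y₂ i)
    (hf : FormOrbit b Y₁ Y₂) (k l : ℤ) :
    (pairedRows b Y₂ k l).card ≤ (pairedRows b Y₁ k l).card := by
  obtain ⟨⟨g, h, H⟩, T₁, T₂, g', h', H'⟩ := hf.exists_transfer hη h₁ h₂ hg₁ hg₂
  rcases lt_or_ge (k + l) 0 with hkl | hkl
  · have := H'.card_le hη (negPart_symm h₂) hkl
    rwa [pairedRows_negPart hkl, pairedRows_negPart hkl] at this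
  · have := H.card_le hη (posPart_symm h₂) (k := k) (l := l) trivial
    rwa [pairedRows_posPart hkl, pairedRows_posPart hkl] at this

theorem FormOrbit.card_pairedRows (hη : η ≠ 0) (h₁ : ∀ i j, Y₁ j i = η * Y₁ i j)
    (h₂ : ∀ i j, Y₂ j i = η * Y₂ i j) (hg₁ : ∀ i, GoodRow b η Y₁ i) (hg₂ : ∀ i, GoodRow b η Y₂ i)
    (hf : FormOrbit b Y₁ Y₂) (k l : ℤ) :
    (pairedRows b Y₁ k l).card = (pairedRows b Y₂ k l).card :=
  le_antisymm (hf.symm.card_pairedRows_le hη h₂ h₁ hg₂ hg₁ k l)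
    (hf.card_pairedRows_le hη h₁ h₂ hg₁ hg₂ k l)

theorem FormOrbit.exists_prod_eq (hη : η = 1) (h₁ : ∀ i j, Y₁ j i = η * Y₁ i j)
    (h₂ : ∀ i j, Y₂ j i = η * Y₂ i j) (hg₁ : ∀ i, GoodRow b η Y₁ i) (hg₂ : ∀ i, GoodRow b η Y₂ i)
    (hf : FormOrbit b Y₁ Y₂) (k : ℤ) :
    ∃ d : K, ∏ i ∈ pairedRows b Y₂ k k, Y₂ i i = d ^ 2 * ∏ i ∈ pairedRows b Y₁ k k, Y₁ i i := by
  have hη0 : η ≠ 0 := hη ▸ one_ne_zero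
  have hc := hf.card_pairedRows hη0 h₁ h₂ hg₁ hg₂ k k
  have hb : ∀ {Y : Matrix ι ι K} {i : ι}, i ∈ pairedRows b Y k k → b i = k :=
    fun h => (mem_pairedRows.1 h).1
  obtain ⟨⟨g, h, H⟩, T₁, T₂, g', h', H'⟩ := hf.exists_transfer hη0 h₁ h₂ hg₁ hg₂
  rcases lt_or_ge (k + k) 0 with hkl | hkl
  · obtain ⟨d, hd⟩ := H'.exists_prod_eq hη hkl
      (by rwa [pairedRows_negPart hkl, pairedRows_negPart hkl])
    rw [pairedRows_negPart hkl, pairedRows_negPart hkl] at hd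
    have e : ∀ Y : Matrix ι ι K, ∏ i ∈ pairedRows b Y k k, negPart b Y i i =
        ∏ i ∈ pairedRows b Y k k, Y i i := fun Y => Finset.prod_congr rfl fun i hi => by
      simp only [negPart, Matrix.of_apply, hb hi, if_pos hkl]
    exact ⟨d, by rw [← e, ← e, hd]⟩
  · obtain ⟨d, hd⟩ := H.exists_prod_eq hη (k := k) trivial
      (by rwa [pairedRows_posPart hkl, pairedRows_posPart hkl])
    rw [pairedRows_posPart hkl, pairedRows_posPart hkl] at hd
    have e : ∀ Y : Matrix ι ι K, ∏ i ∈ pairedRows b Y k k, posPart b Y i i =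
        ∏ i ∈ pairedRows b Y k k, Y i i := fun Y => Finset.prod_congr rfl fun i hi => by
      simp only [posPart, Matrix.of_apply, hb hi, if_pos hkl]
    exact ⟨d, by rw [← e, ← e, hd]⟩

end Forms

/-! ### From the invariants to a block preserving permutation. -/

section Forms

set_option linter.unusedSectionVars false

variable {ι K : Type*} [Fintype ι] [DecidableEq ι] [Field K]
variable {b : ι → ℤ} {η : K} {Y Y' Y₁ Y₂ : Matrix ι ι K}

theorem exists_equiv_of_card_fiber {γ : Type*} [DecidableEq γ] {p q : ι → Prop} [DecidablePred p]
    [DecidablePred q] {f g : ι → γ}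
    (h : ∀ c, (Finset.univ.filter fun i => p i ∧ f i = c).card =
      (Finset.univ.filter fun i => q i ∧ g i = c).card) :
    ∃ e : {i // p i} ≃ {i // q i}, ∀ x, g (e x) = f x := by
  have key : ∀ c, Nonempty ({a : {i // p i} // f a = c} ≃ {a : {i // q i} // g a = c}) := by
    intro c
    refine ⟨(Equiv.subtypeSubtypeEquivSubtypeInter p (fun i => f i = c)).trans
      ((Fintype.equivOfCardEq ?_).trans
      (Equiv.subtypeSubtypeEquivSubtypeInter q (fun i => g i = c)).symm)⟩
    rw [Fintype.card_subtype, Fintype.card_subtype]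
    exact h c
  exact ⟨Equiv.ofFiberEquiv (f := fun x : {i // p i} => f x) (g := fun x : {i // q i} => g x)
    fun c => (key c).some, fun x => Equiv.ofFiberEquiv_map
      (f := fun x : {i // p i} => f x) (g := fun x : {i // q i} => g x) _ x⟩

/-- The indices with `i ≤ σ i` represent the orbits of `σ`. A bijection of representatives that
respects fixed points extends equivariantly. -/
theorem exists_perm_of_involutive [LinearOrder ι] {σ₁ σ₂ : ι → ι}
    (h₁ : Function.Involutive σ₁) (h₂ : Function.Involutive σ₂)
    (e : {i // i ≤ σ₁ i} ≃ {i // i ≤ σ₂ i})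
    (he : ∀ x, (e x).1 < σ₂ (e x) ↔ x.1 < σ₁ x) :
    ∃ w : Equiv.Perm ι, (∀ x : {i // i ≤ σ₁ i}, w x = e x) ∧ ∀ i, w (σ₁ i) = σ₂ (w i) := by
  have hF : ∀ i, ¬ i ≤ σ₁ i → σ₁ i < σ₁ (σ₁ i) := fun i hi => by rw [h₁ i]; exact not_le.1 hi
  let w : ι → ι := fun i => if h : i ≤ σ₁ i then e ⟨i, h⟩
    else σ₂ (e ⟨σ₁ i, (hF i h).le⟩)
  have w1 : ∀ i (h : i ≤ σ₁ i), w i = e ⟨i, h⟩ := fun i h => dif_pos h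
  have w2 : ∀ i (h : ¬ i ≤ σ₁ i), w i = σ₂ (e ⟨σ₁ i, (hF i h).le⟩) := fun i h => dif_neg h
  have w3 : ∀ i, w i ≤ σ₂ (w i) ↔ i ≤ σ₁ i := by
    intro i
    by_cases h : i ≤ σ₁ i
    · simp only [h, iff_true]; rw [w1 i h]; exact (e _).2
    · simp only [h, iff_false, not_le]
      rw [w2 i h, h₂]
      exact (he _).2 (hF i h)
  have inj : Function.Injective w := by
    intro i j hij
    by_cases h : i ≤ σ₁ i
    · have h' : j ≤ σ₁ j := by rw [← w3, ← hij, w3]; exact h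
      rw [w1 i h, w1 j h'] at hij
      exact congrArg Subtype.val (e.injective (Subtype.ext hij))
    · have h' : ¬ j ≤ σ₁ j := by rw [← w3, ← hij, w3]; exact h
      rw [w2 i h, w2 j h'] at hij
      exact h₁.injective (congrArg Subtype.val (e.injective (Subtype.ext (h₂.injective hij))))
  refine ⟨Equiv.ofBijective w (Finite.injective_iff_bijective.1 inj), fun x => w1 x.1 x.2,
    fun i => ?_⟩
  simp only [Equiv.ofBijective_apply]
  rcases lt_trichotomy i (σ₁ i) with h | h | h
  · have h' : ¬ σ₁ i ≤ σ₁ (σ₁ i) := by rw [h₁ i]; exact not_le.2 h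
    rw [w2 _ h', w1 i h.le]
    simp only [h₁ i]
  · rw [← h, w1 i h.le]
    refine le_antisymm (e _).2 (not_lt.1 fun hlt => ?_)
    have := (he ⟨i, h.le⟩).1 hlt
    exact absurd h (ne_of_lt this)
  · have h' : σ₁ i ≤ σ₁ (σ₁ i) := by rw [h₁ i]; exact h.le
    rw [w1 _ h', w2 i (not_le.2 h), h₂]

/-- `σ` interchanges the row and the column of every nonzero entry, and fixes the zero rows. -/
structure IsPartner (Y : Matrix ι ι K) (σ : ι → ι) : Prop where
  invol : Function.Involutive σ
  eq_of_ne_zero : ∀ i j, Y i j ≠ 0 → σ i = j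
  ne_zero : ∀ i, σ i ≠ i → Y i (σ i) ≠ 0

theorem exists_isPartner (hη : η ≠ 0) (hY : ∀ i j, Y j i = η * Y i j)
    (hg : ∀ i, GoodRow b η Y i) : ∃ σ, IsPartner Y σ := by
  classical
  let σ : ι → ι := fun i => if h : ∃ j, Y i j ≠ 0 then h.choose else i
  have h1 : ∀ i j, Y i j ≠ 0 → σ i = j := fun i j hij => by
    have h : ∃ j, Y i j ≠ 0 := ⟨j, hij⟩
    simp only [σ, dif_pos h]
    exact (hg i j hij).1 _ h.choose_spec
  have h2 : ∀ i, (∀ j, Y i j = 0) → σ i = i := fun i hi => by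
    simp [σ, hi]
  refine ⟨σ, fun i => ?_, h1, fun i hi => ?_⟩
  · by_cases h : ∃ j, Y i j ≠ 0
    · obtain ⟨j, hij⟩ := h
      rw [h1 i j hij]
      exact h1 j i (by rw [hY]; exact mul_ne_zero hη hij)
    · push Not at h
      rw [h2 i h, h2 i h]
  · by_contra h
    refine hi (h2 i fun j => ?_)
    by_contra hj
    exact hj (by rwa [h1 i j hj] at h)

/-- An orbit of the partner involution is coloured by the two blocks, the diagonal value and whether
it is an edge. Equal numbers of orbits of every colour give the permutation. -/
theorem combEquiv_of_partner [DecidableEq K] [LinearOrder ι] {σ₁ σ₂ : ι → ι} (h₁ : IsPartner Y₁ σ₁)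
    (h₂ : IsPartner Y₂ σ₂)
    (h : ∀ k l c p, (Finset.univ.filter fun i => i ≤ σ₁ i ∧
        (b i, b (σ₁ i), Y₁ i i, decide (i < σ₁ i)) = (k, l, c, p)).card =
      (Finset.univ.filter fun i => i ≤ σ₂ i ∧
        (b i, b (σ₂ i), Y₂ i i, decide (i < σ₂ i)) = (k, l, c, p)).card) :
    CombEquiv b Y₁ Y₂ := by
  obtain ⟨e, he⟩ := exists_equiv_of_card_fiber (p := fun i => i ≤ σ₁ i) (q := fun i => i ≤ σ₂ i)
    (f := fun i => (b i, b (σ₁ i), Y₁ i i, decide (i < σ₁ i)))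
    (g := fun i => (b i, b (σ₂ i), Y₂ i i, decide (i < σ₂ i)))
    (fun ⟨k, l, c, p⟩ => by convert h k l c p)
  simp only [Prod.mk.injEq, decide_eq_decide] at he
  obtain ⟨w, hw, hσ⟩ := exists_perm_of_involutive h₁.invol h₂.invol e fun x => (he x).2.2.2
  have fix : ∀ i, σ₁ i = i → Y₂ (w i) (w i) = Y₁ i i := fun i hi => by
    have := (he ⟨i, hi.ge⟩).2.2.1
    rwa [← hw ⟨i, hi.ge⟩] at this
  have hnz : ∀ i, Y₂ (w i) (σ₂ (w i)) ≠ 0 ↔ Y₁ i (σ₁ i) ≠ 0 := by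
    intro i
    by_cases hi : σ₁ i = i
    · rw [← hσ, hi, fix i hi]
    · refine iff_of_true (h₂.ne_zero _ ?_) (h₁.ne_zero i hi)
      rw [← hσ]; exact fun h => hi (w.injective h)
  refine ⟨w, fun i => ?_, fun i j => ⟨fun hij => ?_, fun hij => ?_⟩, fun i => ?_⟩
  · by_cases hi : i ≤ σ₁ i
    · rw [hw ⟨i, hi⟩]; exact (he _).1
    · have hi' : σ₁ i ≤ σ₁ (σ₁ i) := by rw [h₁.invol i]; exact (not_le.1 hi).le
      have h3 := (he ⟨σ₁ i, hi'⟩).2.1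
      rw [← hw ⟨σ₁ i, hi'⟩] at h3
      simpa only [hσ, h₂.invol (w i), h₁.invol i] using h3
  · have := h₂.eq_of_ne_zero _ _ hij
    rw [← this, hnz] at hij
    rw [← hσ] at this
    rwa [w.injective this] at hij
  · have := h₁.eq_of_ne_zero _ _ hij
    rw [← this, ← hnz, ← hσ, this] at hij
    exact hij
  · by_cases hi : σ₁ i = i
    · exact fix i hi
    · have z1 : Y₁ i i = 0 := by
        by_contra h; exact hi (h₁.eq_of_ne_zero i i h)
      have z2 : Y₂ (w i) (w i) = 0 := by
        by_contra h
        have := h₂.eq_of_ne_zero _ _ h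
        rw [← hσ] at this
        exact hi (w.injective this)
      rw [z1, z2]

/-! ### Numbers of edges, loops and zero rows in terms of the invariants. -/

section Counting

variable {σ : ι → ι} [LinearOrder ι]

theorem IsPartner.mem_pairedRows (hσ : IsPartner Y σ) {k l : ℤ} {i : ι} :
    i ∈ pairedRows b Y k l ↔ b i = k ∧ b (σ i) = l ∧ Y i (σ i) ≠ 0 := by
  rw [ParabolicContraction.mem_pairedRows]
  refine and_congr_right fun _ => ⟨?_, fun h => ⟨_, h⟩⟩
  rintro ⟨j, hj, hij⟩
  rw [hσ.eq_of_ne_zero i j hij]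
  exact ⟨hj, hij⟩

/-- Monotonicity of `b` makes the end in the lower block the smaller one, so each edge is counted
once. -/
theorem card_edges_of_lt (hb : Monotone b) (hσ : IsPartner Y σ) {k l : ℤ} (hkl : k < l) :
    (Finset.univ.filter fun i => b i = k ∧ b (σ i) = l ∧ i < σ i).card =
      (pairedRows b Y k l).card := by
  congr 1
  ext i
  rw [hσ.mem_pairedRows]
  simp only [Finset.mem_filter, Finset.mem_univ, true_and]
  refine and_congr_right fun hi => and_congr_right fun hi' => ⟨fun h => hσ.ne_zero i h.ne', ?_⟩
  intro _
  by_contra h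
  have := hb (not_lt.1 h)
  linarith

/-- Without loops the paired rows inside a block are the two ends of its inner edges. -/
theorem two_mul_card_edges (hσ : IsPartner Y σ) (hd : ∀ i, Y i i = 0) (k : ℤ) :
    2 * (Finset.univ.filter fun i => b i = k ∧ b (σ i) = k ∧ i < σ i).card =
      (pairedRows b Y k k).card := by
  have e : pairedRows b Y k k = (Finset.univ.filter fun i => b i = k ∧ b (σ i) = k ∧ i < σ i) ∪
      (Finset.univ.filter fun i => b i = k ∧ b (σ i) = k ∧ i < σ i).image σ := by
    ext i
    rw [hσ.mem_pairedRows]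
    simp only [Finset.mem_union, Finset.mem_filter, Finset.mem_univ, true_and, Finset.mem_image]
    constructor
    · rintro ⟨h1, h2, h3⟩
      rcases lt_trichotomy i (σ i) with h | h | h
      · exact Or.inl ⟨h1, h2, h⟩
      · rw [← h] at h3; exact absurd (hd i) h3
      · exact Or.inr ⟨σ i, ⟨h2, by rwa [hσ.invol i], by rwa [hσ.invol i]⟩, hσ.invol i⟩
    · rintro (⟨h1, h2, h3⟩ | ⟨j, ⟨h1, h2, h3⟩, rfl⟩)
      · exact ⟨h1, h2, hσ.ne_zero i h3.ne'⟩
      · refine ⟨h2, by rwa [hσ.invol j], hσ.ne_zero _ ?_⟩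
        rw [hσ.invol j]; exact h3.ne
  rw [e, Finset.card_union_of_disjoint, Finset.card_image_of_injective _ hσ.invol.injective,
    two_mul]
  rw [Finset.disjoint_left]
  intro i hi hi'
  simp only [Finset.mem_filter, Finset.mem_univ, true_and, Finset.mem_image] at hi hi'
  obtain ⟨j, hj, rfl⟩ := hi'
  have h1 := hi.2.2
  rw [hσ.invol j] at h1
  exact lt_asymm h1 hj.2.2

theorem card_zero_rows [DecidableEq K] (hσ : IsPartner Y σ) (k : ℤ) :
    (Finset.univ.filter fun i => b i = k ∧ Y i (σ i) = 0).card +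
      ∑ l ∈ Finset.univ.image b, (pairedRows b Y k l).card =
      (Finset.univ.filter fun i => b i = k).card := by
  rw [← Finset.card_filter_add_card_filter_not (s := Finset.univ.filter fun i => b i = k)
    (fun i => Y i (σ i) = 0), Finset.filter_filter, Finset.filter_filter]
  congr 1
  rw [Finset.card_eq_sum_card_fiberwise (f := fun i => b (σ i)) (t := Finset.univ.image b)]
  · refine Finset.sum_congr rfl fun l _ => ?_
    congr 1
    ext i
    rw [hσ.mem_pairedRows]
    simp only [Finset.mem_filter, Finset.mem_univ, true_and]
    tauto
  · intro i _
    simp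

theorem IsPartner.mem_pairedRows_self (hσ : IsPartner Y σ)
    (hd : ∀ i j, b i = b j → Y i j ≠ 0 → i = j) {k : ℤ} {i : ι} :
    i ∈ pairedRows b Y k k ↔ b i = k ∧ Y i i ≠ 0 := by
  rw [hσ.mem_pairedRows]
  refine and_congr_right fun hi => ⟨fun ⟨h1, h2⟩ => ?_, fun h => ?_⟩
  · rwa [← hd i _ (hi.trans h1.symm) h2] at h2
  · rw [hσ.eq_of_ne_zero i i h]; exact ⟨hi, h⟩

section Loops

variable [DecidableEq K] {s : ℤ → K} {δ : K}

/-- Modulo squares, this product detects the parity of the number of loops `s δ`. -/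
theorem prod_loops (hδ : δ ≠ 0) (hs : ∀ k, s k ≠ 0) (hσ : IsPartner Y σ)
    (hl : NormalLoops b s δ Y) (hd : ∀ i j, b i = b j → Y i j ≠ 0 → i = j) (k : ℤ) :
    ∏ i ∈ pairedRows b Y k k, Y i i = s k ^ (pairedRows b Y k k).card *
      δ ^ (Finset.univ.filter fun i => b i = k ∧ Y i i = s k * δ).card := by
  have e : ∀ i ∈ pairedRows b Y k k, Y i i = s k * if Y i i = s k * δ then δ else 1 := by
    intro i hi
    obtain ⟨h1, h2⟩ := (hσ.mem_pairedRows_self hd).1 hi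
    have := hl.values i h2
    rw [h1] at this
    split_ifs with h
    · exact h
    · rw [mul_one]; exact this.resolve_right h
  rw [Finset.prod_congr rfl e, Finset.prod_mul_distrib, Finset.prod_const, Finset.prod_ite,
    Finset.prod_const, Finset.prod_const_one, mul_one]
  congr 3
  ext i
  simp only [Finset.mem_filter, Finset.mem_univ, true_and, hσ.mem_pairedRows_self hd]
  constructor
  · rintro ⟨⟨h1, -⟩, h2⟩; exact ⟨h1, h2⟩
  · rintro ⟨h1, h2⟩
    exact ⟨⟨h1, by rw [h2]; exact mul_ne_zero (hs k) hδ⟩, h2⟩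

theorem card_loops_add (hδ : δ ≠ 0) (hδ1 : δ ≠ 1) (hs : ∀ k, s k ≠ 0) (hσ : IsPartner Y σ)
    (hl : NormalLoops b s δ Y) (hd : ∀ i j, b i = b j → Y i j ≠ 0 → i = j) (k : ℤ) :
    (Finset.univ.filter fun i => b i = k ∧ Y i i = s k).card +
      (Finset.univ.filter fun i => b i = k ∧ Y i i = s k * δ).card =
      (pairedRows b Y k k).card := by
  rw [← Finset.card_union_of_disjoint]
  · congr 1
    ext i
    simp only [Finset.mem_union, Finset.mem_filter, Finset.mem_univ, true_and,
      hσ.mem_pairedRows_self hd, ← and_or_left]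
    refine and_congr_right fun hi => ⟨?_, fun h => ?_⟩
    · rintro (h | h) <;> rw [h]
      · exact hs k
      · exact mul_ne_zero (hs k) hδ
    · have := hl.values i h
      rwa [hi] at this
  · rw [Finset.disjoint_left]
    intro i hi hi'
    simp only [Finset.mem_filter, Finset.mem_univ, true_and] at hi hi'
    rw [hi.2] at hi'
    exact hδ1 (mul_left_cancel₀ (hs k) (by rw [← hi'.2, mul_one]))

theorem card_nonsquare_loops_le (hl : NormalLoops b s δ Y) (k : ℤ) :
    (Finset.univ.filter fun i => b i = k ∧ Y i i = s k * δ).card ≤ 1 := by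
  rw [Finset.card_le_one]
  intro i hi j hj
  simp only [Finset.mem_filter, Finset.mem_univ, true_and] at hi hj
  exact hl.unique i j (hi.1.trans hj.1.symm) (by rw [hi.1]; exact hi.2) (by rw [hj.1]; exact hj.2)

theorem card_loops_eq_zero (hl : NormalLoops b s δ Y) {k : ℤ} {c : K} (hc : c ≠ 0)
    (hc1 : c ≠ s k) (hc2 : c ≠ s k * δ) :
    (Finset.univ.filter fun i => b i = k ∧ Y i i = c).card = 0 := by
  rw [Finset.card_eq_zero, Finset.filter_eq_empty_iff]
  rintro i - ⟨hi, hi'⟩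
  have := hl.values i (by rwa [hi'])
  rw [hi, hi'] at this
  exact this.elim hc1 hc2

theorem IsPartner.filter_color_true (hσ : IsPartner Y σ) (k l : ℤ) (c : K) :
    (Finset.univ.filter fun i => i ≤ σ i ∧ (b i, b (σ i), Y i i, decide (i < σ i)) = (k, l, c, true))
      = if c = 0 then Finset.univ.filter fun i => b i = k ∧ b (σ i) = l ∧ i < σ i else ∅ := by
  have h0 : ∀ i, i < σ i → Y i i = 0 := fun i hi => by
    by_contra h; exact hi.ne' (hσ.eq_of_ne_zero i i h)
  ext i
  split_ifs with hc
  · simp only [Finset.mem_filter, Finset.mem_univ, true_and, Prod.mk.injEq, decide_eq_true_eq]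
    constructor
    · rintro ⟨-, h1, h2, -, h3⟩; exact ⟨h1, h2, h3⟩
    · rintro ⟨h1, h2, h3⟩; exact ⟨h3.le, h1, h2, hc ▸ h0 i h3, h3⟩
  · simp only [Finset.mem_filter, Finset.mem_univ, true_and, Prod.mk.injEq, decide_eq_true_eq,
      Finset.notMem_empty, iff_false]
    rintro ⟨-, -, -, h2, h3⟩
    exact hc (h2 ▸ h0 i h3)

theorem IsPartner.filter_color_false (hσ : IsPartner Y σ) (k l : ℤ) (c : K) :
    (Finset.univ.filter fun i => i ≤ σ i ∧
      (b i, b (σ i), Y i i, decide (i < σ i)) = (k, l, c, false)) =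
      if k = l then (if c = 0 then Finset.univ.filter fun i => b i = k ∧ Y i (σ i) = 0
        else Finset.univ.filter fun i => b i = k ∧ Y i i = c) else ∅ := by
  ext i
  have key : (i ≤ σ i ∧ ¬ i < σ i) ↔ σ i = i :=
    ⟨fun h => le_antisymm (not_lt.1 h.2) h.1, fun h => ⟨h.ge, h.symm ▸ lt_irrefl _⟩⟩
  have e1 : i ∈ (Finset.univ.filter fun i => i ≤ σ i ∧
      (b i, b (σ i), Y i i, decide (i < σ i)) = (k, l, c, false)) ↔
      σ i = i ∧ b i = k ∧ k = l ∧ Y i i = c := by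
    simp only [Finset.mem_filter, Finset.mem_univ, true_and, Prod.mk.injEq, decide_eq_false_iff_not]
    rw [← key]
    constructor
    · rintro ⟨h1, h2, h3, h4, h5⟩
      rw [key.1 ⟨h1, h5⟩] at h3
      exact ⟨⟨h1, h5⟩, h2, h2.symm.trans h3, h4⟩
    · rintro ⟨⟨h1, h5⟩, h2, h3, h4⟩
      exact ⟨h1, h2, by rw [key.1 ⟨h1, h5⟩, h2, h3], h4, h5⟩
  rw [e1]
  split_ifs with hkl hc
  · simp only [Finset.mem_filter, Finset.mem_univ, true_and]
    constructor
    · rintro ⟨h1, h2, -, h3⟩; rw [h1, h3]; exact ⟨h2, hc⟩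
    · rintro ⟨h1, h2⟩
      have h3 : σ i = i := by
        by_contra h; exact hσ.ne_zero i h h2
      rw [h3] at h2
      exact ⟨h3, h1, hkl, h2.trans hc.symm⟩
  · simp only [Finset.mem_filter, Finset.mem_univ, true_and]
    constructor
    · rintro ⟨-, h2, -, h3⟩; exact ⟨h2, h3⟩
    · rintro ⟨h1, h2⟩
      exact ⟨hσ.eq_of_ne_zero i i (by rwa [h2]), h1, hkl, h2⟩
  · simp [hkl]

end Loops

end Counting

/-- Edges are counted by the paired rows and zero rows by subtraction from the block size. The
number of loops `s δ` in a block is 0 or 1, hence fixed by the invariant product modulo squares. -/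
theorem FormOrbit.combEquiv [LinearOrder ι] (h2 : (2 : K) ≠ 0) (hη : η = 1 ∨ η = -1)
    (hb : Monotone b) {s : ℤ → K} (hs : ∀ k, s k ≠ 0) {δ : K} (hδ : ¬ IsSquare δ)
    (h₁ : ∀ i j, Y₁ j i = η * Y₁ i j) (h₂ : ∀ i j, Y₂ j i = η * Y₂ i j)
    (hg₁ : ∀ i, GoodRow b η Y₁ i) (hg₂ : ∀ i, GoodRow b η Y₂ i)
    (hl₁ : η = 1 → NormalLoops b s δ Y₁) (hl₂ : η = 1 → NormalLoops b s δ Y₂)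
    (hf : FormOrbit b Y₁ Y₂) : CombEquiv b Y₁ Y₂ := by
  classical
  have hη0 : η ≠ 0 := by rcases hη with rfl | rfl <;> simp
  have hδ0 : δ ≠ 0 := fun h => hδ (h ▸ IsSquare.zero)
  have hδ1 : δ ≠ 1 := fun h => hδ (h ▸ IsSquare.one)
  obtain ⟨σ₁, hσ₁⟩ := exists_isPartner hη0 h₁ hg₁
  obtain ⟨σ₂, hσ₂⟩ := exists_isPartner hη0 h₂ hg₂
  have hc := hf.card_pairedRows hη0 h₁ h₂ hg₁ hg₂
  have hdiag : ∀ {Y : Matrix ι ι K}, (∀ i, GoodRow b η Y i) → η = 1 →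
      ∀ i j, b i = b j → Y i j ≠ 0 → i = j := fun hg h i j hij hY => (hg i j hY).2.2 h hij
  have hzero : ∀ {Y : Matrix ι ι K}, (∀ i j, Y j i = η * Y i j) → η = -1 → ∀ i, Y i i = 0 := by
    intro Y hY h i
    have := hY i i
    rw [h] at this
    have h3 : 2 * Y i i = 0 := by linear_combination this
    simpa [h2] using h3
  have hgt : ∀ (σ : ι → ι) (k l : ℤ), l < k →
      (Finset.univ.filter fun i => b i = k ∧ b (σ i) = l ∧ i < σ i) = ∅ := by
    intro σ k l hkl
    rw [Finset.filter_eq_empty_iff]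
    rintro i - ⟨h3, h4, h5⟩
    have := hb h5.le
    linarith
  have heq : ∀ {Y : Matrix ι ι K} {σ : ι → ι}, IsPartner Y σ → (∀ i, GoodRow b η Y i) → η = 1 →
      ∀ k, (Finset.univ.filter fun i => b i = k ∧ b (σ i) = k ∧ i < σ i) = ∅ := by
    intro Y σ hσ hg h k
    rw [Finset.filter_eq_empty_iff]
    rintro i - ⟨h3, h4, h5⟩
    exact h5.ne (hdiag hg h i _ (h3.trans h4.symm) (hσ.ne_zero i h5.ne'))
  refine combEquiv_of_partner hσ₁ hσ₂ fun k l c p => ?_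
  cases p
  · rw [hσ₁.filter_color_false, hσ₂.filter_color_false]
    split_ifs with hkl hc0
    · have e1 := card_zero_rows (b := b) hσ₁ k
      have e2 := card_zero_rows (b := b) hσ₂ k
      simp only [hc] at e1
      omega
    · rcases hη with rfl | rfl
      · have n1 := card_nonsquare_loops_le (hl₁ rfl) k
        have n2 := card_nonsquare_loops_le (hl₂ rfl) k
        have m1 := card_loops_add hδ0 hδ1 hs hσ₁ (hl₁ rfl) (hdiag hg₁ rfl) k
        have m2 := card_loops_add hδ0 hδ1 hs hσ₂ (hl₂ rfl) (hdiag hg₂ rfl) k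
        -- After cancelling the powers of `s k`, unequal numbers would make `δ` a square.
        have hε : (Finset.univ.filter fun i => b i = k ∧ Y₁ i i = s k * δ).card =
            (Finset.univ.filter fun i => b i = k ∧ Y₂ i i = s k * δ).card := by
          obtain ⟨d, hd⟩ := hf.exists_prod_eq rfl h₁ h₂ hg₁ hg₂ k
          rw [prod_loops hδ0 hs hσ₁ (hl₁ rfl) (hdiag hg₁ rfl),
            prod_loops hδ0 hs hσ₂ (hl₂ rfl) (hdiag hg₂ rfl), hc, mul_left_comm] at hd
          have hd' := mul_left_cancel₀ (pow_ne_zero _ (hs k)) hd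
          by_contra hne
          rcases Nat.le_one_iff_eq_zero_or_eq_one.1 n1 with z1 | z1 <;>
            rcases Nat.le_one_iff_eq_zero_or_eq_one.1 n2 with z2 | z2 <;>
            rw [z1, z2] at hd' hne
          · exact hne rfl
          · rw [pow_zero, pow_one, mul_one] at hd'
            exact hδ ⟨d, by rw [hd', sq]⟩
          · rw [pow_zero, pow_one] at hd'
            have d0 : d ≠ 0 := fun h => by simp [h] at hd'
            exact hδ ⟨d⁻¹, by field_simp; linear_combination -hd'⟩
          · exact hne rfl
        by_cases c1 : c = s k
        · subst c1; have := hc k k; omega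
        · by_cases c2 : c = s k * δ
          · subst c2; exact hε
          · rw [card_loops_eq_zero (hl₁ rfl) hc0 c1 c2, card_loops_eq_zero (hl₂ rfl) hc0 c1 c2]
      · have z : ∀ {Y : Matrix ι ι K}, (∀ i j, Y j i = -1 * Y i j) →
            (Finset.univ.filter fun i => b i = k ∧ Y i i = c) = ∅ := by
          intro Y hY
          rw [Finset.filter_eq_empty_iff]
          rintro i - ⟨-, h4⟩
          exact hc0 (h4 ▸ hzero hY rfl i)
        rw [z h₁, z h₂]
    · rfl
  · rw [hσ₁.filter_color_true, hσ₂.filter_color_true]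
    split_ifs with hc0
    · rcases lt_trichotomy k l with hkl | rfl | hkl
      · rw [card_edges_of_lt hb hσ₁ hkl, card_edges_of_lt hb hσ₂ hkl, hc]
      · by_cases h1 : η = 1
        · rw [heq hσ₁ hg₁ h1, heq hσ₂ hg₂ h1]
        · have h1' := hη.resolve_left h1
          have e1 := two_mul_card_edges (b := b) hσ₁ (hzero h₁ h1') k
          have e2 := two_mul_card_edges (b := b) hσ₂ (hzero h₂ h1') k
          have := hc k k
          omega
      · rw [hgt σ₁ k l hkl, hgt σ₂ k l hkl]
    · rfl

end Forms

/-! ### Translation of the contracted action to forms. -/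

section Bridge

variable {K : Type*} [Field K] {t : Series} {n : ℕ} {I : SymmetricPartition t n}
variable {g h u X Y Z : Mat K t n}

theorem Idx.neg_inj {i j : Idx t n} : -i = -j ↔ i = j :=
  ⟨fun h => by rw [← Idx.neg_neg' i, h, Idx.neg_neg'], fun h => by rw [h]⟩

theorem Idx.coe_neg (i : Idx t n) : (-i).1 = -i.1 := rfl

theorem Idx.eq_neg_iff {i j : Idx t n} : i = -j ↔ j = -i :=
  ⟨fun h => by rw [h, Idx.neg_neg'], fun h => by rw [h, Idx.neg_neg']⟩

variable (K t) in
/-- The sign of the antidiagonal entry of the form matrix in the column `j`. -/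
def formSign (j : ℤ) : K := if t = Series.C ∧ 0 < j then -1 else 1

variable (K t) in
/-- The sign of transposition of the forms. -/
def formEta : K := if t = Series.C then 1 else -1

theorem formEta_eq : formEta K t = 1 ∨ formEta K t = -1 := by
  unfold formEta; split_ifs <;> simp

theorem formSign_ne_zero (j : ℤ) : formSign K t j ≠ 0 := by
  unfold formSign; split_ifs <;> simp

theorem mul_formMatrix_apply (X : Mat K t n) (i j : Idx t n) :
    (X * formMatrix K t n) i j = X i (-j) * formSign K t j.1 := by
  rw [Matrix.mul_apply, Finset.sum_eq_single (-j)]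
  · simp [formMatrix, formSign, Idx.neg_neg', Idx.coe_neg]
  · intro k _ hk
    simp only [formMatrix, Matrix.of_apply]
    rw [if_neg fun h => hk (Idx.eq_neg_iff.1 h), mul_zero]
  · simp

/-- The form matrix has the symmetry opposite to that of the forms `X J` with `X† = -X`. -/
theorem formMatrix_transpose : (formMatrix K t n)ᵀ = -(formEta K t) • formMatrix K t n := by
  ext i j
  simp only [Matrix.transpose_apply, formMatrix, Matrix.of_apply, Matrix.smul_apply, smul_eq_mul]
  by_cases h : i = -j
  · subst h
    rw [if_pos rfl, if_pos (Idx.neg_neg' j).symm, Idx.coe_neg]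
    unfold formEta
    by_cases ht : t = Series.C
    · subst ht
      have hj : j.1 ≠ 0 := by
        have := j.2
        simp only [indices, Finset.mem_filter] at this
        simpa using this.2
      simp only [true_and, if_true]
      rcases lt_or_gt_of_ne hj with h | h
      · rw [if_pos h, if_neg (by linarith)]; ring
      · rw [if_neg (by linarith), if_pos (by linarith)]; ring
    · simp [ht]
  · rw [if_neg h, if_neg fun h' => h (Idx.eq_neg_iff.1 h'), mul_zero]

theorem transpose_mul_formMatrix : (formMatrix K t n)ᵀ * formMatrix K t n = 1 :=
  mul_eq_one_comm.1 formMatrix_mul_transpose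

theorem mul_formMatrix_injective :
    Function.Injective fun X : Mat K t n => X * formMatrix K t n := fun X Y h => by
  have := congrArg (· * (formMatrix K t n)ᵀ) h
  simpa only [mul_assoc, formMatrix_mul_transpose, mul_one] using this

theorem dagger_mul_formMatrix : dagger X * formMatrix K t n = formMatrix K t n * Xᵀ := by
  rw [dagger, mul_assoc, transpose_mul_formMatrix, mul_one]

theorem dagger_eq_neg_iff :
    dagger X = -X ↔ ∀ i j, (X * formMatrix K t n) j i =
      formEta K t * (X * formMatrix K t n) i j := by
  have h1 : (X * formMatrix K t n)ᵀ = -(formEta K t) • (dagger X * formMatrix K t n) := by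
    rw [Matrix.transpose_mul, formMatrix_transpose, dagger_mul_formMatrix, Matrix.smul_mul]
  have h2 : (∀ i j, (X * formMatrix K t n) j i = formEta K t * (X * formMatrix K t n) i j) ↔
      (X * formMatrix K t n)ᵀ = formEta K t • (X * formMatrix K t n) := by
    rw [← Matrix.ext_iff]; rfl
  have hη : formEta K t ≠ 0 := by rcases formEta_eq (K := K) (t := t) with h | h <;> simp [h]
  rw [h2, h1, neg_smul, ← smul_neg, (smul_right_injective _ hη).eq_iff, ← Matrix.neg_mul]
  refine ⟨fun h => by rw [h, neg_neg], fun h => ?_⟩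
  have e : -dagger X = X := mul_formMatrix_injective h
  exact neg_eq_iff_eq_neg.1 e

theorem mem_nilradical_iff :
    X ∈ nilradical I ↔ (∀ i j, I.block i + I.block j = 0 → (X * formMatrix K t n) i j = 0) ∧
      ∀ i j, (X * formMatrix K t n) j i = formEta K t * (X * formMatrix K t n) i j := by
  rw [← dagger_eq_neg_iff]
  refine and_congr_left fun _ => ⟨fun h i j hij => ?_, fun h i j hij => ?_⟩
  · rw [mul_formMatrix_apply, h i (-j) (by rw [I.symmetric]; linarith), zero_mul]
  · have := h i (-j) (by rw [I.symmetric, hij]; ring)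
    rw [mul_formMatrix_apply, Idx.neg_neg'] at this
    exact (mul_eq_zero.1 this).resolve_right (formSign_ne_zero _)

theorem parabolicPart_mul_formMatrix :
    parabolicPart I X * formMatrix K t n = posPart I.block (X * formMatrix K t n) := by
  ext i j
  simp only [posPart, Matrix.of_apply, mul_formMatrix_apply, parabolicPart, I.symmetric]
  by_cases h : 0 ≤ I.block i + I.block j
  · rw [if_pos h, if_pos (by linarith)]
  · rw [if_neg h, if_neg (fun h' => h (by linarith)), zero_mul]

theorem lowerPart_mul_formMatrix :
    lowerPart I X * formMatrix K t n = negPart I.block (X * formMatrix K t n) := by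
  ext i j
  simp only [negPart, Matrix.of_apply, mul_formMatrix_apply, lowerPart, I.symmetric]
  by_cases h : I.block i + I.block j < 0
  · rw [if_pos h, if_pos (by linarith)]
  · rw [if_neg h, if_neg (fun h' => h (by linarith)), zero_mul]

theorem parabolicPart_isUpper : IsUpper I.block (parabolicPart I X) := fun i j hij => by
  simp [parabolicPart, not_le.2 hij]

theorem IsUpper.parabolicPart_eq (hg : IsUpper I.block g) : parabolicPart I g = g := by
  ext i j
  simp only [parabolicPart, Matrix.of_apply, ite_eq_left_iff, not_le]
  exact fun h => (hg i j h).symm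

theorem parabolicPart_add : parabolicPart I (X + Y) = parabolicPart I X + parabolicPart I Y := by
  ext i j; simp only [parabolicPart, Matrix.of_apply, Matrix.add_apply]; split_ifs <;> simp

theorem lowerPart_add : lowerPart I (X + Y) = lowerPart I X + lowerPart I Y := by
  ext i j; simp only [lowerPart, Matrix.of_apply, Matrix.add_apply]; split_ifs <;> simp

theorem parabolicPart_add_lowerPart : parabolicPart I X + lowerPart I X = X := by
  ext i j
  simp only [parabolicPart, lowerPart, Matrix.of_apply, Matrix.add_apply]
  rcases lt_or_ge (I.block i) (I.block j) with h | h
  · simp [h]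
  · simp [h, not_lt.2 h]

theorem lowerPart_lowerPart : lowerPart I (lowerPart I X) = lowerPart I X := by
  ext i j; simp only [lowerPart, Matrix.of_apply]; split_ifs <;> rfl

theorem parabolicPart_lowerPart : parabolicPart I (lowerPart I X) = 0 := by
  have := parabolicPart_add_lowerPart (I := I) (X := lowerPart I X)
  rwa [lowerPart_lowerPart, add_eq_right] at this

theorem IsUpper.lowerPart_eq_zero (hg : IsUpper I.block g) : lowerPart I g = 0 := by
  have := parabolicPart_add_lowerPart (I := I) (X := g)
  rwa [hg.parabolicPart_eq, add_eq_left] at this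

/-- The lower part is a module over upper matrices as the quotient of all matrices by them, so inner
projections may be dropped. -/
theorem IsUpper.lowerPart_mul (hg : IsUpper I.block g) :
    lowerPart I (g * lowerPart I Z) = lowerPart I (g * Z) := by
  conv_rhs => rw [← parabolicPart_add_lowerPart (I := I) (X := Z), mul_add, lowerPart_add,
    (hg.mul parabolicPart_isUpper).lowerPart_eq_zero, zero_add]

theorem IsUpper.lowerPart_mul_right (hg : IsUpper I.block g) :
    lowerPart I (lowerPart I Z * g) = lowerPart I (Z * g) := by
  conv_rhs => rw [← parabolicPart_add_lowerPart (I := I) (X := Z), add_mul, lowerPart_add,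
    (parabolicPart_isUpper.mul hg).lowerPart_eq_zero, zero_add]

theorem parabolicPart_contractedMul :
    parabolicPart I (contractedMul I X Y) = parabolicPart I X * parabolicPart I Y := by
  rw [contractedMul, parabolicPart_add, parabolicPart_lowerPart, add_zero,
    (parabolicPart_isUpper.mul parabolicPart_isUpper).parabolicPart_eq]

theorem lowerPart_contractedMul :
    lowerPart I (contractedMul I X Y) =
      lowerPart I (parabolicPart I X * lowerPart I Y + lowerPart I X * parabolicPart I Y) := by
  rw [contractedMul, lowerPart_add, lowerPart_lowerPart,
    (parabolicPart_isUpper.mul parabolicPart_isUpper).lowerPart_eq_zero, zero_add]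

theorem dagger_apply (i j : Idx t n) :
    dagger X i j = formMatrix K t n i (-i) * X (-j) (-i) * formMatrix K t n j (-j) := by
  rw [dagger, Matrix.mul_apply, Finset.sum_eq_single (-j)]
  · rw [Matrix.transpose_apply, Matrix.mul_apply, Finset.sum_eq_single (-i)]
    · rfl
    · intro k _ hk; simp [formMatrix, hk]
    · simp
  · intro k _ hk; simp [formMatrix, hk]
  · simp

theorem parabolicPart_dagger : parabolicPart I (dagger X) = dagger (parabolicPart I X) := by
  ext i j
  simp only [dagger_apply, parabolicPart, Matrix.of_apply, I.symmetric, neg_le_neg_iff]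
  split_ifs <;> simp

theorem lowerPart_dagger : lowerPart I (dagger X) = dagger (lowerPart I X) := by
  ext i j
  simp only [dagger_apply, lowerPart, Matrix.of_apply, I.symmetric, neg_lt_neg_iff]
  split_ifs <;> simp

theorem posPart_daggerAction :
    posPart I.block (daggerAction I g X * formMatrix K t n) =
      parabolicPart I g * posPart I.block (X * formMatrix K t n) * (parabolicPart I g)ᵀ := by
  rw [← parabolicPart_mul_formMatrix, daggerAction, parabolicPart_contractedMul,
    parabolicPart_contractedMul, parabolicPart_dagger, mul_assoc, dagger_mul_formMatrix,
    ← parabolicPart_mul_formMatrix]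
  simp only [mul_assoc]

theorem negPart_daggerAction :
    negPart I.block (daggerAction I g X * formMatrix K t n) = negPart I.block
      (parabolicPart I g * negPart I.block (X * formMatrix K t n) * (parabolicPart I g)ᵀ +
        parabolicPart I g * posPart I.block (X * formMatrix K t n) * (lowerPart I g)ᵀ +
        lowerPart I g * posPart I.block (X * formMatrix K t n) * (parabolicPart I g)ᵀ) := by
  have hu : IsUpper I.block (dagger (parabolicPart I g)) := by
    rw [← parabolicPart_dagger]; exact parabolicPart_isUpper
  have e : lowerPart I (daggerAction I g X) = lowerPart I
      (parabolicPart I g * parabolicPart I X * dagger (lowerPart I g) +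
        (parabolicPart I g * lowerPart I X + lowerPart I g * parabolicPart I X) *
          dagger (parabolicPart I g)) := by
    rw [daggerAction, lowerPart_contractedMul, parabolicPart_contractedMul,
      lowerPart_contractedMul, parabolicPart_dagger, lowerPart_dagger, lowerPart_add,
      hu.lowerPart_mul_right, ← lowerPart_add]
  rw [← lowerPart_mul_formMatrix, e, lowerPart_mul_formMatrix]
  congr 1
  rw [add_mul, mul_assoc, dagger_mul_formMatrix, mul_assoc (_ + _), dagger_mul_formMatrix,
    ← parabolicPart_mul_formMatrix, ← lowerPart_mul_formMatrix]
  simp only [add_mul, mul_assoc]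
  abel

theorem IsUpper.negPart_lowerPart (hg : IsUpper I.block g) {P : Mat K t n}
    (hP : posPart I.block P = P) :
    negPart I.block (g * P * (lowerPart I u)ᵀ + lowerPart I u * P * gᵀ) =
      negPart I.block (g * P * uᵀ + u * P * gᵀ) := by
  have h1 : negPart I.block (g * P * (parabolicPart I u)ᵀ) = 0 :=
    negPart_eq_zero (parabolicPart_isUpper.posPart_mul_transpose (hg.mul_posPart hP))
  have h2 : negPart I.block (parabolicPart I u * P * gᵀ) = 0 :=
    negPart_eq_zero (hg.posPart_mul_transpose (parabolicPart_isUpper.mul_posPart hP))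
  conv_rhs => rw [← parabolicPart_add_lowerPart (I := I) (X := u)]
  simp only [Matrix.transpose_add, mul_add, add_mul, negPart_add, h1, h2, zero_add]

theorem mem_contractedGL (hg : IsUpper I.block g) (hh : IsUpper I.block h) (e : g * h = 1)
    (u : Mat K t n) : g + lowerPart I u ∈ contractedGL I := by
  have e' : h * g = 1 := mul_eq_one_comm.1 e
  have p : ∀ {g : Mat K t n}, IsUpper I.block g → ∀ u : Mat K t n,
      parabolicPart I (g + lowerPart I u) = g := fun hg u => by
    rw [parabolicPart_add, hg.parabolicPart_eq, parabolicPart_lowerPart, add_zero]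
  have l : ∀ {g : Mat K t n}, IsUpper I.block g → ∀ u : Mat K t n,
      lowerPart I (g + lowerPart I u) = lowerPart I u := fun hg u => by
    rw [lowerPart_add, hg.lowerPart_eq_zero, lowerPart_lowerPart, zero_add]
  refine ⟨h + lowerPart I (-(h * u * h)), ?_, ?_⟩
  · rw [contractedMul, p hg, p hh, l hg, l hh, e, lowerPart_add, hg.lowerPart_mul,
      hh.lowerPart_mul_right, ← lowerPart_add]
    have : g * -(h * u * h) + u * h = 0 := by
      rw [mul_neg, mul_assoc, ← mul_assoc g, e, one_mul, neg_add_cancel]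
    rw [this]
    ext; simp [lowerPart]
  · rw [contractedMul, p hg, p hh, l hg, l hh, e', lowerPart_add, hh.lowerPart_mul,
      hg.lowerPart_mul_right, ← lowerPart_add]
    have : h * u + -(h * u * h) * g = 0 := by
      rw [neg_mul, mul_assoc (h * u), e', mul_one, add_neg_cancel]
    rw [this]
    ext; simp [lowerPart]

/-- The parabolic and lower components of the group element serve as `g` and `u`. Conversely, only
the lower part of `u` affects a negative part. -/
theorem sameOrbit_iff :
    SameOrbit I X Y ↔ FormOrbit I.block (X * formMatrix K t n) (Y * formMatrix K t n) := by
  constructor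
  · rintro ⟨g, ⟨h, e, -⟩, rfl⟩
    refine ⟨parabolicPart I g, parabolicPart I h, lowerPart I g, parabolicPart_isUpper,
      parabolicPart_isUpper, ?_, posPart_daggerAction, negPart_daggerAction⟩
    rw [← parabolicPart_contractedMul, e]
    exact IsUpper.one.parabolicPart_eq
  · rintro ⟨g, h, u, hg, hh, e, hp, hn⟩
    refine ⟨g + lowerPart I u, mem_contractedGL hg hh e u, mul_formMatrix_injective ?_⟩
    have p : parabolicPart I (g + lowerPart I u) = g := by
      rw [parabolicPart_add, hg.parabolicPart_eq, parabolicPart_lowerPart, add_zero]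
    have l : lowerPart I (g + lowerPart I u) = lowerPart I u := by
      rw [lowerPart_add, hg.lowerPart_eq_zero, lowerPart_lowerPart, zero_add]
    simp only
    rw [← posPart_add_negPart (b := I.block) (A := Y * formMatrix K t n),
      ← posPart_add_negPart (b := I.block) (A := daggerAction _ _ _ * formMatrix K t n),
      posPart_daggerAction, negPart_daggerAction, p, l, hp, hn, add_assoc, negPart_add,
      hg.negPart_lowerPart posPart_posPart, ← negPart_add, ← add_assoc]

end Bridge

/-! ### Basic pairs as normal forms. -/

section Roots

variable {K : Type*} [Field K] {t : Series} {n : ℕ} {I : SymmetricPartition t n}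
variable {D D₁ D₂ : Finset (Idx t n × Idx t n)} {δ : Kˣ}

theorem isRoot_iff {p : Idx t n × Idx t n} :
    IsRoot p ↔ p.1.1 ≠ p.2.1 ∧ (-p.2.1 < p.1.1 ∨ t = Series.C ∧ p.2.1 = -p.1.1) := by
  simp only [IsRoot, IsPositiveRoot, Prod.fst_swap, Prod.snd_swap]
  by_cases ht : t = Series.C
  · simp only [ht, true_and]; omega
  · simp only [ht, false_and, or_false]; omega

theorem prime_eq_iff {p : Idx t n × Idx t n} : prime p = p ↔ -p.2 = p.1 := by
  simp only [prime, Prod.ext_iff]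
  exact ⟨fun h => h.1, fun h => ⟨h, by rw [← h, Idx.neg_neg']⟩⟩

/-- The sum of the two indices of a root is nonnegative and `prime` changes its sign, so it is zero.
-/
theorem IsRoot.eq_prime {p : Idx t n × Idx t n} (h : IsRoot p) (h' : IsRoot (prime p)) :
    prime p = p := by
  rw [isRoot_iff] at h h'
  simp only [prime, Idx.coe_neg] at h'
  rw [prime_eq_iff]
  apply Subtype.ext
  rw [Idx.coe_neg]
  omega

theorem IsRoot.eq_C {p : Idx t n × Idx t n} (h : IsRoot p) (h' : -p.2 = p.1) : t = Series.C := by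
  rw [isRoot_iff] at h
  have := congrArg Subtype.val h'
  rw [Idx.coe_neg] at this
  rcases h.2 with h | h
  · omega
  · exact h.1

/-- With `IsRoot.eq_prime`, this identifies radical roots with the unordered pairs of indices at
which a form can be nonzero; loops occur only for `C_n`. -/
theorem isRoot_or (i j : Idx t n) (hb : I.block i + I.block j ≠ 0) (hij : i ≠ j ∨ t = Series.C) :
    IsRoot (i, -j) ∨ IsRoot (j, -i) := by
  have h1 : i.1 ≠ -j.1 := fun h => hb (by
    have : i = -j := Subtype.ext h
    rw [this, I.symmetric]; ring)
  rw [isRoot_iff, isRoot_iff]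
  simp only [Idx.coe_neg]
  rcases lt_trichotomy i.1 j.1 with h | h | h
  · exact Or.inr ⟨by omega, Or.inl (by omega)⟩
  · refine Or.inl ⟨h1, Or.inr ⟨?_, by omega⟩⟩
    exact hij.resolve_left (not_not.2 (Subtype.ext h))
  · exact Or.inl ⟨by omega, Or.inl (by omega)⟩

theorem pos_iff_block_pos {i : Idx t n} (h : I.block i ≠ 0) : 0 < i.1 ↔ 0 < I.block i := by
  have hs := I.symmetric i
  have h1 : 0 ≤ i.1 → -I.block i ≤ I.block i := fun h => by
    rw [← hs]; exact I.monotone _ _ (by rw [Idx.coe_neg]; omega)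
  have h2 : i.1 ≤ 0 → I.block i ≤ -I.block i := fun h => by
    rw [← hs]; exact I.monotone _ _ (by rw [Idx.coe_neg]; omega)
  omega

/-- Makes the standard value of a loop depend only on its block, as `NormalLoops` requires. -/
theorem formSign_block {i : Idx t n} (h : I.block i ≠ 0) :
    formSign K t (I.block i) = formSign K t i.1 := by
  simp only [formSign, pos_iff_block_pos h]

theorem formEta_mul_self : formEta K t * formEta K t = 1 := by
  rcases formEta_eq (K := K) (t := t) with h | h <;> simp [h]

theorem formEta_ne_zero : formEta K t ≠ 0 := left_ne_zero_of_mul_eq_one formEta_mul_self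

theorem formEta_eq_one_iff (h2 : (2 : K) ≠ 0) : formEta K t = 1 ↔ t = Series.C := by
  unfold formEta
  split_ifs with h
  · simp [h]
  · simp only [h, iff_false]
    intro h'
    exact h2 (by linear_combination -h')

variable (K) in
/-- The form of a root vector, up to sign: the units at `(i, j)` and, up to sign, at `(j, i)`. -/
def edgeForm (i j : Idx t n) : Mat K t n :=
  if i = j then Matrix.single i i 1
  else Matrix.single i j 1 + formEta K t • Matrix.single j i 1

theorem edgeForm_apply (i j a c : Idx t n) : edgeForm K i j a c =
    if i = a ∧ j = c then 1 else if j = a ∧ i = c then formEta K t else 0 := by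
  unfold edgeForm
  by_cases hij : i = j
  · subst hij
    rw [if_pos rfl, Matrix.single_apply]
    split_ifs <;> rfl
  · rw [if_neg hij, Matrix.add_apply, Matrix.smul_apply, Matrix.single_apply, Matrix.single_apply]
    by_cases h1 : i = a ∧ j = c
    · obtain ⟨rfl, rfl⟩ := h1; simp [hij]
    · simp [h1]

theorem edgeForm_swap {i j : Idx t n} (h : i = j → t = Series.C) :
    edgeForm K j i = formEta K t • edgeForm K i j := by
  unfold edgeForm
  by_cases hij : i = j
  · subst hij; simp [formEta, h rfl]
  · rw [if_neg hij, if_neg (Ne.symm hij), smul_add, smul_smul, formEta_mul_self, one_smul, add_comm]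

theorem rootVector_mul_formMatrix (p : Idx t n × Idx t n) :
    rootVector K p * formMatrix K t n = formSign K t (-p.2.1) • edgeForm K p.1 (-p.2) := by
  have e : Matrix.single p.1 p.2 (1 : K) * formMatrix K t n =
      formSign K t (-p.2.1) • Matrix.single p.1 (-p.2) 1 := by
    ext a c
    rw [mul_formMatrix_apply, Matrix.smul_apply, Matrix.single_apply, Matrix.single_apply]
    by_cases h : p.1 = a ∧ -p.2 = c
    · obtain ⟨h1, rfl⟩ := h
      simp [h1, Idx.neg_neg', Idx.coe_neg]
    · rw [if_neg h, if_neg fun h' => h ⟨h'.1, by rw [h'.2, Idx.neg_neg']⟩]; simp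
  unfold rootVector edgeForm
  simp only [prime_eq_iff, eq_comm (a := -p.2)]
  split_ifs with h
  · rw [e, ← h]
  · have e2 : formMatrix K t n * (Matrix.single p.1 p.2 (1 : K))ᵀ =
        -(formEta K t) • (Matrix.single p.1 p.2 (1 : K) * formMatrix K t n)ᵀ := by
      rw [Matrix.transpose_mul, formMatrix_transpose, Matrix.smul_mul, smul_smul, neg_mul_neg,
        formEta_mul_self, one_smul]
    rw [sub_mul, dagger_mul_formMatrix, e2, e, Matrix.transpose_smul, Matrix.transpose_single,
      smul_add, neg_smul, sub_neg_eq_add, smul_comm]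

theorem rookMatrix_mul_formMatrix_apply (φ : D → Kˣ) (a c : Idx t n) :
    (rookMatrix D φ * formMatrix K t n) a c =
      ∑ γ : D, (φ γ : K) * (formSign K t (-γ.1.2.1) * edgeForm K γ.1.1 (-γ.1.2) a c) := by
  rw [rookMatrix, Finset.sum_mul, Matrix.sum_apply]
  refine Finset.sum_congr rfl fun γ _ => ?_
  rw [Matrix.smul_mul, rootVector_mul_formMatrix]
  rfl

theorem rookMatrix_symm (hD : ∀ γ ∈ D, IsRoot γ) (φ : D → Kˣ) (a c : Idx t n) :
    (rookMatrix D φ * formMatrix K t n) c a =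
      formEta K t * (rookMatrix D φ * formMatrix K t n) a c := by
  rw [rookMatrix_mul_formMatrix_apply, rookMatrix_mul_formMatrix_apply, Finset.mul_sum]
  refine Finset.sum_congr rfl fun γ _ => ?_
  have : edgeForm K γ.1.1 (-γ.1.2) c a = formEta K t * edgeForm K γ.1.1 (-γ.1.2) a c := by
    have hC : γ.1.1 = -γ.1.2 → formEta K t = 1 := fun h => by
      rw [formEta, if_pos ((hD _ γ.2).eq_C h.symm)]
    simp only [edgeForm_apply]
    by_cases h1 : γ.1.1 = a ∧ -γ.1.2 = c
    · obtain ⟨rfl, rfl⟩ := h1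
      by_cases h : γ.1.1 = -γ.1.2
      · simp [← h, hC h]
      · simp [h]
    · by_cases h3 : -γ.1.2 = a ∧ γ.1.1 = c
      · obtain ⟨rfl, rfl⟩ := h3
        by_cases h : γ.1.1 = -γ.1.2
        · simp [← h, hC h]
        · simp [h, Ne.symm h, formEta_mul_self]
      · have h1' : ¬ (-γ.1.2 = c ∧ γ.1.1 = a) := fun h => h1 h.symm
        have h3' : ¬ (γ.1.1 = c ∧ -γ.1.2 = a) := fun h => h3 h.symm
        simp [h1, h3, h1', h3']
  rw [this]; ring

theorem rookMatrix_apply_mem (hD : ∀ γ ∈ D, IsRoot γ) (φ : D → Kˣ) (γ : D) :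
    (rookMatrix D φ * formMatrix K t n) γ.1.1 (-γ.1.2) = φ γ * formSign K t (-γ.1.2.1) := by
  rw [rookMatrix_mul_formMatrix_apply, Finset.sum_eq_single γ]
  · simp [edgeForm_apply]
  · intro β _ hβ
    rw [edgeForm_apply, if_neg, if_neg, mul_zero, mul_zero]
    -- A contribution from the transposed place would give `prime β = γ`; both being roots, `β = γ`.
    · rintro ⟨h1, h2⟩
      have e : prime β.1 = γ.1 := by
        refine Prod.ext h1 ?_
        simp only [prime]; rw [h2, Idx.neg_neg']
      have := (hD _ β.2).eq_prime (e ▸ hD _ γ.2)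
      exact hβ (Subtype.ext (this.symm.trans e))
    · rintro ⟨h1, h2⟩
      exact hβ (Subtype.ext (Prod.ext h1 (Idx.neg_inj.1 h2)))
  · simp

theorem rookMatrix_ne_zero_iff (hD : ∀ γ ∈ D, IsRoot γ) (φ : D → Kˣ) (a c : Idx t n) :
    (rookMatrix D φ * formMatrix K t n) a c ≠ 0 ↔ (a, -c) ∈ D ∨ (c, -a) ∈ D := by
  have key : ∀ a c, (a, -c) ∈ D → (rookMatrix D φ * formMatrix K t n) a c ≠ 0 := by
    intro a c h
    have := rookMatrix_apply_mem hD φ ⟨(a, -c), h⟩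
    simp only [Idx.neg_neg'] at this
    rw [this]
    exact mul_ne_zero (Units.ne_zero _) (formSign_ne_zero _)
  constructor
  · intro h
    rw [rookMatrix_mul_formMatrix_apply] at h
    obtain ⟨γ, -, hγ⟩ := Finset.exists_ne_zero_of_sum_ne_zero h
    have hγ' := right_ne_zero_of_mul (right_ne_zero_of_mul hγ)
    rw [edgeForm_apply] at hγ'
    split_ifs at hγ' with h1 h2
    · left
      obtain ⟨rfl, rfl⟩ := h1
      rw [Idx.neg_neg']; exact γ.2
    · right
      obtain ⟨rfl, rfl⟩ := h2
      rw [Idx.neg_neg']; exact γ.2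
    · exact absurd rfl hγ'
  · rintro (h | h)
    · exact key a c h
    · rw [rookMatrix_symm hD]
      exact mul_ne_zero formEta_ne_zero (key c a h)

/-- A block preserving permutation commutes with the projections, so it merely permutes the entries
of the form. -/
theorem daggerAction_weylMatrix {w : Equiv.Perm (Idx t n)} (hw : w ∈ weylGroup I) (X : Mat K t n)
    (i j : Idx t n) :
    (daggerAction I (weylMatrix K w) X * formMatrix K t n) (w i) (w j) =
      (X * formMatrix K t n) i j := by
  have hw' : ∀ i, I.block (w i) = I.block i := hw
  have e : weylMatrix K w = permDiag w fun _ => 1 := rfl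
  have hu : IsUpper I.block (weylMatrix K w) := permDiag_isUpper hw' _
  rw [← posPart_add_negPart (b := I.block) (A := daggerAction _ _ _ * formMatrix K t n),
    posPart_daggerAction, negPart_daggerAction, hu.parabolicPart_eq, hu.lowerPart_eq_zero,
    Matrix.add_apply]
  conv_rhs => rw [← posPart_add_negPart (b := I.block) (A := X * formMatrix K t n),
    Matrix.add_apply]
  have h0 : ∀ A : Mat K t n, (weylMatrix K w * A * (weylMatrix K w)ᵀ) (w i) (w j) = A i j := by
    intro A
    rw [e, permDiag_congr, one_mul, mul_one]
  rw [h0]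
  congr 1
  rw [Matrix.transpose_zero, mul_zero, zero_mul, zero_mul, add_zero, add_zero]
  rw [negPart, Matrix.of_apply, h0, hw', hw']
  simp only [negPart, Matrix.of_apply]
  split_ifs <;> rfl

theorem daggerAction_rootVector {w : Equiv.Perm (Idx t n)} (hw : w ∈ weylGroup I)
    (p : Idx t n × Idx t n) :
    daggerAction I (weylMatrix K w) (rootVector K p) * formMatrix K t n =
      formSign K t (-p.2.1) • edgeForm K (w p.1) (w (-p.2)) := by
  ext a c
  obtain ⟨a, rfl⟩ := w.surjective a
  obtain ⟨c, rfl⟩ := w.surjective c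
  rw [daggerAction_weylMatrix hw, rootVector_mul_formMatrix]
  simp only [Matrix.smul_apply, edgeForm_apply, EmbeddingLike.apply_eq_iff_eq]

theorem formSign_eq (j : ℤ) : formSign K t j = 1 ∨ formSign K t j = -1 := by
  unfold formSign; split_ifs <;> simp

/-- Up to sign, the form of a root vector depends only on the unordered pair of `γ.1` and `-γ.2`,
and `w` moves this pair. -/
theorem weylMapsTo_iff {w : Equiv.Perm (Idx t n)} (hw : w ∈ weylGroup I)
    {γ β : Idx t n × Idx t n} (hβ : IsRoot β) :
    WeylMapsTo K I w γ β ↔ (β.1 = w γ.1 ∧ -β.2 = w (-γ.2)) ∨ (β.1 = w (-γ.2) ∧ -β.2 = w γ.1) := by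
  constructor
  · intro h
    have hne : (rootVector K β * formMatrix K t n) (w γ.1) (w (-γ.2)) ≠ 0 := by
      have h0 : (daggerAction I (weylMatrix K w) (rootVector K γ) * formMatrix K t n)
          (w γ.1) (w (-γ.2)) ≠ 0 := by
        rw [daggerAction_rootVector hw, Matrix.smul_apply, edgeForm_apply, if_pos ⟨rfl, rfl⟩]
        simp [formSign_ne_zero]
      rcases h with h | h <;> rw [h] at h0
      · exact h0
      · rw [Matrix.neg_mul, Matrix.neg_apply] at h0
        exact neg_ne_zero.1 h0
    rw [rootVector_mul_formMatrix, Matrix.smul_apply, edgeForm_apply] at hne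
    split_ifs at hne with h1 h2
    · exact Or.inl h1
    · exact Or.inr ⟨h2.2, h2.1⟩
    · simp at hne
  · intro h
    have hF : edgeForm K (w γ.1) (w (-γ.2)) = edgeForm K β.1 (-β.2) ∨
        edgeForm K (w γ.1) (w (-γ.2)) = -edgeForm K β.1 (-β.2) := by
      rcases h with ⟨h1, h2⟩ | ⟨h1, h2⟩
      · rw [h1, h2]; exact Or.inl rfl
      · rw [← h1, ← h2, edgeForm_swap (fun h => hβ.eq_C h.symm)]
        rcases formEta_eq (K := K) (t := t) with h | h <;> rw [h] <;> simp
    have hs : daggerAction I (weylMatrix K w) (rootVector K γ) * formMatrix K t n =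
        rootVector K β * formMatrix K t n ∨
        daggerAction I (weylMatrix K w) (rootVector K γ) * formMatrix K t n =
        -rootVector K β * formMatrix K t n := by
      rw [Matrix.neg_mul, daggerAction_rootVector hw, rootVector_mul_formMatrix]
      rcases hF with h | h <;> rcases formSign_eq (K := K) (t := t) (-γ.2.1) with h1 | h1 <;>
        rcases formSign_eq (K := K) (t := t) (-β.2.1) with h2 | h2 <;> rw [h, h1, h2] <;> simp
    exact hs.imp (fun h => mul_formMatrix_injective h) (fun h => mul_formMatrix_injective h)

namespace IsBasicPair

variable {φ : D → Kˣ} {φ₁ : D₁ → Kˣ} {φ₂ : D₂ → Kˣ}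

theorem isRoot (h : IsBasicPair I δ D φ) : ∀ γ ∈ D, IsRoot γ := fun γ hγ => (h.roots γ hγ).1

theorem block_add_ne_zero (h : IsBasicPair I δ D φ) {γ} (hγ : γ ∈ D) :
    I.block γ.1 + I.block (-γ.2) ≠ 0 := by
  rw [I.symmetric]
  intro h'
  exact (h.roots γ hγ).2 (by linarith)

theorem mem_union (h : IsBasicPair I δ D φ) {i j : Idx t n}
    (hij : (rookMatrix D φ * formMatrix K t n) i j ≠ 0) : (i, -j) ∈ D ∪ D.image prime := by
  rw [rookMatrix_ne_zero_iff h.isRoot] at hij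
  rw [Finset.mem_union, Finset.mem_image]
  refine hij.imp id fun h' => ⟨_, h', ?_⟩
  simp [prime, Idx.neg_neg']

theorem goodRow (h2 : (2 : K) ≠ 0) (h : IsBasicPair I δ D φ) (i : Idx t n) :
    GoodRow I.block (formEta K t) (rookMatrix D φ * formMatrix K t n) i := by
  intro j hij
  have hm := h.mem_union hij
  refine ⟨fun j' hj' => ?_, fun i' hi' => ?_, fun hη hb => ?_⟩
  · have := h.rook _ (h.mem_union hj') _ hm (Or.inl rfl)
    exact Idx.neg_inj.1 (congrArg Prod.snd this)
  · exact congrArg Prod.fst (h.rook _ (h.mem_union hi') _ hm (Or.inr rfl))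
  · rw [formEta_eq_one_iff h2] at hη
    rw [rookMatrix_ne_zero_iff h.isRoot] at hij
    rcases hij with h' | h'
    · have := h.symplectic_block hη _ h' (by simp only; rw [I.symmetric, hb])
      exact (Idx.neg_inj.1 this).symm
    · have := h.symplectic_block hη _ h' (by simp only; rw [I.symmetric, hb])
      exact Idx.neg_inj.1 this

theorem diag_apply (h : IsBasicPair I δ D φ) {i : Idx t n} (hi : (i, -i) ∈ D) :
    (rookMatrix D φ * formMatrix K t n) i i =
      formSign K t (I.block i) * φ ⟨(i, -i), hi⟩ := by
  have e := rookMatrix_apply_mem h.isRoot φ ⟨(i, -i), hi⟩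
  have hb : I.block i ≠ 0 := fun h0 => by
    have := h.block_add_ne_zero hi
    simp only [Idx.neg_neg', h0] at this
    exact this rfl
  simp only [Idx.neg_neg', Idx.coe_neg, neg_neg] at e
  rw [e, formSign_block hb, mul_comm]

theorem normalLoops (h2 : (2 : K) ≠ 0) (h : IsBasicPair I δ D φ) (hη : formEta K t = 1) :
    NormalLoops I.block (formSign K t) (δ : K) (rookMatrix D φ * formMatrix K t n) := by
  rw [formEta_eq_one_iff h2] at hη
  have hm : ∀ i, (rookMatrix D φ * formMatrix K t n) i i ≠ 0 → (i, -i) ∈ D := fun i hi => by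
    rw [rookMatrix_ne_zero_iff h.isRoot] at hi
    exact hi.elim id id
  have hδ : ∀ i, (rookMatrix D φ * formMatrix K t n) i i = formSign K t (I.block i) * (δ : K) →
      ∃ hi : (i, -i) ∈ D, φ ⟨(i, -i), hi⟩ = δ := fun i hi => by
    have hi' := hm i (by rw [hi]; exact mul_ne_zero (formSign_ne_zero _) δ.ne_zero)
    refine ⟨hi', Units.ext (mul_left_cancel₀ (formSign_ne_zero (t := t) (I.block i)) ?_)⟩
    rw [← h.diag_apply hi', hi]
  refine ⟨fun i hi => ?_, fun i j hb hi hj => ?_⟩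
  · rw [h.diag_apply (hm i hi)]
    rcases h.symplectic_values hη ⟨_, hm i hi⟩ with h' | h' <;> rw [h'] <;> simp
  · obtain ⟨hi', ei⟩ := hδ i hi
    obtain ⟨hj', ej⟩ := hδ j hj
    have := h.symplectic_unique hη ⟨_, hi'⟩ ⟨_, hj'⟩ (I.symmetric i) (I.symmetric j) hb ei ej
    exact congrArg (fun x => x.1.1) this

theorem eq_one (h : IsBasicPair I δ D φ) (γ : D) (hγ : -γ.1.2 ≠ γ.1.1) : φ γ = 1 := by
  by_cases ht : t = Series.C
  · refine (h.symplectic_values ht γ).resolve_right fun h' => hγ ?_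
    rw [h.symplectic_antidiagonal ht γ h', Idx.neg_neg']
  · exact h.orthogonal ht γ

/-- The support of the form determines `D`, and its loops determine `φ`, which is 1 on all other
roots. -/
theorem combEquiv_iff (h₁ : IsBasicPair I δ D₁ φ₁) (h₂ : IsBasicPair I δ D₂ φ₂) :
    CombEquiv I.block (rookMatrix D₁ φ₁ * formMatrix K t n) (rookMatrix D₂ φ₂ * formMatrix K t n) ↔
      WeylConjugate I D₁ φ₁ D₂ φ₂ := by
  constructor
  · rintro ⟨w, hw, hs, hd⟩
    have hw' : w ∈ weylGroup I := hw
    have key : ∀ (γ : D₁) (β : D₂), (β.1.1 = w γ.1.1 ∧ -β.1.2 = w (-γ.1.2)) ∨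
        (β.1.1 = w (-γ.1.2) ∧ -β.1.2 = w γ.1.1) → WeylMapsTo K I w γ.1 β.1 ∧ φ₂ β = φ₁ γ := by
      intro γ β h
      refine ⟨(weylMapsTo_iff hw' (h₂.isRoot _ β.2)).2 h, ?_⟩
      by_cases hγ : -γ.1.2 = γ.1.1
      · have hβ : -β.1.2 = β.1.1 := by
          rw [hγ] at h; rcases h with h | h <;> rw [h.1, h.2]
        have e1 : γ.1.2 = -γ.1.1 := by rw [← hγ, Idx.neg_neg']
        have e2 : β.1.2 = -β.1.1 := by rw [← hβ, Idx.neg_neg']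
        have e3 : β.1.1 = w γ.1.1 := by
          rw [hγ] at h; rcases h with h | h <;> exact h.1
        have a1 := rookMatrix_apply_mem h₁.isRoot φ₁ γ
        have a2 := rookMatrix_apply_mem h₂.isRoot φ₂ β
        have b1 := h₁.block_add_ne_zero γ.2
        rw [hγ] at a1 b1
        rw [hβ, e3, hd, a1, e1, e2, e3, Idx.coe_neg, Idx.coe_neg, neg_neg, neg_neg] at a2
        have b1' : I.block γ.1.1 ≠ 0 := fun h => b1 (by rw [h]; rfl)
        have b2' : I.block (w γ.1.1) ≠ 0 := by rwa [hw]
        rw [← formSign_block b1', ← formSign_block b2', hw] at a2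
        exact Units.ext (mul_right_cancel₀ (formSign_ne_zero _) a2).symm
      · have hβ : -β.1.2 ≠ β.1.1 := fun hβ => hγ (by
          rcases h with h | h
          · exact w.injective (by rw [← h.1, ← h.2, hβ])
          · exact w.injective (by rw [← h.1, ← h.2, hβ]))
        rw [h₁.eq_one γ hγ, h₂.eq_one β hβ]
    refine ⟨w, hw', fun γ => ?_, fun β => ?_⟩
    · have h0 : (rookMatrix D₁ φ₁ * formMatrix K t n) γ.1.1 (-γ.1.2) ≠ 0 := by
        rw [rookMatrix_ne_zero_iff h₁.isRoot, Idx.neg_neg']; exact Or.inl γ.2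
      rw [← hs, rookMatrix_ne_zero_iff h₂.isRoot] at h0
      rcases h0 with h | h
      · exact ⟨⟨_, h⟩, key γ ⟨_, h⟩ (Or.inl ⟨rfl, Idx.neg_neg' _⟩)⟩
      · exact ⟨⟨_, h⟩, key γ ⟨_, h⟩ (Or.inr ⟨rfl, Idx.neg_neg' _⟩)⟩
    · have h0 : (rookMatrix D₂ φ₂ * formMatrix K t n) β.1.1 (-β.1.2) ≠ 0 := by
        rw [rookMatrix_ne_zero_iff h₂.isRoot, Idx.neg_neg']; exact Or.inl β.2
      obtain ⟨a, ha⟩ := w.surjective β.1.1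
      obtain ⟨c, hc⟩ := w.surjective (-β.1.2)
      rw [← ha, ← hc, hs, rookMatrix_ne_zero_iff h₁.isRoot] at h0
      rcases h0 with h | h
      · exact ⟨⟨_, h⟩, key ⟨_, h⟩ β (Or.inl ⟨ha.symm, by rw [Idx.neg_neg', hc]⟩)⟩
      · exact ⟨⟨_, h⟩, key ⟨_, h⟩ β (Or.inr ⟨by rw [Idx.neg_neg', ha], hc.symm⟩)⟩
  · rintro ⟨w, hw, hγ, hβ⟩
    have hs : ∀ i j, (rookMatrix D₂ φ₂ * formMatrix K t n) (w i) (w j) ≠ 0 ↔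
        (rookMatrix D₁ φ₁ * formMatrix K t n) i j ≠ 0 := by
      intro i j
      rw [rookMatrix_ne_zero_iff h₁.isRoot, rookMatrix_ne_zero_iff h₂.isRoot]
      have fwd : ∀ i j, (i, -j) ∈ D₁ → (w i, -w j) ∈ D₂ ∨ (w j, -w i) ∈ D₂ := by
        intro i j h
        obtain ⟨β, hm, -⟩ := hγ ⟨_, h⟩
        rw [weylMapsTo_iff hw (h₂.isRoot _ β.2)] at hm
        simp only [Idx.neg_neg'] at hm
        have hβ := β.2
        rcases hm with ⟨e1, e2⟩ | ⟨e1, e2⟩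
        · left; rw [← e1, ← e2, Idx.neg_neg']; exact hβ
        · right; rw [← e1, ← e2, Idx.neg_neg']; exact hβ
      have bwd : ∀ i j, (w i, -w j) ∈ D₂ → (i, -j) ∈ D₁ ∨ (j, -i) ∈ D₁ := by
        intro i j h
        obtain ⟨γ, hm, -⟩ := hβ ⟨_, h⟩
        rw [weylMapsTo_iff hw (h₂.isRoot _ h)] at hm
        simp only [Idx.neg_neg', EmbeddingLike.apply_eq_iff_eq] at hm
        have hγ := γ.2
        rcases hm with ⟨e1, e2⟩ | ⟨e1, e2⟩
        · left; rw [e1, e2, Idx.neg_neg']; exact hγ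
        · right; rw [e1, e2, Idx.neg_neg']; exact hγ
      constructor
      · rintro (h | h)
        · exact bwd i j h
        · exact (bwd j i h).symm
      · rintro (h | h)
        · exact fwd i j h
        · exact (fwd j i h).symm
    refine ⟨w, hw, hs, fun i => ?_⟩
    by_cases h0 : (rookMatrix D₁ φ₁ * formMatrix K t n) i i = 0
    · rw [h0]
      by_contra h
      exact (hs i i).1 h h0
    · have hi : (i, -i) ∈ D₁ := ((rookMatrix_ne_zero_iff h₁.isRoot φ₁ i i).1 h0).elim id id
      obtain ⟨β, hm, e⟩ := hγ ⟨_, hi⟩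
      rw [weylMapsTo_iff hw (h₂.isRoot _ β.2)] at hm
      simp only [Idx.neg_neg', or_self] at hm
      have hβ' : β.1 = (w i, -w i) := Prod.ext hm.1 (by rw [← hm.2, Idx.neg_neg'])
      have hwi : (w i, -w i) ∈ D₂ := hβ' ▸ β.2
      have : β = ⟨_, hwi⟩ := Subtype.ext hβ'
      rw [h₁.diag_apply hi, h₂.diag_apply hwi, ← this, e]
      have hb : I.block (w i) = I.block i := hw i
      rw [hb]

end IsBasicPair

/-- `D` is read off from the support of `Y` and `φ` from its loops. The edge coefficients of `Y` are
forgotten, which `CombEquiv` permits. -/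
theorem exists_isBasicPair (h2 : (2 : K) ≠ 0) (hδ1 : δ ≠ 1) {Y : Mat K t n}
    (hY : ∀ i j, Y j i = formEta K t * Y i j) (hY0 : ∀ i j, I.block i + I.block j = 0 → Y i j = 0)
    (hg : ∀ i, GoodRow I.block (formEta K t) Y i)
    (hl : formEta K t = 1 → NormalLoops I.block (formSign K t) (δ : K) Y) :
    ∃ (D : Finset (Idx t n × Idx t n)) (φ : D → Kˣ), IsBasicPair I δ D φ ∧
      CombEquiv I.block Y (rookMatrix D φ * formMatrix K t n) := by
  classical
  have sw : ∀ i j, Y i j ≠ 0 → Y j i ≠ 0 := fun i j h => by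
    rw [hY]; exact mul_ne_zero formEta_ne_zero h
  have hd : ∀ i, Y i i ≠ 0 → t = Series.C := fun i hi => by
    rw [← formEta_eq_one_iff h2]
    exact mul_right_cancel₀ hi (by rw [one_mul]; exact (hY i i).symm)
  let D : Finset (Idx t n × Idx t n) :=
    Finset.univ.filter fun p => IsRoot p ∧ Y p.1 (-p.2) ≠ 0
  have hD : ∀ p, p ∈ D ↔ IsRoot p ∧ Y p.1 (-p.2) ≠ 0 := fun p => by simp [D]
  let φ : D → Kˣ := fun γ => if t = Series.C ∧ γ.1.2 = -γ.1.1 ∧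
    Y γ.1.1 γ.1.1 = formSign K t (I.block γ.1.1) * δ then δ else 1
  have hDr : ∀ γ ∈ D, IsRoot γ := fun γ hγ => ((hD γ).1 hγ).1
  have hU : ∀ p ∈ D ∪ D.image prime, Y p.1 (-p.2) ≠ 0 := by
    intro p hp
    rw [Finset.mem_union, Finset.mem_image] at hp
    rcases hp with hp | ⟨q, hq, rfl⟩
    · exact ((hD p).1 hp).2
    · simp only [prime, Idx.neg_neg']
      exact sw _ _ ((hD q).1 hq).2
  have hφ : ∀ γ, φ γ ≠ 1 → φ γ = δ ∧ t = Series.C ∧ γ.1.2 = -γ.1.1 ∧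
      Y γ.1.1 γ.1.1 = formSign K t (I.block γ.1.1) * δ := by
    intro γ h
    simp only [φ] at h ⊢
    split_ifs at h ⊢ with h'
    · exact ⟨rfl, h'⟩
    · exact absurd rfl h
  have hφδ : ∀ γ, φ γ = δ → t = Series.C ∧ γ.1.2 = -γ.1.1 ∧
      Y γ.1.1 γ.1.1 = formSign K t (I.block γ.1.1) * δ := fun γ h => (hφ γ (h ▸ hδ1)).2
  have hB : IsBasicPair I δ D φ := by
    refine ⟨fun γ hγ => ⟨hDr γ hγ, fun h => ?_⟩, fun p hp q hq hpq => ?_, fun ht γ => ?_,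
      fun _ γ => ?_, fun _ γ h => (hφδ γ h).2.1, fun ht γ hγ h => ?_,
      fun ht γ₁ γ₂ _ _ hb h₁ h₂ => ?_⟩
    · exact ((hD γ).1 hγ).2 (hY0 _ _ (by rw [I.symmetric, h, add_neg_cancel]))
    · obtain ⟨g1, g2, -⟩ := hg _ _ (hU p hp)
      have hq' := hU q hq
      rcases hpq with h | h
      · rw [← h] at hq'
        exact Prod.ext h (Idx.neg_inj.1 (g1 _ hq')).symm
      · rw [← h] at hq'
        exact Prod.ext (g2 _ hq').symm h
    · by_contra h
      exact ht (hφ γ h).2.1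
    · by_cases h : φ γ = 1
      · exact Or.inl h
      · exact Or.inr (hφ γ h).1
    · have := (hg _ _ ((hD γ).1 hγ).2).2.2 ((formEta_eq_one_iff h2).2 ht)
        (by rw [I.symmetric, h, neg_neg])
      exact Idx.eq_neg_iff.1 this
    · obtain ⟨-, a1, a2⟩ := hφδ γ₁ h₁
      obtain ⟨-, c1, c2⟩ := hφδ γ₂ h₂
      have e := (hl ((formEta_eq_one_iff h2).2 ht)).unique _ _ hb a2 c2
      exact Subtype.ext (Prod.ext e (by rw [a1, c1, e]))
  have hs : ∀ i j, (rookMatrix D φ * formMatrix K t n) i j ≠ 0 ↔ Y i j ≠ 0 := by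
    intro i j
    rw [rookMatrix_ne_zero_iff hDr, hD, hD]
    simp only [Idx.neg_neg']
    constructor
    · rintro (h | h)
      · exact h.2
      · exact sw _ _ h.2
    · intro h
      have hij : i ≠ j ∨ t = Series.C := by
        by_cases hij : i = j
        · subst hij; exact Or.inr (hd i h)
        · exact Or.inl hij
      exact (isRoot_or (I := I) i j (fun h' => h (hY0 i j h')) hij).imp
        (fun h' => ⟨h', h⟩) (fun h' => ⟨h', sw _ _ h⟩)
  -- The supports coincide, so the identity permutation serves.
  refine ⟨D, φ, hB, 1, fun _ => rfl, hs, fun i => ?_⟩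
  simp only [Equiv.Perm.coe_one, id]
  by_cases h0 : Y i i = 0
  · rw [h0]
    by_contra h
    exact (hs i i).1 h h0
  · have hi : (i, -i) ∈ D :=
      ((rookMatrix_ne_zero_iff hDr φ i i).1 ((hs i i).2 h0)).elim id id
    have ht := hd i h0
    rw [hB.diag_apply hi]
    by_cases hi' : Y i i = formSign K t (I.block i) * δ
    · have : φ ⟨(i, -i), hi⟩ = δ := if_pos ⟨ht, rfl, hi'⟩
      rw [this, hi']
    · have : φ ⟨(i, -i), hi⟩ = 1 := if_neg fun h => hi' h.2.2
      rw [this, ((hl ((formEta_eq_one_iff h2).2 ht)).values i h0).resolve_right hi']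
      simp

end Roots

end ParabolicContraction

theorem mainTheorem5 {K : Type*} [Field K] [Finite K] (hK : ringChar K ≠ 2)
    (δ : Kˣ) (hδ : ¬ IsSquare δ)
    (t : ParabolicContraction.Series) (n : ℕ)
    (I : ParabolicContraction.SymmetricPartition t n) :
    (∀ X ∈ ParabolicContraction.nilradical (K := K) I,
      ∃ (D : Finset (ParabolicContraction.Idx t n × ParabolicContraction.Idx t n))
        (φ : D → Kˣ),
        ParabolicContraction.IsBasicPair I δ D φ ∧
        ParabolicContraction.SameOrbit I X (ParabolicContraction.rookMatrix D φ)) ∧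
    (∀ (D₁ : Finset (ParabolicContraction.Idx t n × ParabolicContraction.Idx t n))
        (φ₁ : D₁ → Kˣ)
        (D₂ : Finset (ParabolicContraction.Idx t n × ParabolicContraction.Idx t n))
        (φ₂ : D₂ → Kˣ),
        ParabolicContraction.IsBasicPair I δ D₁ φ₁ →
        ParabolicContraction.IsBasicPair I δ D₂ φ₂ →
        (ParabolicContraction.SameOrbit I (ParabolicContraction.rookMatrix D₁ φ₁)
            (ParabolicContraction.rookMatrix D₂ φ₂) ↔
          ParabolicContraction.WeylConjugate I D₁ φ₁ D₂ φ₂)) := by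
  have h2 : (2 : K) ≠ 0 := Ring.two_ne_zero hK
  have hδ' : ¬ IsSquare (δ : K) := by
    rintro ⟨r, hr⟩
    have hr0 : r ≠ 0 := fun h => δ.ne_zero (by rw [hr, h, mul_zero])
    exact hδ ⟨Units.mk0 r hr0, Units.ext (by simpa using hr)⟩
  have hδ1 : δ ≠ 1 := fun h => hδ (h ▸ IsSquare.one)
  have hη := ParabolicContraction.formEta_eq (K := K) (t := t)
  have hη0 := ParabolicContraction.formEta_ne_zero (K := K) (t := t)
  refine ⟨fun X hX => ?_, fun D₁ φ₁ D₂ φ₂ h₁ h₂ => ?_⟩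
  · obtain ⟨hX0, hXs⟩ := ParabolicContraction.mem_nilradical_iff.1 hX
    obtain ⟨Y, hf, hYs, hY0, hg, hl⟩ := ParabolicContraction.exists_formOrbit_normal h2 hη hXs hX0
      (ParabolicContraction.formSign K t) (fun k => ParabolicContraction.formSign_ne_zero k) hδ'
    obtain ⟨D, φ, hB, hc⟩ := ParabolicContraction.exists_isBasicPair h2 hδ1 hYs hY0 hg hl
    refine ⟨D, φ, hB, ParabolicContraction.sameOrbit_iff.2 (hf.trans ?_)⟩
    exact hc.formOrbit hη0 hYs (ParabolicContraction.rookMatrix_symm hB.isRoot φ)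
      fun i j j' h h' => ((hg i j h).1 j' h').symm
  · rw [ParabolicContraction.sameOrbit_iff, ← h₁.combEquiv_iff h₂]
    refine ⟨fun hf => ?_, fun hc => ?_⟩
    · exact hf.combEquiv h2 hη (fun i j hij => I.monotone i j hij)
        (fun k => ParabolicContraction.formSign_ne_zero k) hδ'
        (ParabolicContraction.rookMatrix_symm h₁.isRoot φ₁)
        (ParabolicContraction.rookMatrix_symm h₂.isRoot φ₂)
        (h₁.goodRow h2) (h₂.goodRow h2) (h₁.normalLoops h2) (h₂.normalLoops h2)
    · exact hc.formOrbit hη0 (ParabolicContraction.rookMatrix_symm h₁.isRoot φ₁)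
        (ParabolicContraction.rookMatrix_symm h₂.isRoot φ₂)
        fun i j j' h h' => ((h₁.goodRow h2 i j h).1 j' h').symm
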